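/- **Torus, potential, weight function.** Let $d,N\in\mathbb N$ with $N\ge 2$ and let $\lambda>0$. For even $L\ge 2$ let $\mathbb T_L=\mathbb Z^d/L\mathbb Z^d$, with representatives in $(-L/2,L/2]^d$, be viewed as the simple nearest-neighbour graph with edge set $\mathbb E_L$. Let $v:\mathbb Z^d\to\mathbb R$ satisfy $v(x)=v(-x)$ and put $v_L(x,y)=\sum_{z\in\mathbb Z^d}v(y+Lz-x)$. Suppose that $v$ is - *tempered*: $\sum_x|v(x)|<\infty$ and $\bar v:=v(0)+\sum_{x}v(x)\mathbf 1_{\{v(x)<0\}}\ge 0$; - *separable*: for every even $L\ge 2$ and every $i\in\{1,\dots,d\}$ there are $k\in\mathbb N$, a finite measure space $(T,\nu)$ and bounded measurable $\alpha,\tilde\alpha:T\times\mathbb T_L\to\mathbb C^k$ with $-v_L(x,y)=\int_T\sum_{j=1}^k\alpha_j(t,x)\tilde\alpha_j(t,y)\,d\nu(t)$ whenever $x_i>0\ge y_i$, and $\tilde\alpha(t,x)=\overline{\alpha(t,\theta_ix)}$ for $\nu$-a.e. $t$ and all $x$, where $\theta_i$ is the reflection $x_i\mapsto 1-x_i$ through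 the plane $x_i=\tfrac12$, which cuts edges in their midpoints. Let $U:\mathbb N_0\to[0,\infty)$ be not identically zero and *good*: there is $M<\infty$ with $n\,\bar U(n+1)\le M\,\bar U(n)$ for all $n\ge 0$, where $\bar U(n)=U(n)e^{-\bar v n^2}$. **Random path model.** A configuration $w=(m,c,\pi,g)$ consists of: - link numbers $m\in\mathbb N_0^{\mathbb E_L}$ such that every vertex is touched by an even number of links (each edge $e$ carries links $(e,1),\dots,(e,m_e)$, which touch both endpoints of $e$); - a colour in $\{1,\dots,N\}$ for each link; - for each vertex $x$, a partition $\pi_x$ of the links touching $x$ into blocks of at most two links of equal colour (two links in a block are *paired at $x$*, a link alone in its block is *unpaired at $x$*); - ghost pairings $g_x\in\{0,1,2\}$ at each vertex $x$. Let $u_x^i$ be the number of links of colour $i$ unpaired at $x$, let $u_x=\sum_iu_x^i$, and let $n_x$ be the number of two-element blocks of $\pi_x$ plus $g_x$. Set $$\mu(w)=\prod_{e\in\mathbb E_L}\frac{\lambda^{m_e}}{m_e!}\;\prod_{x\in\mathbb T_L}U(n_x)\;\exp\Big(-\sum_{x,y\in\mathbb T_L}v_L(x,y)\,n_xn_y\Big).$$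 Let $\tilde{\mathcal W}$ be the set of configurations with $u_z=g_z=0$ for all $z$, let $\mathbb Z^\ell=\mu(\tilde{\mathcal W})$, and let $\mathbb E$ be the expectation under the probability measure $\mu/\mathbb Z^\ell$ on $\tilde{\mathcal W}$. For $w\in\tilde{\mathcal W}$, following the pairings decomposes the links into closed paths (cycles, unrooted and unoriented); let $\tilde{\mathcal N}_{x,y}(w)$ be the number of closed paths of $w$ that visit both $x$ and $y$. For $x\ne y$ let $\mathcal W_{x,y}$ be the set of configurations with $u_z=g_z=0$ for $z\notin\{x,y\}$ and with $u_z^1=u_z^2=1$, $u_z^i=0$ for $i\ge 3$, and $g_z=2$, for $z\in\{x,y\}$. Define the two-point function $$\mathbb G(x,y)=\lambda^2\,\frac{\mu(\mathcal W_{x,y})}{\mathbb Z^\ell}.$$ **Proposition.** There is a constant $c>0$, depending only on $d,N,\lambda,v,U$, such that for all even $L\ge 2$ one has $0<\mathbb Z^\ell<\infty$, and for all $x,y\in\mathbb T_L$ with $x\ne y$ the quantities $\mathbb G(x,y)$ and $\mathbb E(\tilde{\mathcal N}_{x,y})$ are finite and $$\mathbb E\big(\tilde{\mathcal N}_{x,y}\big)\;\ge\;c\,\mathbb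 G(x,y)^4 .$$ -/

import Mathlib

open MeasureTheory

noncomputable section

namespace RandomPath

/-! ### The random path model on a finite simple graph -/

section Graph

/-- The links of a link configuration `m`: the pairs `(e, p)` with `p` one of the `m e` labels. -/
abbrev Link {V : Type} {G : SimpleGraph V} (m : G.edgeSet → ℕ) : Type :=
  Σ e : G.edgeSet, Fin (m e)

/-- The links touching the vertex `x`. -/
abbrev LinkAt {V : Type} {G : SimpleGraph V} (m : G.edgeSet → ℕ) (x : V) : Type :=
  {l : Link m // x ∈ (l.1 : Sym2 V)}

open scoped Classical in
/-- A configuration `w = (m, c, π, g)` of the random path model with `N` colours.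
The pairing `π_x`, a partition of the links touching `x` into blocks of at most two links of the
same colour, is encoded by the involution `partner x` exchanging the two elements of each
two-element block; its fixed points are the links which are unpaired at `x`. -/
structure Config {V : Type} [Fintype V] (G : SimpleGraph V) (N : ℕ) where
  /-- link cardinalities -/
  links : G.edgeSet → ℕ
  /-- every vertex is touched by an even number of links -/
  even_links : ∀ x : V, Even (∑ e : G.edgeSet, if x ∈ (e : Sym2 V) then links e else 0)
  /-- colours of the links -/
  colour : (e : G.edgeSet) → Fin (links e) → Fin N
  /-- pairings -/
  partner : (x : V) → LinkAt links x → LinkAt links x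
  partner_involutive : ∀ x, Function.Involutive (partner x)
  colour_partner : ∀ (x : V) (l : LinkAt links x),
    colour (partner x l).1.1 (partner x l).1.2 = colour l.1.1 l.1.2
  /-- ghost pairings, with values in `{0, 1, 2}` -/
  ghost : V → Fin 3

variable {V : Type} [Fintype V] {G : SimpleGraph V} {N : ℕ}

/-- `u_x^i`: the number of links of colour `i` touching `x` which are unpaired at `x`. -/
def Config.unpairedColour (w : Config G N) (x : V) (i : Fin N) : ℕ :=
  Nat.card {l : LinkAt w.links x // w.partner x l = l ∧ w.colour l.1.1 l.1.2 = i}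

/-- `u_x`: the number of links touching `x` which are unpaired at `x`. -/
def Config.unpaired (w : Config G N) (x : V) : ℕ :=
  ∑ i : Fin N, w.unpairedColour x i

/-- `n_x`: the number of pairings at `x`, ghost or not. Each non-ghost pairing consists of exactly
two links which are not fixed by the involution, so that the division by two is exact. -/
def Config.numPairings (w : Config G N) (x : V) : ℕ :=
  Nat.card {l : LinkAt w.links x // w.partner x l ≠ l} / 2 + (w.ghost x : ℕ)

/-- `V(w) = ∑_{x, y} v(x, y) n_x(w) n_y(w)`. -/
def Config.energy (v : V → V → ℝ) (w : Config G N) : ℝ :=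
  ∑ x : V, ∑ y : V, v x y * (w.numPairings x : ℝ) * (w.numPairings y : ℝ)

open scoped Classical in
/-- The weight `μ(w)` of a configuration. -/
def Config.weight (U : ℕ → ℝ) (v : V → V → ℝ) (lam : ℝ) (w : Config G N) : ℝ :=
  (∏ e : G.edgeSet, lam ^ w.links e / ((w.links e).factorial : ℝ)) *
    (∏ x : V, U (w.numPairings x)) * Real.exp (-w.energy v)

/-- The configurations without unpaired links and without ghost pairings: all paths are closed. -/
def closedConfigs (G : SimpleGraph V) (N : ℕ) : Set (Config G N) :=
  {w | ∀ x : V, w.unpaired x = 0 ∧ w.ghost x = 0}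

/-- For `x ≠ y`, the configurations with exactly one unpaired link of each of the first two colours,
no unpaired link of another colour, and two ghost pairings, at each of `x` and `y`, and with no
unpaired link and no ghost pairing at all other vertices. -/
def twoPathConfigs (G : SimpleGraph V) (N : ℕ) (x y : V) : Set (Config G N) :=
  {w | (∀ z : V, z ≠ x → z ≠ y → w.unpaired z = 0 ∧ w.ghost z = 0) ∧
    ∀ z : V, z = x ∨ z = y →
      (∀ i : Fin N, w.unpairedColour z i = if (i : ℕ) < 2 then 1 else 0) ∧ w.ghost z = 2}

/-- The measure `μ(A)` of a set of configurations. -/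
def mass (U : ℕ → ℝ) (v : V → V → ℝ) (lam : ℝ) (A : Set (Config G N)) : ℝ :=
  ∑' w : A, w.1.weight U v lam

/-- The partition function of the model with closed paths only. -/
def partitionFunction (G : SimpleGraph V) (N : ℕ) (U : ℕ → ℝ) (v : V → V → ℝ) (lam : ℝ) : ℝ :=
  mass U v lam (closedConfigs G N)

/-- Expectation with respect to the probability measure on configurations of closed paths whose
weights are proportional to `Config.weight`. -/
def expectation (U : ℕ → ℝ) (v : V → V → ℝ) (lam : ℝ) (f : Config G N → ℝ) : ℝ :=
  (∑' w : closedConfigs G N, w.1.weight U v lam * f w.1) / partitionFunction G N U v lam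

/-- The two-point function `λ² Z(x, y) / Z` at two distinct vertices `x ≠ y`. -/
def twoPoint (G : SimpleGraph V) (N : ℕ) (U : ℕ → ℝ) (v : V → V → ℝ) (lam : ℝ) (x y : V) : ℝ :=
  lam ^ 2 * (mass U v lam (twoPathConfigs G N x y) / partitionFunction G N U v lam)

/-- `l'` is the link following `l` along a path of `w`, through some endpoint of `l`. -/
def Config.Follows (w : Config G N) (l l' : Link w.links) : Prop :=
  ∃ (x : V) (h : x ∈ (l.1 : Sym2 V)), (w.partner x ⟨l, h⟩).1 = l'

/-- The paths of `w`: the classes of links connected through successive pairings. When `w` is a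
configuration of closed paths, every link has one successor at each of its two endpoints, and
these are the cycles of `w` (neither rooted nor oriented). -/
def Config.Cycle (w : Config G N) : Type :=
  Quotient (Relation.EqvGen.setoid w.Follows)

/-- The cycle `χ` visits the vertex `x`: one of its links touches `x`. -/
def Config.Visits (w : Config G N) (χ : w.Cycle) (x : V) : Prop :=
  ∃ l : Link w.links,
    Quotient.mk (Relation.EqvGen.setoid w.Follows) l = χ ∧ x ∈ (l.1 : Sym2 V)

/-- The number of cycles of `w` visiting both `x` and `y`. -/
def Config.numCycles (w : Config G N) (x y : V) : ℕ :=
  Nat.card {χ : w.Cycle // w.Visits χ x ∧ w.Visits χ y}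

end Graph

/-! ### The torus, the potential and the weight function -/

section Torus

/-- The vertices of the torus `ℤ^d / L ℤ^d`. The representative of `x` with coordinates in
`(-L/2, L/2]` is `fun i => (x i).valMinAbs`. -/
abbrev Torus (d L : ℕ) : Type := Fin d → ZMod L

/-- The nearest-neighbour graph on the torus (a simple graph, also for `L = 2`). -/
def torusGraph (d L : ℕ) : SimpleGraph (Torus d L) :=
  SimpleGraph.fromRel fun x y => ∃ i : Fin d, y = x + Pi.single i 1

/-- The periodised potential `v_L(x, y) = ∑_{z ∈ ℤ^d} v(y + L z - x)`. -/
def periodised {d : ℕ} (v : (Fin d → ℤ) → ℝ) (L : ℕ) (x y : Torus d L) : ℝ :=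
  ∑' z : Fin d → ℤ, v fun i => (y i).valMinAbs + (L : ℤ) * z i - (x i).valMinAbs

open scoped Classical in
/-- `v̄ = v(0) + ∑_x v(x) 1_{v(x) < 0}`. -/
def vbar {d : ℕ} (v : (Fin d → ℤ) → ℝ) : ℝ :=
  v 0 + ∑' x : Fin d → ℤ, if v x < 0 then v x else 0

/-- Tempered potentials. -/
def IsTempered {d : ℕ} (v : (Fin d → ℤ) → ℝ) : Prop :=
  0 ≤ vbar v ∧ Summable fun x => |v x|

/-- The reflection of the torus exchanging `0` and `1` in direction `i`, that is, the reflection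
through the plane `x_i = 1/2`, which cuts edges in their midpoints. -/
def reflect {d L : ℕ} (i : Fin d) (x : Torus d L) : Torus d L :=
  Function.update x i (1 - x i)

/-- Separability of `v_L` in direction `i`. The plane `x_i = 1/2` splits the torus into the halves
`0 < x_i ≤ L/2` and `-L/2 < x_i ≤ 0`; by translation invariance the choice of the plane among
those orthogonal to direction `i` and cutting edges in their midpoints is irrelevant. -/
def IsSeparableAlong {d : ℕ} (v : (Fin d → ℤ) → ℝ) (L : ℕ) (i : Fin d) : Prop :=
  ∃ (k : ℕ) (T : Type) (_ : MeasurableSpace T) (ν : Measure T)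
    (α β : T → Torus d L → Fin k → ℂ),
    IsFiniteMeasure ν ∧
    (∀ x j, Measurable fun t => α t x j) ∧ (∀ x j, Measurable fun t => β t x j) ∧
    (∃ B : ℝ, ∀ t x j, ‖α t x j‖ ≤ B ∧ ‖β t x j‖ ≤ B) ∧
    (∀ x y : Torus d L, 0 < (x i).valMinAbs → (y i).valMinAbs ≤ 0 →
      ((-periodised v L x y : ℝ) : ℂ) = ∫ t, ∑ j, α t x j * β t y j ∂ν) ∧
    ∀ x : Torus d L, ∀ᵐ t ∂ν, ∀ j, β t x j = (starRingEnd ℂ) (α t (reflect i x) j)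

/-- Separable potentials. -/
def IsSeparable {d : ℕ} (v : (Fin d → ℤ) → ℝ) : Prop :=
  ∀ L : ℕ, 0 < L → Even L → ∀ i : Fin d, IsSeparableAlong v L i

/-- Good weight functions for the potential `v`: with `Ū(n) = U(n) exp(-v̄ n²)`, there is `M` with
`n Ū(n + 1) ≤ M Ū(n)` for all `n`. -/
def IsGood {d : ℕ} (v : (Fin d → ℤ) → ℝ) (U : ℕ → ℝ) : Prop :=
  ∃ M : ℝ, ∀ n : ℕ,
    (n : ℝ) * (U (n + 1) * Real.exp (-vbar v * ((n + 1 : ℕ) : ℝ) ^ 2)) ≤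
      M * (U n * Real.exp (-vbar v * (n : ℝ) ^ 2))

end Torus

end RandomPath

end

noncomputable section

namespace RandomPath

section PositiveKernels

open scoped MatrixOrder Matrix.Norms.L2Operator

/-- Powers of a Gram kernel are positive semidefinite. -/
lemma sum_mul_gram_pow_nonneg {ι κ : Type*} [Fintype ι] [Fintype κ] (ξ : κ → ι → ℝ) (j : ℕ) :
    ∀ g : ι → ℝ, 0 ≤ ∑ p, ∑ q, g p * g q * (∑ k, ξ k p * ξ k q) ^ j := by
  induction j with
  | zero =>
    intro g
    have : ∑ p, ∑ q, g p * g q * (∑ k, ξ k p * ξ k q) ^ 0 = (∑ p, g p) ^ 2 := by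
      simp [sq, Finset.sum_mul_sum]
    rw [this]; positivity
  | succ j ih =>
    intro g
    have : ∑ p, ∑ q, g p * g q * (∑ k, ξ k p * ξ k q) ^ (j + 1) =
        ∑ k, ∑ p, ∑ q, (g p * ξ k p) * (g q * ξ k q) * (∑ k, ξ k p * ξ k q) ^ j := by
      symm
      refine Finset.sum_comm.trans (Finset.sum_congr rfl fun p _ => ?_)
      refine Finset.sum_comm.trans (Finset.sum_congr rfl fun q _ => ?_)
      rw [← Finset.sum_mul, pow_succ, mul_comm (_ ^ j), ← mul_assoc, Finset.mul_sum]
      congr 1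
      exact Finset.sum_congr rfl fun k _ => by ring
    rw [this]
    exact Finset.sum_nonneg fun k _ => ih fun p => g p * ξ k p

lemma sum_mul_exp_gram_nonneg {ι κ : Type*} [Fintype ι] [Fintype κ] (ξ : κ → ι → ℝ) (g : ι → ℝ) :
    0 ≤ ∑ p, ∑ q, g p * g q * Real.exp (∑ k, ξ k p * ξ k q) := by
  have h : HasSum (fun j : ℕ => ∑ p, ∑ q, g p * g q *
      ((∑ k, ξ k p * ξ k q) ^ j / (j.factorial : ℝ)))
      (∑ p, ∑ q, g p * g q * Real.exp (∑ k, ξ k p * ξ k q)) := by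
    refine hasSum_sum fun p _ => hasSum_sum fun q _ => HasSum.mul_left _ ?_
    rw [Real.exp_eq_exp_ℝ]
    exact NormedSpace.expSeries_div_hasSum_exp (𝔸 := ℝ) _
  refine h.nonneg fun j => ?_
  have := sum_mul_gram_pow_nonneg ξ j g
  have e : ∑ p, ∑ q, g p * g q * ((∑ k, ξ k p * ξ k q) ^ j / (j.factorial : ℝ)) =
      (∑ p, ∑ q, g p * g q * (∑ k, ξ k p * ξ k q) ^ j) / (j.factorial : ℝ) := by
    simp only [Finset.sum_div, mul_div_assoc]
  rw [e]; positivity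

/-- The exponential of a positive semidefinite form is a positive semidefinite kernel. -/
lemma sum_mul_exp_form_nonneg {ι V : Type*} [Fintype ι] [Fintype V] (b : V → V → ℝ)
    (hsymm : ∀ x y, b x y = b y x) (hb : ∀ c : V → ℝ, 0 ≤ ∑ x, ∑ y, c x * c y * b x y)
    (n : ι → V → ℝ) (g : ι → ℝ) :
    0 ≤ ∑ p, ∑ q, g p * g q * Real.exp (∑ x, ∑ y, b x y * n p x * n q y) := by
  classical
  have hpsd : (Matrix.of b).PosSemidef := by
    refine Matrix.PosSemidef.of_dotProduct_mulVec_nonneg ?_ fun c => ?_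
    · ext x y; simp [hsymm x y]
    · have := hb c
      simp only [dotProduct, Matrix.mulVec, Finset.mul_sum]
      convert! this using 1
      refine Finset.sum_congr rfl fun x _ => Finset.sum_congr rfl fun y _ => ?_
      simp; ring
  obtain ⟨B, hB⟩ := CStarAlgebra.nonneg_iff_eq_star_mul_self.mp
    (Matrix.nonneg_iff_posSemidef.mpr hpsd)
  have hB' : ∀ x y, b x y = ∑ k, B k x * B k y := fun x y => by
    have := congrFun (congrFun hB x) y
    simpa [Matrix.mul_apply] using this
  have := sum_mul_exp_gram_nonneg (fun k p => ∑ x, B k x * n p x) g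
  have e : ∀ p q, ∑ x, ∑ y, b x y * n p x * n q y =
      ∑ k, (∑ x, B k x * n p x) * ∑ x, B k x * n q x := fun p q => by
    simp_rw [Finset.sum_mul_sum, hB', Finset.sum_mul]
    symm
    refine Finset.sum_comm.trans (Finset.sum_congr rfl fun x _ => ?_)
    refine Finset.sum_comm.trans (Finset.sum_congr rfl fun y _ => ?_)
    exact Finset.sum_congr rfl fun k _ => by ring
  simpa only [e] using this

/-- Cauchy-Schwarz for a positive semidefinite kernel. -/
lemma sq_le_of_kernel_nonneg {R ι : Type*} [Fintype R] [Fintype ι] (k : R → ι → ι → ℝ)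
    (hsymm : ∀ r p q, k r p q = k r q p)
    (hk : ∀ r (g : ι → ℝ), 0 ≤ ∑ p, ∑ q, g p * g q * k r p q) (g h : R → ι → ℝ) :
    (∑ r, ∑ p, ∑ q, g r p * h r q * k r p q) ^ 2 ≤
      (∑ r, ∑ p, ∑ q, g r p * g r q * k r p q) * ∑ r, ∑ p, ∑ q, h r p * h r q * k r p q := by
  set a := ∑ r, ∑ p, ∑ q, g r p * g r q * k r p q
  set b := ∑ r, ∑ p, ∑ q, g r p * h r q * k r p q with hb
  set c := ∑ r, ∑ p, ∑ q, h r p * h r q * k r p q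
  have hb' : b = ∑ r, ∑ p, ∑ q, h r p * g r q * k r p q := by
    refine Finset.sum_congr rfl fun r _ => ?_
    rw [Finset.sum_comm]
    exact Finset.sum_congr rfl fun p _ => Finset.sum_congr rfl fun q _ => by
      rw [hsymm]; ring
  have key : ∀ t : ℝ, 0 ≤ c * (t * t) + 2 * b * t + a := fun t => by
    have h0 : 0 ≤ ∑ r, ∑ p, ∑ q, (g r p + t * h r p) * (g r q + t * h r q) * k r p q :=
      Finset.sum_nonneg fun r _ => hk r fun p => g r p + t * h r p
    have e : ∑ r, ∑ p, ∑ q, (g r p + t * h r p) * (g r q + t * h r q) * k r p q =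
        a + t * b + t * b + t * t * c := by
      nth_rewrite 2 [hb']
      simp only [a, b, c, Finset.mul_sum, ← Finset.sum_add_distrib]
      exact Finset.sum_congr rfl fun r _ => Finset.sum_congr rfl fun p _ =>
        Finset.sum_congr rfl fun q _ => by ring
    linarith
  have := discrim_le_zero key
  rw [discrim] at this
  nlinarith

end PositiveKernels

section Chessboard

variable {V : Type*}

/-- A reflection of a graph through a plane which cuts edges in their midpoints. -/
structure Reflection (G : SimpleGraph V) where
  /-- the reflection -/
  toFun : V → V
  /-- one of the two halves -/
  half : V → Prop
  invol : ∀ x, toFun (toFun x) = x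
  adj : ∀ {x y}, G.Adj x y → G.Adj (toFun x) (toFun y)
  half_iff : ∀ x, half (toFun x) ↔ ¬ half x
  crossing : ∀ {x y}, G.Adj x y → half x → ¬ half y → y = toFun x

namespace Reflection

variable {G : SimpleGraph V} (θ : Reflection G)

open scoped Classical in
/-- The point of the chosen half which is equal to `x` up to a reflection. -/
def fold (x : V) : V := if θ.half x then x else θ.toFun x

open scoped Classical in
/-- The reflected copy in the other half. -/
def cofold (x : V) : V := if θ.half x then θ.toFun x else x

lemma fold_of_half {x : V} (h : θ.half x) : θ.fold x = x := if_pos h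
lemma fold_of_not_half {x : V} (h : ¬ θ.half x) : θ.fold x = θ.toFun x := if_neg h
lemma cofold_of_half {x : V} (h : θ.half x) : θ.cofold x = θ.toFun x := if_pos h
lemma cofold_of_not_half {x : V} (h : ¬ θ.half x) : θ.cofold x = x := if_neg h

end Reflection

open scoped Classical in
/-- The abstract chessboard estimate: a function on sets of vertices with the reflection
Cauchy-Schwarz inequality is bounded by its value at the empty set. -/
theorem chessboard [Fintype V] {G : SimpleGraph V} (hG : G.Preconnected)
    (ψ : Finset V → ℝ) (hpos : ∀ S, 0 < ψ S) (huniv : ψ Finset.univ ≤ ψ ∅)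
    (hrefl : ∀ x y, G.Adj x y → ∃ θ : Reflection G, ¬ (θ.half x ↔ θ.half y) ∧
      ∀ S, ψ S ^ 2 ≤ ψ (Finset.univ.filter fun z => θ.fold z ∈ S) *
        ψ (Finset.univ.filter fun z => θ.cofold z ∈ S)) (S : Finset V) : ψ S ≤ ψ ∅ := by
  obtain ⟨S₀, -, hS₀⟩ := Finset.exists_max_image Finset.univ ψ ⟨∅, Finset.mem_univ _⟩
  let bd : Finset V → ℕ := fun S =>
    (Finset.univ.filter fun p : V × V => G.Adj p.1 p.2 ∧ p.1 ∈ S ∧ p.2 ∉ S).card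
  obtain ⟨S₁, hS₁, hmin⟩ := Finset.exists_min_image
    (Finset.univ.filter fun T => ψ S₀ ≤ ψ T) bd ⟨S₀, by simp⟩
  have hmax : ∀ T, ψ T ≤ ψ S₁ := fun T =>
    (hS₀ T (Finset.mem_univ _)).trans (Finset.mem_filter.mp hS₁).2
  have hmin' : ∀ T, ψ S₁ ≤ ψ T → bd S₁ ≤ bd T := fun T hT =>
    hmin T (Finset.mem_filter.mpr ⟨Finset.mem_univ _, (Finset.mem_filter.mp hS₁).2.trans hT⟩)
  suffices h : ψ S₁ ≤ ψ ∅ from (hmax S).trans h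
  by_cases hbd : ∃ x y, G.Adj x y ∧ x ∈ S₁ ∧ y ∉ S₁
  · exfalso
    obtain ⟨x, y, hxy, hx, hy⟩ := hbd
    obtain ⟨θ, hθxy, hθ⟩ := hrefl x y hxy
    set A := Finset.univ.filter fun z => θ.fold z ∈ S₁ with hA
    set B := Finset.univ.filter fun z => θ.cofold z ∈ S₁ with hB
    have h := hθ S₁
    have hA1 : ψ S₁ ≤ ψ A := by nlinarith [hmax A, hmax B, hpos S₁, hpos A, hpos B]
    have hB1 : ψ S₁ ≤ ψ B := by nlinarith [hmax A, hmax B, hpos S₁, hpos A, hpos B]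
    have hA2 := hmin' A hA1
    have hB2 := hmin' B hB1
    let ins := Finset.univ.filter fun p : V × V =>
      (G.Adj p.1 p.2 ∧ p.1 ∈ S₁ ∧ p.2 ∉ S₁) ∧ θ.half p.1 ∧ θ.half p.2
    let out := Finset.univ.filter fun p : V × V =>
      (G.Adj p.1 p.2 ∧ p.1 ∈ S₁ ∧ p.2 ∉ S₁) ∧ ¬ θ.half p.1 ∧ ¬ θ.half p.2
    have hS : ins.card + out.card + 1 ≤ bd S₁ := by
      have hd : Disjoint ins out := by
        rw [Finset.disjoint_left]; intro p hp hp'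
        simp only [ins, out, Finset.mem_filter] at hp hp'
        exact hp'.2.2.1 hp.2.2.1
      rw [← Finset.card_union_of_disjoint hd]
      refine Nat.succ_le_of_lt (Finset.card_lt_card ?_)
      rw [Finset.ssubset_iff_of_subset]
      · exact ⟨(x, y), by simp [hxy, hx, hy], by
          simp only [ins, out, Finset.mem_union, Finset.mem_filter]; tauto⟩
      · intro p hp
        simp only [ins, out, Finset.mem_union, Finset.mem_filter] at hp ⊢
        tauto
    have hbA : bd A ≤ ins.card + ins.card := by
      refine (Finset.card_le_card (t := ins ∪ ins.image fun p => (θ.toFun p.1, θ.toFun p.2))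
        ?_).trans ((Finset.card_union_le _ _).trans (Nat.add_le_add_left Finset.card_image_le _))
      rintro ⟨u, w⟩ hp
      simp only [hA, Finset.mem_filter, Finset.mem_univ, true_and] at hp
      obtain ⟨hadj, hu, hw⟩ := hp
      simp only [Finset.mem_union, Finset.mem_image, ins, Finset.mem_filter, Finset.mem_univ,
        true_and]
      by_cases h1 : θ.half u <;> by_cases h2 : θ.half w
      · left; rw [θ.fold_of_half h1] at hu; rw [θ.fold_of_half h2] at hw
        exact ⟨⟨hadj, hu, hw⟩, h1, h2⟩
      · exfalso; have := θ.crossing hadj h1 h2; subst this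
        simp_all [Reflection.fold, θ.invol]
      · exfalso; have := θ.crossing hadj.symm h2 h1; subst this
        simp_all [Reflection.fold, θ.invol]
      · right; rw [θ.fold_of_not_half h1] at hu; rw [θ.fold_of_not_half h2] at hw
        exact ⟨(θ.toFun u, θ.toFun w), ⟨⟨θ.adj hadj, hu, hw⟩, (θ.half_iff u).mpr h1,
          (θ.half_iff w).mpr h2⟩, by simp [θ.invol]⟩
    have hbB : bd B ≤ out.card + out.card := by
      refine (Finset.card_le_card (t := out ∪ out.image fun p => (θ.toFun p.1, θ.toFun p.2))
        ?_).trans ((Finset.card_union_le _ _).trans (Nat.add_le_add_left Finset.card_image_le _))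
      rintro ⟨u, w⟩ hp
      simp only [hB, Finset.mem_filter, Finset.mem_univ, true_and] at hp
      obtain ⟨hadj, hu, hw⟩ := hp
      simp only [Finset.mem_union, Finset.mem_image, out, Finset.mem_filter, Finset.mem_univ,
        true_and]
      by_cases h1 : θ.half u <;> by_cases h2 : θ.half w
      · right; rw [θ.cofold_of_half h1] at hu; rw [θ.cofold_of_half h2] at hw
        exact ⟨(θ.toFun u, θ.toFun w), ⟨⟨θ.adj hadj, hu, hw⟩, fun h => (θ.half_iff u).mp h h1,
          fun h => (θ.half_iff w).mp h h2⟩, by simp [θ.invol]⟩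
      · exfalso; have := θ.crossing hadj h1 h2; subst this
        simp_all [Reflection.cofold]
      · exfalso; have := θ.crossing hadj.symm h2 h1; subst this
        simp_all [Reflection.cofold]
      · left; rw [θ.cofold_of_not_half h1] at hu; rw [θ.cofold_of_not_half h2] at hw
        exact ⟨⟨hadj, hu, hw⟩, h1, h2⟩
    omega
  · push Not at hbd
    by_cases hne : S₁.Nonempty
    · obtain ⟨x, hx⟩ := hne
      have : S₁ = Finset.univ := by
        ext y; simp only [Finset.mem_univ, iff_true]
        have hr := (SimpleGraph.reachable_iff_reflTransGen x y).mp (hG x y)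
        induction hr with
        | refl => exact hx
        | tail _ hadj ih => exact hbd _ _ hadj ih
      rw [this]; exact huniv
    · rw [Finset.not_nonempty_iff_eq_empty.mp hne]

end Chessboard

end RandomPath
end

noncomputable section

namespace RandomPath

section EdgeStates

/-- The pairings of all elements of `X` into pairs of equal colour. -/
abbrev Matching {X : Type*} {N : ℕ} (col : X → Fin N) : Type _ :=
  {π : X → X // Function.Involutive π ∧ ∀ l, π l ≠ l ∧ col (π l) = col l}

/-- Pairings are transported by colour preserving equivalences. -/
def Matching.congr {X Y : Type*} {N : ℕ} {col : X → Fin N} {col' : Y → Fin N} (e : X ≃ Y)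
    (h : ∀ l, col' (e l) = col l) : Matching col ≃ Matching col' where
  toFun π := ⟨fun l => e (π.1 (e.symm l)), fun l => by simp [π.2.1 _], fun l => by
    refine ⟨fun hl => (π.2.2 (e.symm l)).1 (e.injective (by simpa using hl)), ?_⟩
    rw [h, (π.2.2 _).2, ← h, e.apply_symm_apply]⟩
  invFun π := ⟨fun l => e.symm (π.1 (e l)), fun l => by simp [π.2.1 _], fun l => by
    refine ⟨fun hl => (π.2.2 (e l)).1 (e.symm.injective (by simpa using hl)), ?_⟩
    rw [← h, e.apply_symm_apply, (π.2.2 _).2, h]⟩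
  left_inv π := by ext l; simp
  right_inv π := by ext l; simp

/-- The number and the colours of the links on an edge which carries at most `K` links. -/
abbrev EdgeState (N K : ℕ) : Type := Σ m : Fin (K + 1), (Fin m → Fin N)

variable {V : Type} {G : SimpleGraph V} {N K : ℕ}

/-- The number of pairings of the links touching `x`. -/
def pairingCount (s : G.edgeSet → EdgeState N K) (x : V) : ℕ :=
  Nat.card (Matching fun l : Σ e : {e : G.edgeSet // x ∈ (e : Sym2 V)}, Fin (s e.1).1 =>
    (s l.1.1).2 l.2)

lemma pairingCount_congr {s s' : G.edgeSet → EdgeState N K} {x : V}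
    (h : ∀ e : G.edgeSet, x ∈ (e : Sym2 V) → s e = s' e) :
    pairingCount s x = pairingCount s' x := by
  let f : ({e : G.edgeSet // x ∈ (e : Sym2 V)} → EdgeState N K) → ℕ := fun t =>
    Nat.card (Matching fun l : Σ e : {e : G.edgeSet // x ∈ (e : Sym2 V)}, Fin (t e).1 =>
      (t l.1).2 l.2)
  have : (fun e : {e : G.edgeSet // x ∈ (e : Sym2 V)} => s e.1) = fun e => s' e.1 :=
    funext fun e => h e.1 e.2
  exact congrArg f this

variable [Fintype V]

open scoped Classical in
/-- Half of the number of links touching `x`. -/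
def occupation (s : G.edgeSet → EdgeState N K) (x : V) : ℕ :=
  (∑ e : G.edgeSet, if x ∈ (e : Sym2 V) then ((s e).1 : ℕ) else 0) / 2

lemma occupation_congr {s s' : G.edgeSet → EdgeState N K} {x : V}
    (h : ∀ e : G.edgeSet, x ∈ (e : Sym2 V) → s e = s' e) :
    occupation s x = occupation s' x := by
  unfold occupation
  congr 1
  refine Finset.sum_congr rfl fun e _ => ?_
  split_ifs with hx
  · rw [h e hx]
  · rfl

/-- The weight of the links on an edge. -/
def edgeWeight (lam : ℝ) (a : EdgeState N K) : ℝ := lam ^ (a.1 : ℕ) / ((a.1 : ℕ).factorial : ℝ)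

lemma edgeWeight_nonneg {lam : ℝ} (hlam : 0 ≤ lam) (a : EdgeState N K) : 0 ≤ edgeWeight lam a := by
  unfold edgeWeight; positivity

/-- The interaction energy of occupation numbers. -/
def interaction (v : V → V → ℝ) (n : V → ℕ) : ℝ := ∑ x, ∑ y, v x y * (n x : ℝ) * (n y : ℝ)

open scoped Classical in
/-- The weight of a choice of links and colours, summed over all pairings, with one-body
functions `u`. -/
def stateWeight (v : V → V → ℝ) (lam : ℝ) (u : V → ℕ → ℝ) (s : G.edgeSet → EdgeState N K) : ℝ :=
  (∏ e, edgeWeight lam (s e)) * (∏ x, (pairingCount s x : ℝ) * u x (occupation s x)) *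
    Real.exp (-interaction v (occupation s))

open scoped Classical in
/-- The total weight with at most `K` links on every edge. -/
def stateSum (G : SimpleGraph V) (N K : ℕ) (v : V → V → ℝ) (lam : ℝ) (u : V → ℕ → ℝ) : ℝ :=
  ∑ s : G.edgeSet → EdgeState N K, stateWeight v lam u s

end EdgeStates

section ReflectionPositivity

variable {V : Type} {G : SimpleGraph V} {N K : ℕ}

namespace Reflection

variable (θ : Reflection G)

/-- The action of a reflection on edges. -/
def edge (e : G.edgeSet) : G.edgeSet :=
  ⟨Sym2.map θ.toFun e.1, by
    obtain ⟨e, he⟩ := e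
    induction e using Sym2.ind with
    | _ x y => exact θ.adj he⟩

lemma edge_edge (e : G.edgeSet) : θ.edge (θ.edge e) = e := by
  apply Subtype.ext
  simp only [edge, Sym2.map_map]
  have : θ.toFun ∘ θ.toFun = id := funext θ.invol
  rw [this, Sym2.map_id, id]

/-- The action of a reflection on vertices, as a permutation. -/
def vertexEquiv : V ≃ V := ⟨θ.toFun, θ.toFun, θ.invol, θ.invol⟩

/-- The action of a reflection on edges, as a permutation. -/
def edgeEquiv : G.edgeSet ≃ G.edgeSet := ⟨θ.edge, θ.edge, θ.edge_edge, θ.edge_edge⟩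

lemma mem_edge {x : V} {e : G.edgeSet} : θ.toFun x ∈ (θ.edge e : Sym2 V) ↔ x ∈ (e : Sym2 V) := by
  simp only [edge, Sym2.mem_map]
  constructor
  · rintro ⟨y, hy, h⟩
    rwa [← θ.invol x, ← h, θ.invol]
  · exact fun h => ⟨x, h, rfl⟩

/-- The edges in the chosen half. -/
def Inner (e : G.edgeSet) : Prop := ∀ x ∈ (e : Sym2 V), θ.half x

lemma not_inner_edge {x : V} {e : G.edgeSet} (hx : x ∈ (e : Sym2 V)) (h : θ.half x) :
    ¬ θ.Inner (θ.edge e) := fun hi => (θ.half_iff x).mp (hi _ (θ.mem_edge.mpr hx)) h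

lemma Inner.not_edge {e : G.edgeSet} (h : θ.Inner e) : ¬ θ.Inner (θ.edge e) := by
  obtain ⟨e, he⟩ := e
  induction e using Sym2.ind with
  | _ x y => exact θ.not_inner_edge (Sym2.mem_mk_left x y) (h x (Sym2.mem_mk_left x y))

lemma edge_eq_self {e : G.edgeSet} (h : ¬ θ.Inner e) (h' : ¬ θ.Inner (θ.edge e)) :
    θ.edge e = e := by
  obtain ⟨e, he⟩ := e
  induction e using Sym2.ind with
  | _ x y =>
    have hxy : G.Adj x y := he
    apply Subtype.ext
    simp only [edge, Sym2.map_mk]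
    by_cases hx : θ.half x <;> by_cases hy : θ.half y
    · exact absurd (fun z hz => by rcases Sym2.mem_iff.mp hz with rfl | rfl <;> assumption) h
    · rw [θ.crossing hxy hx hy, θ.invol, Sym2.eq_swap]
    · rw [θ.crossing hxy.symm hy hx, θ.invol, Sym2.eq_swap]
    · refine absurd (fun z hz => ?_) h'
      simp only [edge, Sym2.map_mk] at hz
      rcases Sym2.mem_iff.mp hz with rfl | rfl <;> simpa [θ.half_iff]

open scoped Classical in
@[to_additive]
lemma prod_eq [Fintype V] {M : Type*} [CommMonoid M] (f : V → M) :
    ∏ x, f x = ∏ x, if θ.half x then f x * f (θ.toFun x) else 1 := by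
  have h1 : ∀ x, f x = (if θ.half x then f x else 1) * (if θ.half (θ.toFun x) then f x else 1) := by
    intro x
    by_cases h : θ.half x <;> simp [h, θ.half_iff]
  have h2 : ∏ x, (if θ.half (θ.toFun x) then f x else 1) =
      ∏ x, if θ.half x then f (θ.toFun x) else 1 :=
    Fintype.prod_equiv θ.vertexEquiv _ _ fun x => by simp [vertexEquiv, θ.invol]
  rw [Finset.prod_congr rfl fun x _ => h1 x, Finset.prod_mul_distrib, h2,
    ← Finset.prod_mul_distrib]
  exact Finset.prod_congr rfl fun x _ => by split_ifs <;> simp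

/-- The edges crossing the reflection plane. -/
abbrev Cross : Type := {e : G.edgeSet // ¬ θ.Inner e ∧ ¬ θ.Inner (θ.edge e)}

/-- The edges in the chosen half, as a type. -/
abbrev InnerEdge : Type := {e : G.edgeSet // θ.Inner e}

open scoped Classical in
/-- A state on all edges, from states on the crossing edges and on the edges in the two halves. -/
def glue {A : Type*} (r : θ.Cross → A) (p q : θ.InnerEdge → A) (e : G.edgeSet) : A :=
  if h : θ.Inner e then p ⟨e, h⟩
  else if h' : θ.Inner (θ.edge e) then q ⟨θ.edge e, h'⟩ else r ⟨e, h, h'⟩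

lemma glue_inner {A : Type*} (r : θ.Cross → A) (p q : θ.InnerEdge → A) {e : G.edgeSet}
    (h : θ.Inner e) : θ.glue r p q e = p ⟨e, h⟩ := by simp [glue, h]

lemma glue_outer {A : Type*} (r : θ.Cross → A) (p q : θ.InnerEdge → A) {e : G.edgeSet}
    (h : θ.Inner (θ.edge e)) : θ.glue r p q e = q ⟨θ.edge e, h⟩ := by
  have : ¬ θ.Inner e := fun h' => Inner.not_edge θ h' h
  simp [glue, h, this]

lemma glue_cross {A : Type*} (r : θ.Cross → A) (p q : θ.InnerEdge → A) {e : G.edgeSet}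
    (h : ¬ θ.Inner e) (h' : ¬ θ.Inner (θ.edge e)) : θ.glue r p q e = r ⟨e, h, h'⟩ := by
  simp [glue, h, h']

lemma glue_edge {A : Type*} (r : θ.Cross → A) (p q : θ.InnerEdge → A) (e : G.edgeSet) :
    θ.glue r p q (θ.edge e) = θ.glue r q p e := by
  by_cases h : θ.Inner e
  · rw [θ.glue_inner r q p h]
    have : θ.Inner (θ.edge (θ.edge e)) := by rwa [θ.edge_edge]
    rw [θ.glue_outer r p q this]
    congr 2; exact θ.edge_edge e
  · by_cases h' : θ.Inner (θ.edge e)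
    · rw [θ.glue_outer r q p h', θ.glue_inner r p q h']
    · rw [θ.edge_eq_self h h', θ.glue_cross r q p h h', θ.glue_cross r p q h h']

/-- Gluing is a bijection. -/
def glueEquiv (A : Type*) :
    (θ.Cross → A) × (θ.InnerEdge → A) × (θ.InnerEdge → A) ≃ (G.edgeSet → A) where
  toFun t := θ.glue t.1 t.2.1 t.2.2
  invFun s := (fun e => s e.1, fun e => s e.1, fun e => s (θ.edge e.1))
  left_inv := by
    rintro ⟨r, p, q⟩
    refine Prod.ext (funext fun e => ?_) (Prod.ext (funext fun e => ?_) (funext fun e => ?_))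
    · exact θ.glue_cross r p q e.2.1 e.2.2
    · exact θ.glue_inner r p q e.2
    · exact (θ.glue_edge r p q e.1).trans (θ.glue_inner r q p e.2)
  right_inv s := by
    funext e
    by_cases h : θ.Inner e
    · exact θ.glue_inner _ _ _ h
    · by_cases h' : θ.Inner (θ.edge e)
      · refine (θ.glue_outer _ _ _ h').trans ?_
        simp only [θ.edge_edge]
      · exact θ.glue_cross _ _ _ h h'

/-- The state at a vertex of the chosen half does not depend on the edges of the other half. -/
lemma glue_eq_of_half {A : Type*} (r : θ.Cross → A) (p q q' : θ.InnerEdge → A) {x : V}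
    (hx : θ.half x) {e : G.edgeSet} (he : x ∈ (e : Sym2 V)) :
    θ.glue r p q e = θ.glue r p q' e := by
  by_cases h : θ.Inner e
  · rw [θ.glue_inner r p q h, θ.glue_inner r p q' h]
  · have h' := θ.not_inner_edge he hx
    rw [θ.glue_cross r p q h h', θ.glue_cross r p q' h h']

open scoped Classical in
lemma prod_glue [Fintype V] {A : Type*} {M : Type*} [CommMonoid M] (a : A → M) (r : θ.Cross → A)
    (p q : θ.InnerEdge → A) :
    ∏ e, a (θ.glue r p q e) =
      (∏ e, if h : ¬ θ.Inner e ∧ ¬ θ.Inner (θ.edge e) then a (r ⟨e, h⟩) else 1) *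
      (∏ e, if h : θ.Inner e then a (p ⟨e, h⟩) else 1) *
      ∏ e, if h : θ.Inner e then a (q ⟨e, h⟩) else 1 := by
  have h2 : ∏ e, (if h : θ.Inner (θ.edge e) then a (q ⟨θ.edge e, h⟩) else 1) =
      ∏ e, if h : θ.Inner e then a (q ⟨e, h⟩) else 1 :=
    Fintype.prod_equiv θ.edgeEquiv _ _ fun e => rfl
  rw [← h2, ← Finset.prod_mul_distrib, ← Finset.prod_mul_distrib]
  refine Finset.prod_congr rfl fun e _ => ?_
  by_cases h : θ.Inner e
  · have := Inner.not_edge θ h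
    simp [θ.glue_inner r p q h, h, this]
  · by_cases h' : θ.Inner (θ.edge e)
    · simp [θ.glue_outer r p q h', h, h']
    · simp [θ.glue_cross r p q h h', h, h']

lemma pairingCount_reflect (s : G.edgeSet → EdgeState N K) (x : V) :
    pairingCount s (θ.toFun x) = pairingCount (fun e => s (θ.edge e)) x := by
  unfold pairingCount
  let f : {e : G.edgeSet // x ∈ (e : Sym2 V)} ≃ {e : G.edgeSet // θ.toFun x ∈ (e : Sym2 V)} :=
    θ.edgeEquiv.subtypeEquiv fun e => θ.mem_edge.symm
  exact (Nat.card_congr (Matching.congr (Equiv.sigmaCongrLeft (β := fun e => Fin (s e.1).1) f)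
    fun l => rfl)).symm

lemma occupation_reflect [Fintype V] (s : G.edgeSet → EdgeState N K) (x : V) :
    occupation s (θ.toFun x) = occupation (fun e => s (θ.edge e)) x := by
  classical
  unfold occupation
  congr 1
  refine (Fintype.sum_equiv θ.edgeEquiv _ _ fun e => ?_).symm
  simp only [edgeEquiv, Equiv.coe_fn_mk, θ.mem_edge]

end Reflection

variable [Fintype V]

/-- Symmetry and reflection positivity of an interaction. -/
structure IsReflectionPositive (θ : Reflection G) (v : V → V → ℝ) : Prop where
  symm : ∀ x y, v x y = v y x
  reflect : ∀ x y, v (θ.toFun x) (θ.toFun y) = v x y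
  nonpos : ∀ c : V → ℝ, (∀ x, ¬ θ.half x → c x = 0) → ∑ x, ∑ y, c x * c y * v x (θ.toFun y) ≤ 0

open scoped Classical in
lemma interaction_reflect {θ : Reflection G} {v : V → V → ℝ} (hv : IsReflectionPositive θ v)
    {n a b : V → ℕ} (ha : ∀ x, θ.half x → n x = a x) (hb : ∀ x, θ.half x → n (θ.toFun x) = b x) :
    interaction v n =
      (∑ x, ∑ y, if θ.half x ∧ θ.half y then v x y * (a x : ℝ) * (a y : ℝ) else 0) +
      (∑ x, ∑ y, if θ.half x ∧ θ.half y then v x y * (b x : ℝ) * (b y : ℝ) else 0) -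
      ∑ x, ∑ y, (if θ.half x ∧ θ.half y then -2 * v x (θ.toFun y) else 0) *
        (a x : ℝ) * (b y : ℝ) := by
  have hcross : ∑ x, ∑ y, (if θ.half x ∧ θ.half y then v x (θ.toFun y) else 0) *
        (b x : ℝ) * (a y : ℝ) =
      ∑ x, ∑ y, (if θ.half x ∧ θ.half y then v x (θ.toFun y) else 0) *
        (a x : ℝ) * (b y : ℝ) := by
    rw [Finset.sum_comm]
    refine Finset.sum_congr rfl fun x _ => Finset.sum_congr rfl fun y _ => ?_
    have : v y (θ.toFun x) = v x (θ.toFun y) := by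
      rw [← hv.reflect, θ.invol, hv.symm]
    rw [this]
    by_cases h1 : θ.half x <;> by_cases h2 : θ.half y <;> simp [h1, h2]
    ring
  have h2 : ∑ x, ∑ y, (if θ.half x ∧ θ.half y then -2 * v x (θ.toFun y) else 0) *
        (a x : ℝ) * (b y : ℝ) =
      - (∑ x, ∑ y, (if θ.half x ∧ θ.half y then v x (θ.toFun y) else 0) *
        (b x : ℝ) * (a y : ℝ)) -
      ∑ x, ∑ y, (if θ.half x ∧ θ.half y then v x (θ.toFun y) else 0) *
        (a x : ℝ) * (b y : ℝ) := by
    rw [hcross]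
    simp only [← Finset.sum_neg_distrib, ← Finset.sum_sub_distrib]
    refine Finset.sum_congr rfl fun x _ => Finset.sum_congr rfl fun y _ => ?_
    split_ifs <;> ring
  rw [h2, interaction, θ.sum_eq]
  simp_rw [θ.sum_eq (fun y => v _ y * (n _ : ℝ) * (n y : ℝ))]
  simp only [← Finset.sum_neg_distrib, ← Finset.sum_sub_distrib, ← Finset.sum_add_distrib]
  refine Finset.sum_congr rfl fun x _ => ?_
  by_cases h1 : θ.half x
  · simp only [h1, if_true, true_and]
    refine Finset.sum_congr rfl fun y _ => ?_
    by_cases h2 : θ.half y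
    · simp only [h2, if_true, ha _ h1, ha _ h2, hb _ h1, hb _ h2, hv.reflect]
      have : v (θ.toFun x) y = v x (θ.toFun y) := by
        rw [← hv.reflect, θ.invol]
      rw [this]; ring
    · simp [h2]
  · simp [h1]

open scoped Classical in
/-- The contribution of one half, given the states of the crossing edges. -/
def halfWeight (θ : Reflection G) (v : V → V → ℝ) (lam : ℝ) (u : V → ℕ → ℝ)
    (r : θ.Cross → EdgeState N K) (p : θ.InnerEdge → EdgeState N K) : ℝ :=
  (∏ e, if h : θ.Inner e then edgeWeight lam (p ⟨e, h⟩) else 1) *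
  (∏ x, if θ.half x then (pairingCount (θ.glue r p p) x : ℝ) * u x (occupation (θ.glue r p p) x)
    else 1) *
  Real.exp (-∑ x, ∑ y, if θ.half x ∧ θ.half y then
    v x y * (occupation (θ.glue r p p) x : ℝ) * (occupation (θ.glue r p p) y : ℝ) else 0)

open scoped Classical in
/-- The weight of the crossing edges and their interaction. -/
def crossWeight (θ : Reflection G) (v : V → V → ℝ) (lam : ℝ)
    (r : θ.Cross → EdgeState N K) (p q : θ.InnerEdge → EdgeState N K) : ℝ :=
  (∏ e, if h : ¬ θ.Inner e ∧ ¬ θ.Inner (θ.edge e) then edgeWeight lam (r ⟨e, h⟩) else 1) *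
  Real.exp (∑ x, ∑ y, (if θ.half x ∧ θ.half y then -2 * v x (θ.toFun y) else 0) *
    (occupation (θ.glue r p p) x : ℝ) * (occupation (θ.glue r q q) y : ℝ))

lemma stateWeight_glue {θ : Reflection G} {v : V → V → ℝ} (hv : IsReflectionPositive θ v)
    (lam : ℝ) (u : V → ℕ → ℝ) (r : θ.Cross → EdgeState N K)
    (p q : θ.InnerEdge → EdgeState N K) :
    stateWeight v lam u (θ.glue r p q) =
      halfWeight θ v lam u r p * halfWeight θ v lam (fun x => u (θ.toFun x)) r q *
        crossWeight θ v lam r p q := by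
  classical
  have o1 : ∀ x, θ.half x → occupation (θ.glue r p q) x = occupation (θ.glue r p p) x :=
    fun x hx => occupation_congr fun e he => θ.glue_eq_of_half r p q p hx he
  have o2 : ∀ x, θ.half x →
      occupation (θ.glue r p q) (θ.toFun x) = occupation (θ.glue r q q) x := fun x hx => by
    rw [θ.occupation_reflect]
    exact occupation_congr fun e he => (θ.glue_edge r p q e).trans
      (θ.glue_eq_of_half r q p q hx he)
  have c1 : ∀ x, θ.half x → pairingCount (θ.glue r p q) x = pairingCount (θ.glue r p p) x :=
    fun x hx => pairingCount_congr fun e he => θ.glue_eq_of_half r p q p hx he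
  have c2 : ∀ x, θ.half x →
      pairingCount (θ.glue r p q) (θ.toFun x) = pairingCount (θ.glue r q q) x := fun x hx => by
    rw [θ.pairingCount_reflect]
    exact pairingCount_congr fun e he => (θ.glue_edge r p q e).trans
      (θ.glue_eq_of_half r q p q hx he)
  have hvert : ∏ x, (pairingCount (θ.glue r p q) x : ℝ) * u x (occupation (θ.glue r p q) x) =
      (∏ x, if θ.half x then (pairingCount (θ.glue r p p) x : ℝ) *
        u x (occupation (θ.glue r p p) x) else 1) *
      ∏ x, if θ.half x then (pairingCount (θ.glue r q q) x : ℝ) *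
        u (θ.toFun x) (occupation (θ.glue r q q) x) else 1 := by
    rw [θ.prod_eq, ← Finset.prod_mul_distrib]
    refine Finset.prod_congr rfl fun x _ => ?_
    by_cases h : θ.half x
    · simp only [h, if_true, o1 x h, o2 x h, c1 x h, c2 x h]
    · simp [h]
  rw [stateWeight, hvert, θ.prod_glue, interaction_reflect hv o1 o2, neg_sub, sub_eq_add_neg,
    neg_add, Real.exp_add, Real.exp_add, halfWeight, halfWeight, crossWeight]
  ring

open scoped Classical in
lemma stateSum_glue {θ : Reflection G} {v : V → V → ℝ} (hv : IsReflectionPositive θ v)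
    (lam : ℝ) (u : V → ℕ → ℝ) :
    stateSum G N K v lam u = ∑ r : θ.Cross → EdgeState N K,
      ∑ p : θ.InnerEdge → EdgeState N K, ∑ q : θ.InnerEdge → EdgeState N K,
      halfWeight θ v lam u r p * halfWeight θ v lam (fun x => u (θ.toFun x)) r q *
        crossWeight θ v lam r p q := by
  rw [stateSum]
  simp_rw [← stateWeight_glue hv, ← Fintype.sum_prod_type']
  exact (Fintype.sum_equiv (θ.glueEquiv (EdgeState N K)) _ _ fun t => rfl).symm

lemma halfWeight_congr (θ : Reflection G) (v : V → V → ℝ) (lam : ℝ) {u u' : V → ℕ → ℝ}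
    (h : ∀ x, θ.half x → u x = u' x) (r : θ.Cross → EdgeState N K)
    (p : θ.InnerEdge → EdgeState N K) :
    halfWeight θ v lam u r p = halfWeight θ v lam u' r p := by
  classical
  unfold halfWeight
  congr 2
  refine Finset.prod_congr rfl fun x _ => ?_
  split_ifs with hx
  · rw [h x hx]
  · rfl

/-- Reflection positivity, in the form of the Cauchy-Schwarz inequality. -/
theorem stateSum_sq_le {θ : Reflection G} {v : V → V → ℝ} (hv : IsReflectionPositive θ v)
    {lam : ℝ} (hlam : 0 ≤ lam) (u : V → ℕ → ℝ) :
    stateSum G N K v lam u ^ 2 ≤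
      stateSum G N K v lam (fun x => u (θ.fold x)) *
        stateSum G N K v lam (fun x => u (θ.cofold x)) := by
  classical
  have h1 : ∀ r p, halfWeight θ v lam (fun x => u (θ.fold x)) r p =
      halfWeight (N := N) (K := K) θ v lam u r p := fun r p =>
    halfWeight_congr θ v lam (fun x hx => by rw [θ.fold_of_half hx]) r p
  have h2 : ∀ r p, halfWeight θ v lam (fun x => u (θ.fold (θ.toFun x))) r p =
      halfWeight (N := N) (K := K) θ v lam u r p := fun r p =>
    halfWeight_congr θ v lam (fun x hx => by
      rw [θ.fold_of_not_half (by simpa [θ.half_iff]), θ.invol]) r p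
  have h3 : ∀ r p, halfWeight θ v lam (fun x => u (θ.cofold x)) r p =
      halfWeight (N := N) (K := K) θ v lam (fun x => u (θ.toFun x)) r p := fun r p =>
    halfWeight_congr θ v lam (fun x hx => by rw [θ.cofold_of_half hx]) r p
  have h4 : ∀ r p, halfWeight θ v lam (fun x => u (θ.cofold (θ.toFun x))) r p =
      halfWeight (N := N) (K := K) θ v lam (fun x => u (θ.toFun x)) r p := fun r p =>
    halfWeight_congr θ v lam (fun x hx => by
      rw [θ.cofold_of_not_half (by simpa [θ.half_iff])]) r p
  simp only [stateSum_glue hv, h1, h2, h3, h4]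
  have hbsymm : ∀ x y, (if θ.half x ∧ θ.half y then -2 * v x (θ.toFun y) else 0) =
      if θ.half y ∧ θ.half x then -2 * v y (θ.toFun x) else 0 := fun x y => by
    have : v y (θ.toFun x) = v x (θ.toFun y) := by rw [← hv.reflect, θ.invol, hv.symm]
    simp only [this, and_comm]
  refine sq_le_of_kernel_nonneg (crossWeight θ v lam) (fun r p q => ?_) (fun r g => ?_) _ _
  · unfold crossWeight
    congr 2
    rw [Finset.sum_comm]
    refine Finset.sum_congr rfl fun x _ => Finset.sum_congr rfl fun y _ => ?_
    rw [hbsymm]; ring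
  · have h := sum_mul_exp_form_nonneg
      (fun x y => if θ.half x ∧ θ.half y then -2 * v x (θ.toFun y) else 0) hbsymm (fun c => ?_)
      (fun p x => (occupation (θ.glue r p p) x : ℝ)) g
    · have h0 : 0 ≤ ∏ e, if h : ¬ θ.Inner e ∧ ¬ θ.Inner (θ.edge e) then
          edgeWeight lam (r ⟨e, h⟩) else 1 :=
        Finset.prod_nonneg fun e _ => by
          split_ifs
          · exact edgeWeight_nonneg hlam _
          · exact zero_le_one
      refine (mul_nonneg h0 h).trans_eq ?_
      simp only [crossWeight, Finset.mul_sum]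
      exact Finset.sum_congr rfl fun p _ => Finset.sum_congr rfl fun q _ => by ring
    · have h := hv.nonpos (fun x => if θ.half x then c x else 0) fun x hx => if_neg hx
      have e : ∑ x, ∑ y, c x * c y *
          (if θ.half x ∧ θ.half y then -2 * v x (θ.toFun y) else 0) =
          -2 * ∑ x, ∑ y, (if θ.half x then c x else 0) * (if θ.half y then c y else 0) *
            v x (θ.toFun y) := by
        simp only [Finset.mul_sum]
        refine Finset.sum_congr rfl fun x _ => Finset.sum_congr rfl fun y _ => ?_
        by_cases h1 : θ.half x <;> by_cases h2 : θ.half y <;> simp [h1, h2]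
        ring
      rw [e]; linarith

end ReflectionPositivity

end RandomPath
end

noncomputable section

namespace RandomPath

section MatchingCount

/-- The number of pairings of at most `2 n + 1` elements is at most `2 ^ n * n!`. -/
lemma card_matching_le {X : Type*} [Finite X] {N : ℕ} (col : X → Fin N) :
    Nat.card (Matching col) ≤ 2 ^ (Nat.card X / 2) * (Nat.card X / 2).factorial := by
  classical
  have := Fintype.ofFinite X
  rcases isEmpty_or_nonempty (Matching col) with hemp | ⟨⟨π₀⟩⟩
  · simp
  have htype : ∀ π : Matching col, ∃ k, Nat.card X = 2 * k ∧
      π.2.1.toPerm.cycleType = Multiset.replicate k 2 := fun π => by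
    have hsq : π.2.1.toPerm ^ 2 = 1 := by
      ext l; simp [sq, π.2.1 l]
    have h1 := Equiv.Perm.cycleType_of_pow_prime_eq_one (p := 2) hsq
    have h2 : π.2.1.toPerm.support = Finset.univ := by
      ext l; simpa using (π.2.2 l).1
    have h3 := π.2.1.toPerm.sum_cycleType
    rw [h2, h1, Multiset.sum_replicate, Finset.card_univ, ← Nat.card_eq_fintype_card,
      smul_eq_mul] at h3
    exact ⟨_, by rw [← h3, mul_comm], h1⟩
  obtain ⟨n, hn, -⟩ := htype π₀
  have hn' : Nat.card X / 2 = n := by omega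
  rw [hn']
  let f : Matching col → {σ : Equiv.Perm X // σ.cycleType = Multiset.replicate n 2} := fun π =>
    ⟨π.2.1.toPerm, by obtain ⟨k, hk, h⟩ := htype π; rw [h]; congr 1; omega⟩
  have hf : Function.Injective f := fun π π' h => by
    apply Subtype.ext; funext l
    exact congrArg (fun σ : {σ : Equiv.Perm X // σ.cycleType = Multiset.replicate n 2} => σ.1 l) h
  have hcard : Nat.card (Matching col) ≤
      (Finset.univ.filter fun σ : Equiv.Perm X => σ.cycleType = Multiset.replicate n 2).card := by
    refine (Nat.card_le_card_of_injective f hf).trans_eq ?_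
    rw [Nat.card_eq_fintype_card, Fintype.card_subtype]
  refine hcard.trans ?_
  rcases Nat.eq_zero_or_pos n with h0 | h0
  · rw [h0]
    refine (Finset.card_le_one.mpr ?_).trans (by simp)
    simp only [Multiset.replicate_zero, Finset.mem_filter, Equiv.Perm.cycleType_eq_zero]
    rintro a ⟨-, rfl⟩ b ⟨-, rfl⟩; rfl
  have hct := Equiv.Perm.card_of_cycleType_mul_eq X (Multiset.replicate n 2)
  set c := (Finset.univ.filter fun σ : Equiv.Perm X =>
    σ.cycleType = Multiset.replicate n 2).card
  rw [← Nat.card_eq_fintype_card, hn, Multiset.toFinset_replicate, if_neg h0.ne',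
    Finset.prod_singleton, Multiset.count_replicate_self, Multiset.sum_replicate,
    Multiset.prod_replicate, if_pos ⟨by simp [mul_comm], fun a ha => by
      rw [Multiset.eq_of_mem_replicate ha]⟩] at hct
  have h4 : n • 2 = 2 * n := by simp [mul_comm]
  rw [h4, Nat.sub_self, Nat.factorial_zero, one_mul] at hct
  have hcb := Nat.centralBinom_le_four_pow n
  have hfac : (2 * n).factorial = n.centralBinom * (n.factorial * n.factorial) := by
    have := Nat.choose_mul_factorial_mul_factorial (n := 2 * n) (k := n) (by omega)
    rw [← this, Nat.centralBinom, two_mul, Nat.add_sub_cancel, mul_assoc]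
  have hpos : 0 < 2 ^ n * n.factorial := by positivity
  refine Nat.le_of_mul_le_mul_right ?_ hpos
  rw [hct, hfac]
  calc n.centralBinom * (n.factorial * n.factorial)
      ≤ 4 ^ n * (n.factorial * n.factorial) := Nat.mul_le_mul_right _ hcb
    _ = 2 ^ n * n.factorial * (2 ^ n * n.factorial) := by
      rw [show (4 : ℕ) = 2 * 2 from rfl, mul_pow]; ring

end MatchingCount

section Bounds

variable {V : Type} [Fintype V] {G : SimpleGraph V} {N K : ℕ}

open scoped Classical in
lemma card_star_eq (s : G.edgeSet → EdgeState N K) (x : V) :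
    Nat.card (Σ e : {e : G.edgeSet // x ∈ (e : Sym2 V)}, Fin (s e.1).1) =
      ∑ e : G.edgeSet, if x ∈ (e : Sym2 V) then ((s e).1 : ℕ) else 0 := by
  rw [Nat.card_eq_fintype_card, Fintype.card_sigma]
  simp only [Fintype.card_fin]
  rw [← Finset.sum_filter, Finset.sum_subtype (p := fun e : G.edgeSet => x ∈ (e : Sym2 V))]
  simp

lemma pairingCount_le (s : G.edgeSet → EdgeState N K) (x : V) :
    pairingCount s x ≤ 2 ^ occupation s x * (occupation s x).factorial := by
  have := card_matching_le
    fun l : Σ e : {e : G.edgeSet // x ∈ (e : Sym2 V)}, Fin (s e.1).1 => (s l.1.1).2 l.2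
  rw [card_star_eq] at this
  exact this

open scoped Classical in
/-- Every link contributes to the occupation numbers of its two endpoints. -/
lemma sum_occupation_le (s : G.edgeSet → EdgeState N K) :
    ∑ x, occupation s x ≤ ∑ e, ((s e).1 : ℕ) := by
  have h : ∑ x, ∑ e : G.edgeSet, (if x ∈ (e : Sym2 V) then ((s e).1 : ℕ) else 0) =
      ∑ e, 2 * ((s e).1 : ℕ) := by
    rw [Finset.sum_comm]
    refine Finset.sum_congr rfl fun e _ => ?_
    rw [← Finset.sum_filter, Finset.sum_const, smul_eq_mul]
    congr 1
    obtain ⟨e, he⟩ := e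
    induction e using Sym2.ind with
    | _ x y =>
      have hxy : G.Adj x y := he
      have : (Finset.univ.filter fun z => z ∈ s(x, y)) = {x, y} := by
        ext z; simp
      rw [this, Finset.card_pair hxy.ne]
  have h2 : 2 * ∑ x, occupation s x ≤ ∑ e, 2 * ((s e).1 : ℕ) := by
    rw [← h, Finset.mul_sum]
    exact Finset.sum_le_sum fun x _ => Nat.mul_div_le _ 2
  rw [← Finset.mul_sum] at h2
  omega

/-- Good weight functions decay like inverse factorials. -/
lemma good_decay {U : ℕ → ℝ} {vb M : ℝ} (hU : ∀ n, 0 ≤ U n) (hM : 0 ≤ M)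
    (hgood : ∀ n : ℕ, (n : ℝ) * (U (n + 1) * Real.exp (-vb * ((n + 1 : ℕ) : ℝ) ^ 2)) ≤
      M * (U n * Real.exp (-vb * (n : ℝ) ^ 2))) (n : ℕ) :
    (n.factorial : ℝ) * (U n * Real.exp (-vb * (n : ℝ) ^ 2)) ≤
      (U 0 + U 1 * Real.exp (-vb)) * (2 * (M + 1)) ^ n := by
  set W : ℕ → ℝ := fun n => U n * Real.exp (-vb * (n : ℝ) ^ 2) with hW
  have hW0 : ∀ n, 0 ≤ W n := fun n => mul_nonneg (hU n) (Real.exp_nonneg _)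
  have hW1 : W 1 = U 1 * Real.exp (-vb) := by simp [hW]
  have hW00 : W 0 = U 0 := by simp [hW]
  have h : ∀ n : ℕ, (n.factorial : ℝ) * W (n + 1) ≤ (M + 1) ^ n * W 1 := by
    intro n
    induction n with
    | zero => simp
    | succ n ih =>
      have h1 := hgood (n + 1)
      calc ((n + 1).factorial : ℝ) * W (n + 1 + 1)
          = (n.factorial : ℝ) * (((n + 1 : ℕ) : ℝ) * W (n + 1 + 1)) := by
            rw [Nat.factorial_succ]; push_cast; ring
        _ ≤ (n.factorial : ℝ) * ((M + 1) * W (n + 1)) := by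
            refine mul_le_mul_of_nonneg_left (h1.trans ?_) (by positivity)
            exact mul_le_mul_of_nonneg_right (by linarith) (hW0 _)
        _ = (M + 1) * ((n.factorial : ℝ) * W (n + 1)) := by ring
        _ ≤ (M + 1) * ((M + 1) ^ n * W 1) := by gcongr
        _ = (M + 1) ^ (n + 1) * W 1 := by ring
  change (n.factorial : ℝ) * W n ≤ _
  rw [← hW1, ← hW00]
  rcases n with - | n
  · simp; exact hW0 1
  · have h2 : ((n : ℝ) + 1) ≤ 2 ^ (n + 1) := by
      have := (Nat.lt_two_pow_self (n := n + 1)).le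
      exact_mod_cast this
    calc ((n + 1).factorial : ℝ) * W (n + 1)
        = ((n : ℝ) + 1) * ((n.factorial : ℝ) * W (n + 1)) := by
          rw [Nat.factorial_succ]; push_cast; ring
      _ ≤ 2 ^ (n + 1) * ((M + 1) ^ n * W 1) :=
          mul_le_mul h2 (h n) (mul_nonneg (by positivity) (hW0 _)) (by positivity)
      _ ≤ 2 ^ (n + 1) * ((M + 1) ^ (n + 1) * (W 0 + W 1)) := by
          gcongr
          · exact hW0 1
          · linarith
          · omega
          · linarith [hW0 0]
      _ = (W 0 + W 1) * (2 * (M + 1)) ^ (n + 1) := by rw [mul_pow]; ring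

open scoped Classical in
lemma sum_edgeState_le {y : ℝ} (hy : 0 ≤ y) :
    ∑ a : EdgeState N K, y ^ (a.1 : ℕ) / ((a.1 : ℕ).factorial : ℝ) ≤ Real.exp (N * y) := by
  rw [Fintype.sum_sigma]
  simp only [Finset.sum_const, Finset.card_univ, Fintype.card_pi, Finset.prod_const,
    Fintype.card_fin, nsmul_eq_mul]
  rw [Fin.sum_univ_eq_sum_range (fun m => ((N ^ m : ℕ) : ℝ) * (y ^ m / (m.factorial : ℝ)))]
  refine le_trans (le_of_eq ?_) (Real.sum_le_exp_of_nonneg (by positivity) (K + 1))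
  refine Finset.sum_congr rfl fun m _ => ?_
  push_cast
  rw [mul_pow]; ring

open scoped Classical in
/-- The partition function with an additional factor `exp (B n)` at all vertices is at most
exponentially large in the volume, uniformly in the maximal number of links. -/
lemma stateSum_le {U : ℕ → ℝ} {vb M B lam : ℝ} {D : ℕ} {v : V → V → ℝ} (hU : ∀ n, 0 ≤ U n)
    (hM : 0 ≤ M) (hlam : 0 ≤ lam) (hB : 0 ≤ B)
    (hgood : ∀ n : ℕ, (n : ℝ) * (U (n + 1) * Real.exp (-vb * ((n + 1 : ℕ) : ℝ) ^ 2)) ≤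
      M * (U n * Real.exp (-vb * (n : ℝ) ^ 2)))
    (hv : ∀ n : V → ℕ, vb * ∑ x, (n x : ℝ) ^ 2 ≤ interaction v n)
    (hD : Fintype.card G.edgeSet ≤ D * Fintype.card V) :
    stateSum G N K v lam (fun _ n => U n * Real.exp (B * n)) ≤
      ((U 0 + U 1 * Real.exp (-vb)) *
        Real.exp (N * (lam * (4 * (M + 1) * Real.exp B))) ^ D) ^ Fintype.card V := by
  set C := U 0 + U 1 * Real.exp (-vb)
  set q := 4 * (M + 1) * Real.exp B with hq
  have hC : 0 ≤ C := add_nonneg (hU 0) (mul_nonneg (hU 1) (Real.exp_nonneg _))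
  have hq1 : 1 ≤ q := by
    have := Real.one_le_exp hB
    nlinarith
  have hbound : ∀ s : G.edgeSet → EdgeState N K,
      stateWeight v lam (fun _ n => U n * Real.exp (B * n)) s ≤
        C ^ Fintype.card V * ∏ e, (lam * q) ^ ((s e).1 : ℕ) / (((s e).1 : ℕ).factorial : ℝ) := by
    intro s
    have hvert : (∏ x, (pairingCount s x : ℝ) *
        (U (occupation s x) * Real.exp (B * occupation s x))) *
        Real.exp (-interaction v (occupation s)) ≤ ∏ x, C * q ^ occupation s x := by
      calc _ ≤ (∏ x, (pairingCount s x : ℝ) *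
            (U (occupation s x) * Real.exp (B * occupation s x))) *
            ∏ x, Real.exp (-vb * (occupation s x : ℝ) ^ 2) := by
            refine mul_le_mul_of_nonneg_left ?_ (Finset.prod_nonneg fun x _ =>
              mul_nonneg (Nat.cast_nonneg _) (mul_nonneg (hU _) (Real.exp_nonneg _)))
            rw [← Real.exp_sum, Real.exp_le_exp, ← Finset.mul_sum]
            linarith [hv (occupation s)]
        _ ≤ _ := by
            rw [← Finset.prod_mul_distrib]
            refine Finset.prod_le_prod (fun x _ => mul_nonneg (mul_nonneg (Nat.cast_nonneg _)
              (mul_nonneg (hU _) (Real.exp_nonneg _))) (Real.exp_nonneg _)) fun x _ => ?_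
            set n := occupation s x
            have h1 : (pairingCount s x : ℝ) ≤ 2 ^ n * (n.factorial : ℝ) := by
              exact_mod_cast pairingCount_le s x
            have h2 := good_decay hU hM hgood n
            have h3 : 0 ≤ U n * Real.exp (-vb * (n : ℝ) ^ 2) :=
              mul_nonneg (hU _) (Real.exp_nonneg _)
            calc _ = (pairingCount s x : ℝ) * (U n * Real.exp (-vb * (n : ℝ) ^ 2)) *
                  Real.exp (B * n) := by ring
              _ ≤ 2 ^ n * (n.factorial : ℝ) * (U n * Real.exp (-vb * (n : ℝ) ^ 2)) *
                  Real.exp (B * n) := by gcongr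
              _ = 2 ^ n * ((n.factorial : ℝ) * (U n * Real.exp (-vb * (n : ℝ) ^ 2))) *
                  Real.exp (B * n) := by ring
              _ ≤ 2 ^ n * (C * (2 * (M + 1)) ^ n) * Real.exp (B * n) := by gcongr
              _ = C * q ^ n := by
                rw [mul_comm B, Real.exp_nat_mul, hq, show (4 : ℝ) = 2 * 2 by norm_num]
                simp only [mul_pow]; ring
    have hq2 : ∏ x, C * q ^ occupation s x ≤ C ^ Fintype.card V * ∏ e, q ^ ((s e).1 : ℕ) := by
      rw [Finset.prod_mul_distrib, Finset.prod_const, Finset.card_univ,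
        Finset.prod_pow_eq_pow_sum, Finset.prod_pow_eq_pow_sum]
      exact mul_le_mul_of_nonneg_left (pow_le_pow_right₀ hq1 (sum_occupation_le s)) (by positivity)
    rw [stateWeight, mul_assoc]
    refine (mul_le_mul_of_nonneg_left (hvert.trans hq2)
      (Finset.prod_nonneg fun e _ => edgeWeight_nonneg hlam _)).trans_eq ?_
    rw [mul_left_comm, ← Finset.prod_mul_distrib]
    congr 1
    refine Finset.prod_congr rfl fun e _ => ?_
    rw [edgeWeight, mul_pow lam q]; ring
  have hx : 0 ≤ lam * q := by positivity
  calc stateSum G N K v lam (fun _ n => U n * Real.exp (B * n))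
      ≤ ∑ s : G.edgeSet → EdgeState N K, C ^ Fintype.card V *
          ∏ e, (lam * q) ^ ((s e).1 : ℕ) / (((s e).1 : ℕ).factorial : ℝ) :=
        Finset.sum_le_sum fun s _ => hbound s
    _ = C ^ Fintype.card V * (∑ a : EdgeState N K,
          (lam * q) ^ (a.1 : ℕ) / ((a.1 : ℕ).factorial : ℝ)) ^ Fintype.card G.edgeSet := by
        rw [← Finset.mul_sum, ← Finset.card_univ (α := G.edgeSet), ← Finset.prod_const,
          Finset.prod_univ_sum, Fintype.piFinset_univ]
    _ ≤ C ^ Fintype.card V * Real.exp (N * (lam * q)) ^ Fintype.card G.edgeSet := by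
        have h1 := sum_edgeState_le (N := N) (K := K) hx
        have h2 : 0 ≤ ∑ a : EdgeState N K,
          (lam * q) ^ (a.1 : ℕ) / ((a.1 : ℕ).factorial : ℝ) :=
            Finset.sum_nonneg fun a _ => by positivity
        gcongr
    _ ≤ C ^ Fintype.card V * Real.exp (N * (lam * q)) ^ (D * Fintype.card V) := by
        gcongr
        exact Real.one_le_exp (by positivity)
    _ = _ := by rw [mul_pow, pow_mul]

lemma stateWeight_nonneg {v : V → V → ℝ} {lam : ℝ} (hlam : 0 ≤ lam) {u : V → ℕ → ℝ}
    (hu : ∀ x n, 0 ≤ u x n) (s : G.edgeSet → EdgeState N K) : 0 ≤ stateWeight v lam u s := by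
  refine mul_nonneg (mul_nonneg (Finset.prod_nonneg fun e _ => edgeWeight_nonneg hlam _)
    (Finset.prod_nonneg fun x _ => mul_nonneg (Nat.cast_nonneg _) (hu _ _))) (Real.exp_nonneg _)

/-- Without links there is exactly one pairing. -/
lemma pow_le_stateSum_of_zero {v : V → V → ℝ} {lam : ℝ} (hlam : 0 ≤ lam) {U : ℕ → ℝ}
    (hU : ∀ n, 0 ≤ U n) : U 0 ^ Fintype.card V ≤ stateSum G N K v lam fun _ => U := by
  classical
  let s₀ : G.edgeSet → EdgeState N K := fun _ => ⟨0, fun i => i.elim0⟩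
  refine le_trans (le_of_eq ?_) (Finset.single_le_sum
    (fun s _ => stateWeight_nonneg hlam (fun _ => hU) s) (Finset.mem_univ s₀))
  have hocc : occupation s₀ = 0 := by
    funext x; simp [occupation, s₀]
  have hcount : ∀ x, pairingCount s₀ x = 1 := fun x => by
    have : IsEmpty (Σ e : {e : G.edgeSet // x ∈ (e : Sym2 V)}, Fin (s₀ e.1).1) :=
      ⟨fun l => l.2.elim0⟩
    have : Unique (Matching fun l : Σ e : {e : G.edgeSet // x ∈ (e : Sym2 V)}, Fin (s₀ e.1).1 =>
        (s₀ l.1.1).2 l.2) :=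
      { default := ⟨id, fun _ => rfl, fun l => isEmptyElim l⟩
        uniq := fun π => Subtype.ext (funext fun l => isEmptyElim l) }
    exact Nat.card_unique
  have hedge : ∀ e, edgeWeight lam (s₀ e) = 1 := fun e => by simp [edgeWeight, s₀]
  simp [stateWeight, hocc, hcount, interaction, hedge]

open scoped Classical in
/-- The contribution of a dimer covering with two links on every dimer. -/
lemma pow_le_stateSum_of_mate {v : V → V → ℝ} {lam κ : ℝ} {D : ℕ} (hlam : 0 ≤ lam) {U : ℕ → ℝ}
    (hU : ∀ n, 0 ≤ U n) (hN : 0 < N) (hK : 2 ≤ K)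
    (hD : Fintype.card G.edgeSet ≤ D * Fintype.card V)
    (hv : interaction v (fun _ => 1) ≤ κ * Fintype.card V)
    (mate : V → V) (hmate : ∀ x, mate (mate x) = x) (hadj : ∀ x, G.Adj x (mate x)) :
    (min 1 (lam ^ 2 / 2) ^ D * (U 1 * Real.exp (-κ))) ^ Fintype.card V ≤
      stateSum G N K v lam fun _ => U := by
  let s₀ : G.edgeSet → EdgeState N K := fun e =>
    if ∃ y, (e : Sym2 V) = s(y, mate y) then ⟨⟨2, by omega⟩, fun _ => ⟨0, hN⟩⟩
    else ⟨0, fun i => i.elim0⟩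
  refine le_trans ?_ (Finset.single_le_sum
    (fun s _ => stateWeight_nonneg hlam (fun _ => hU) s) (Finset.mem_univ s₀))
  have hs : ∀ e : G.edgeSet, ((s₀ e).1 : ℕ) = if ∃ y, (e : Sym2 V) = s(y, mate y) then 2 else 0 :=
    fun e => by
      simp only [s₀]; split_ifs <;> rfl
  have hocc : occupation s₀ = fun _ => 1 := by
    funext x
    have : ∑ e : G.edgeSet, (if x ∈ (e : Sym2 V) then ((s₀ e).1 : ℕ) else 0) = 2 := by
      rw [Finset.sum_eq_single (⟨s(x, mate x), hadj x⟩ : G.edgeSet)]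
      · rw [hs, if_pos (Sym2.mem_mk_left _ _), if_pos ⟨x, rfl⟩]
      · intro e _ he
        split_ifs with hx
        · rw [hs, if_neg]
          rintro ⟨y, hy⟩
          apply he; apply Subtype.ext
          rw [hy] at hx ⊢
          rcases Sym2.mem_iff.mp hx with rfl | rfl
          · rfl
          · change s(y, mate y) = s(mate y, mate (mate y))
            rw [hmate, Sym2.eq_swap]
        · rfl
      · simp
    rw [occupation, this]
  have hcount : ∀ x, (1 : ℝ) ≤ pairingCount s₀ x := fun x => by
    have : Nonempty (Matching fun l : Σ e : {e : G.edgeSet // x ∈ (e : Sym2 V)},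
        Fin (s₀ e.1).1 => (s₀ l.1.1).2 l.2) := by
      refine ⟨fun l => ⟨l.1, Fin.rev l.2⟩, fun l => by simp, fun l => ⟨fun hl => ?_, ?_⟩⟩
      · obtain ⟨e, p⟩ := l
        simp only [Sigma.mk.injEq, heq_eq_eq, true_and] at hl
        have h1 := congrArg Fin.val hl
        rw [Fin.val_rev] at h1
        have h2 := p.2
        have h3 := hs e.1
        split_ifs at h3 <;> omega
      · obtain ⟨e, p⟩ := l
        have h2 : ∀ a : EdgeState N K, a = ⟨⟨2, by omega⟩, fun _ => ⟨0, hN⟩⟩ ∨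
            a = ⟨0, fun i => i.elim0⟩ → ∀ p p' : Fin a.1, a.2 p = a.2 p' := by
          rintro _ (rfl | rfl) p p'
          · rfl
          · exact p.elim0
        refine h2 (s₀ e.1) ?_ _ _
        by_cases h : ∃ y, (e.1 : Sym2 V) = s(y, mate y)
        · exact Or.inl (if_pos h)
        · exact Or.inr (if_neg h)
    have : 0 < pairingCount s₀ x := Nat.card_pos
    exact_mod_cast this
  set m := min 1 (lam ^ 2 / 2) with hm
  have hm0 : 0 ≤ m := le_min zero_le_one (by positivity)
  have hedge : m ^ (D * Fintype.card V) ≤ ∏ e, edgeWeight lam (s₀ e) := by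
    refine (pow_le_pow_of_le_one hm0 (min_le_left _ _) hD).trans ?_
    rw [← Finset.card_univ, ← Finset.prod_const]
    refine Finset.prod_le_prod (fun _ _ => hm0) fun e _ => ?_
    rw [edgeWeight, hs]
    split_ifs
    · exact (min_le_right _ _).trans_eq (by norm_num [Nat.factorial])
    · simp [hm]
  have hvert : U 1 ^ Fintype.card V ≤
      ∏ x, (pairingCount s₀ x : ℝ) * U (occupation s₀ x) := by
    rw [← Finset.card_univ, ← Finset.prod_const]
    refine Finset.prod_le_prod (fun _ _ => hU 1) fun x _ => ?_
    rw [hocc]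
    exact le_mul_of_one_le_left (hU 1) (hcount x)
  have hexp : Real.exp (-κ) ^ Fintype.card V ≤ Real.exp (-interaction v (occupation s₀)) := by
    rw [← Real.exp_nat_mul, Real.exp_le_exp, hocc]
    linarith
  calc _ = m ^ (D * Fintype.card V) * U 1 ^ Fintype.card V * Real.exp (-κ) ^ Fintype.card V := by
        rw [mul_pow, mul_pow, pow_mul]; ring
    _ ≤ _ := by
        have h1 := hU 1
        have h2 : 0 ≤ ∏ e, edgeWeight lam (s₀ e) :=
          Finset.prod_nonneg fun e _ => edgeWeight_nonneg hlam _
        have h3 := (pow_nonneg h1 _).trans hvert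
        exact mul_le_mul (mul_le_mul hedge hvert (pow_nonneg h1 _) h2) hexp
          (pow_nonneg (Real.exp_nonneg _) _) (mul_nonneg h2 h3)

end Bounds

end RandomPath
end

noncomputable section

namespace RandomPath

section SingleSite

variable {V : Type} [Fintype V] {G : SimpleGraph V} {N K : ℕ}

lemma stateSum_mono {v : V → V → ℝ} {lam : ℝ} (hlam : 0 ≤ lam) {u u' : V → ℕ → ℝ}
    (hu : ∀ x n, 0 ≤ u x n) (h : ∀ x n, u x n ≤ u' x n) :
    stateSum G N K v lam u ≤ stateSum G N K v lam u' := by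
  classical
  refine Finset.sum_le_sum fun s _ => ?_
  refine mul_le_mul_of_nonneg_right (mul_le_mul_of_nonneg_left ?_
    (Finset.prod_nonneg fun e _ => edgeWeight_nonneg hlam _)) (Real.exp_nonneg _)
  exact Finset.prod_le_prod (fun x _ => mul_nonneg (Nat.cast_nonneg _) (hu _ _))
    fun x _ => mul_le_mul_of_nonneg_left (h _ _) (Nat.cast_nonneg _)

open scoped Classical in
lemma Reflection.card_fold_add_card_cofold (θ : Reflection G) (S : Finset V) :
    (Finset.univ.filter fun z => θ.fold z ∈ S).card +
      (Finset.univ.filter fun z => θ.cofold z ∈ S).card = S.card + S.card := by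
  have h0 : S.card = ∑ z, if z ∈ S then 1 else 0 := by simp
  rw [Finset.card_filter, Finset.card_filter, ← Finset.sum_add_distrib, h0,
    ← Finset.sum_add_distrib, θ.sum_eq, θ.sum_eq (fun z => (if z ∈ S then 1 else 0) + _)]
  refine Finset.sum_congr rfl fun z _ => ?_
  by_cases h : θ.half z
  · have h' : ¬ θ.half (θ.toFun z) := fun h' => (θ.half_iff z).mp h' h
    simp only [h, if_true, θ.fold_of_half h, θ.cofold_of_half h, θ.fold_of_not_half h',
      θ.cofold_of_not_half h', θ.invol]
    omega
  · simp [h]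

open scoped Classical in
/-- The exponential moment of a single occupation number, from volume bounds on the partition
functions and the chessboard estimate. -/
theorem stateSum_single_le (hG : G.Preconnected) {v : V → V → ℝ} {lam B C c : ℝ}
    (hlam : 0 ≤ lam) (hB : 0 ≤ B) (hc : 0 < c) {U : ℕ → ℝ} (hU : ∀ n, 0 ≤ U n)
    (hupper : stateSum G N K v lam (fun _ n => U n * Real.exp (B * n)) ≤ C ^ Fintype.card V)
    (hlower : c ^ Fintype.card V ≤ stateSum G N K v lam fun _ => U) (hC : 0 < C)
    (hrefl : ∀ x y, G.Adj x y → ∃ θ : Reflection G, ¬ (θ.half x ↔ θ.half y) ∧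
      IsReflectionPositive θ v) (z : V) :
    stateSum G N K v lam (fun x n => U n * if x = z then Real.exp (B * n) else 1) ≤
      C / c * stateSum G N K v lam fun _ => U := by
  set F : Finset V → ℝ := fun S =>
    stateSum G N K v lam fun x n => U n * if x ∈ S then Real.exp (B * n) else 1 with hF
  have hF0 : F ∅ = stateSum G N K v lam fun _ => U := by simp [hF]
  have hexp : ∀ n : ℕ, 1 ≤ Real.exp (B * n) := fun n => Real.one_le_exp (by positivity)
  have hFpos : ∀ S, 0 < F S := fun S => by
    refine ((pow_pos hc _).trans_le hlower).trans_le (stateSum_mono hlam (fun _ => hU) ?_)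
    intro x n
    refine le_mul_of_one_le_right (hU n) ?_
    split_ifs
    · exact hexp n
    · exact le_rfl
  have hR : 0 < C / c := div_pos hC hc
  have key := chessboard hG (fun S => F S / (C / c) ^ S.card)
    (fun S => div_pos (hFpos S) (pow_pos hR _)) ?_ ?_ {z}
  · rw [Finset.card_singleton, Finset.card_empty, pow_zero, div_one, pow_one,
      div_le_iff₀ hR, mul_comm, hF0] at key
    simpa [hF] using key
  · rw [Finset.card_empty, pow_zero, div_one, hF0, Finset.card_univ, div_le_iff₀ (pow_pos hR _)]
    have h1 : F Finset.univ ≤ C ^ Fintype.card V := by simpa [hF] using hupper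
    refine h1.trans ?_
    rw [div_pow]
    have h2 : 0 < C ^ Fintype.card V := pow_pos hC _
    have h3 : 0 < c ^ Fintype.card V := pow_pos hc _
    rw [← mul_div_assoc, le_div_iff₀ h3, mul_comm]
    exact mul_le_mul_of_nonneg_right hlower h2.le
  · intro x y hxy
    obtain ⟨θ, hθ, hθv⟩ := hrefl x y hxy
    refine ⟨θ, hθ, fun S => ?_⟩
    have h := stateSum_sq_le (N := N) (K := K) hθv hlam
      fun x n => U n * if x ∈ S then Real.exp (B * n) else 1
    have hcard := θ.card_fold_add_card_cofold S
    rw [div_pow, div_mul_div_comm, ← pow_mul, ← pow_add, hcard, ← two_mul, mul_comm 2]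
    refine div_le_div_of_nonneg_right ?_ (pow_nonneg hR.le _)
    simpa [hF] using h

end SingleSite

end RandomPath
end

noncomputable section

namespace RandomPath

section TorusGraph

variable {d L : ℕ}

lemma torusGraph_adj {x y : Torus d L} : (torusGraph d L).Adj x y ↔
    x ≠ y ∧ ((∃ i, y = x + Pi.single i 1) ∨ ∃ i, x = y + Pi.single i 1) :=
  SimpleGraph.fromRel_adj _ _ _

lemma two_le_of_even [NeZero L] (hL : Even L) : 2 ≤ L := by
  have := NeZero.ne L
  obtain ⟨k, rfl⟩ := hL
  omega

lemma add_single_ne (hL : 2 ≤ L) (x : Torus d L) (i : Fin d) : x ≠ x + Pi.single i 1 := by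
  have : Fact (1 < L) := ⟨hL⟩
  intro h
  have := congrFun (left_eq_add.mp h) i
  simp at this

lemma adj_add_single (hL : 2 ≤ L) (x : Torus d L) (i : Fin d) :
    (torusGraph d L).Adj x (x + Pi.single i 1) :=
  torusGraph_adj.mpr ⟨add_single_ne hL x i, Or.inl ⟨i, rfl⟩⟩

lemma torusGraph_preconnected [NeZero L] (hL : 2 ≤ L) : (torusGraph d L).Preconnected := by
  have h1 : ∀ (x : Torus d L) (i : Fin d) (k : ℕ),
      (torusGraph d L).Reachable x (x + Pi.single i (k : ZMod L)) := fun x i k => by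
    induction k with
    | zero => simp
    | succ k ih =>
      refine ih.trans ?_
      have := adj_add_single hL (x + Pi.single i (k : ZMod L)) i
      rw [add_assoc, ← Pi.single_add] at this
      exact_mod_cast this.reachable
  have h2 : ∀ (x : Torus d L) (i : Fin d) (a : ZMod L),
      (torusGraph d L).Reachable x (x + Pi.single i a) := fun x i a => by
    have := h1 x i a.val
    rwa [ZMod.natCast_zmod_val] at this
  have h3 : ∀ (x : Torus d L) (s : Finset (Fin d)),
      (torusGraph d L).Reachable 0 (∑ i ∈ s, Pi.single i (x i)) := fun x s => by
    induction s using Finset.induction_on with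
    | empty => simp
    | insert i s hi ih =>
      rw [Finset.sum_insert hi, add_comm]
      exact ih.trans (h2 _ _ _)
  have h4 : ∀ x : Torus d L, (torusGraph d L).Reachable 0 x := fun x => by
    have := h3 x Finset.univ
    rwa [Finset.univ_sum_single] at this
  exact fun x y => (h4 x).symm.trans (h4 y)

open scoped Classical in
lemma card_edgeSet_torusGraph_le [NeZero L] (hL : 2 ≤ L) :
    Fintype.card (torusGraph d L).edgeSet ≤ d * Fintype.card (Torus d L) := by
  have : Fintype.card (Fin d × Torus d L) = d * Fintype.card (Torus d L) := by simp
  rw [← this]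
  refine Fintype.card_le_of_surjective
    (fun p => ⟨s(p.2, p.2 + Pi.single p.1 1), adj_add_single hL p.2 p.1⟩) fun e => ?_
  obtain ⟨e, he⟩ := e
  induction e using Sym2.ind with
  | _ x y =>
    have hxy : (torusGraph d L).Adj x y := he
    obtain ⟨-, ⟨i, rfl⟩ | ⟨i, rfl⟩⟩ := torusGraph_adj.mp hxy
    · exact ⟨(i, x), rfl⟩
    · exact ⟨(i, y), Subtype.ext Sym2.eq_swap⟩

/-- The torus has a perfect matching by nearest-neighbour edges. -/
lemma exists_mate [NeZero L] (hL : Even L) (i : Fin d) : ∃ mate : Torus d L → Torus d L,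
    (∀ x, mate (mate x) = x) ∧ ∀ x, (torusGraph d L).Adj x (mate x) := by
  have hL2 := two_le_of_even hL
  let par : ZMod L →+* ZMod 2 := ZMod.castHom hL.two_dvd (ZMod 2)
  have hpar : ∀ a : ZMod 2, a = 0 ∨ a = 1 := by decide
  refine ⟨fun x => if par (x i) = 0 then x + Pi.single i 1 else x - Pi.single i 1, fun x => ?_,
    fun x => ?_⟩
  · rcases hpar (par (x i)) with h | h
    · simp [h]
    · have : (1 : ZMod 2) - 1 = 0 := by decide
      simp [h]
  · rcases hpar (par (x i)) with h | h
    · simp only [h, if_true]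
      exact adj_add_single hL2 x i
    · simp only [h, one_ne_zero, if_false]
      have := adj_add_single hL2 (x - Pi.single i 1) i
      rw [sub_add_cancel] at this
      exact this.symm

lemma two_mul_valMinAbs_bounds [NeZero L] (w : ZMod L) :
    -(L : ℤ) < 2 * w.valMinAbs ∧ 2 * w.valMinAbs ≤ L := by
  have := w.valMinAbs_mem_Ioc
  rw [Set.mem_Ioc] at this
  constructor <;> linarith [this.1, this.2]

lemma valMinAbs_eq [NeZero L] {w : ZMod L} {m : ℤ} (h : w = m) (h1 : -(L : ℤ) < 2 * m)
    (h2 : 2 * m ≤ L) : w.valMinAbs = m :=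
  (ZMod.valMinAbs_spec w m).mpr ⟨h, by rw [Set.mem_Ioc]; constructor <;> linarith⟩

lemma valMinAbs_one_sub [NeZero L] (hL : Even L) (w : ZMod L) :
    (1 - w).valMinAbs = 1 - w.valMinAbs := by
  have h := two_mul_valMinAbs_bounds w
  obtain ⟨k, hk⟩ := hL
  have := NeZero.ne L
  exact valMinAbs_eq (by push_cast [ZMod.coe_valMinAbs]; rfl) (by omega) (by omega)

/-- The reflection of the torus exchanging `a` and `a + 1` in direction `i`. -/
def reflectAt (i : Fin d) (a : ZMod L) (x : Torus d L) : Torus d L :=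
  Function.update x i (2 * a + 1 - x i)

lemma reflectAt_reflectAt (i : Fin d) (a : ZMod L) (x : Torus d L) :
    reflectAt i a (reflectAt i a x) = x := by
  simp [reflectAt]

lemma reflectAt_add_single_of_ne {i j : Fin d} (h : j ≠ i) (a : ZMod L) (x : Torus d L) :
    reflectAt i a (x + Pi.single j 1) = reflectAt i a x + Pi.single j 1 := by
  funext k
  by_cases hk : k = i
  · subst hk; simp [reflectAt, h.symm]
  · simp [reflectAt, hk]

lemma reflectAt_add_single_self (i : Fin d) (a : ZMod L) (x : Torus d L) :
    reflectAt i a x = reflectAt i a (x + Pi.single i 1) + Pi.single i 1 := by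
  funext k
  by_cases hk : k = i
  · subst hk; simp [reflectAt]; ring
  · simp [reflectAt, hk]

/-- The reflections of the torus through planes which cut edges in their midpoints. -/
def torusReflection [NeZero L] (hL : Even L) (i : Fin d) (a : ZMod L) :
    Reflection (torusGraph d L) where
  toFun := reflectAt i a
  half x := 0 < (x i - a).valMinAbs
  invol := reflectAt_reflectAt i a
  adj := by
    have key : ∀ x j, x ≠ x + Pi.single j 1 →
        (torusGraph d L).Adj (reflectAt i a x) (reflectAt i a (x + Pi.single j 1)) := by
      intro x j hne
      refine torusGraph_adj.mpr ⟨fun h => hne ?_, ?_⟩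
      · have := congrArg (reflectAt i a) h
        rwa [reflectAt_reflectAt, reflectAt_reflectAt] at this
      · by_cases hj : j = i
        · subst hj; exact Or.inr ⟨j, reflectAt_add_single_self j a x⟩
        · exact Or.inl ⟨j, reflectAt_add_single_of_ne hj a x⟩
    intro x y hxy
    obtain ⟨hne, ⟨j, rfl⟩ | ⟨j, rfl⟩⟩ := torusGraph_adj.mp hxy
    · exact key x j hne
    · exact (key y j hne.symm).symm
  half_iff x := by
    have : reflectAt i a x i - a = 1 - (x i - a) := by simp [reflectAt]; ring
    rw [this, valMinAbs_one_sub hL]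
    omega
  crossing := by
    intro x y hxy hx hy
    have bx := two_mul_valMinAbs_bounds (x i - a)
    have bY := two_mul_valMinAbs_bounds (y i - a)
    have hL2 := two_le_of_even hL
    obtain ⟨-, ⟨j, rfl⟩ | ⟨j, rfl⟩⟩ := torusGraph_adj.mp hxy
    · by_cases hj : j = i
      · subst hj
        have hval : 2 * (x j - a).valMinAbs = L := by
          by_contra hne
          obtain ⟨k, hk⟩ := hL
          have : ((x + Pi.single j 1 : Torus d L) j - a).valMinAbs =
              (x j - a).valMinAbs + 1 :=
            valMinAbs_eq (by push_cast [ZMod.coe_valMinAbs]; simp; ring) (by omega) (by omega)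
          omega
        have h2 : 2 * (x j - a) = 0 := by
          have := congrArg (Int.cast : ℤ → ZMod L) hval
          simpa using this
        funext k
        by_cases hk : k = j
        · subst hk; simp [reflectAt]; linear_combination h2
        · simp [reflectAt, hk]
      · exact absurd hx (by simpa [Ne.symm hj] using hy)
    · by_cases hj : j = i
      · subst hj
        have : ((y + Pi.single j 1 : Torus d L) j - a).valMinAbs = (y j - a).valMinAbs + 1 :=
          valMinAbs_eq (by push_cast [ZMod.coe_valMinAbs]; simp; ring) (by omega) (by omega)
        have h0 : (y j - a).valMinAbs = 0 := by omega
        have h1 : y j = a := by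
          rw [ZMod.valMinAbs_eq_zero] at h0
          exact sub_eq_zero.mp h0
        funext k
        by_cases hk : k = j
        · subst hk; simp [reflectAt]; linear_combination 2 * h1
        · simp [reflectAt, hk]
      · exact absurd hx (by simpa [Ne.symm hj] using hy)

lemma exists_torusReflection [NeZero L] (hL : Even L) {x y : Torus d L}
    (h : (torusGraph d L).Adj x y) : ∃ (i : Fin d) (a : ZMod L),
      ¬ ((torusReflection hL i a).half x ↔ (torusReflection hL i a).half y) := by
  have hL2 := two_le_of_even hL
  have h1 : (1 : ZMod L).valMinAbs = 1 := valMinAbs_eq (by simp) (by omega) (by omega)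
  obtain ⟨-, ⟨i, rfl⟩ | ⟨i, rfl⟩⟩ := torusGraph_adj.mp h
  · exact ⟨i, x i, by simp [torusReflection, h1]⟩
  · exact ⟨i, y i, by simp [torusReflection, h1]⟩

end TorusGraph

section Periodised

variable {d L : ℕ}

/-- The periodised potential as a function of the difference of its arguments. -/
def periodisedDiff (v : (Fin d → ℤ) → ℝ) (u : Torus d L) : ℝ :=
  ∑' z : Fin d → ℤ, v fun i => (u i).valMinAbs + (L : ℤ) * z i

lemma tsum_lift_eq (v : (Fin d → ℤ) → ℝ) (u : Torus d L) (a : Fin d → ℤ)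
    (h : ∀ i, ((a i : ℤ) : ZMod L) = u i) :
    ∑' z : Fin d → ℤ, v (fun i => a i + (L : ℤ) * z i) = periodisedDiff v u := by
  have : ∀ i, ∃ k : ℤ, a i = (u i).valMinAbs + L * k := fun i => by
    have h1 : ((a i - (u i).valMinAbs : ℤ) : ZMod L) = 0 := by
      push_cast [ZMod.coe_valMinAbs]; rw [h, sub_self]
    obtain ⟨k, hk⟩ := (ZMod.intCast_zmod_eq_zero_iff_dvd _ L).mp h1
    exact ⟨k, by linarith⟩
  choose k hk using this
  rw [periodisedDiff, ← (Equiv.addRight k).tsum_eq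
    fun z => v fun i => (u i).valMinAbs + (L : ℤ) * z i]
  congr 1; funext z; congr 1; funext i
  simp only [hk, Equiv.coe_addRight, Pi.add_apply]; ring

lemma periodised_eq (v : (Fin d → ℤ) → ℝ) (x y : Torus d L) :
    periodised v L x y = periodisedDiff v (y - x) := by
  rw [← tsum_lift_eq v (y - x) (fun i => (y i).valMinAbs - (x i).valMinAbs) (fun i => by
    push_cast [ZMod.coe_valMinAbs]; rfl), periodised]
  congr 1; funext z; congr 1; funext i; ring

lemma periodisedDiff_neg {v : (Fin d → ℤ) → ℝ} (hv : ∀ x, v x = v (-x)) (u : Torus d L) :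
    periodisedDiff v (-u) = periodisedDiff v u := by
  rw [← tsum_lift_eq v (-u) (fun i => -(u i).valMinAbs) (fun i => by
    push_cast [ZMod.coe_valMinAbs]; rfl), periodisedDiff, ← (Equiv.neg _).tsum_eq]
  congr 1; funext z; rw [hv]; congr 1; funext i; simp; ring

lemma lift_injective [NeZero L] : Function.Injective fun p : Torus d L × (Fin d → ℤ) =>
    fun i => (p.1 i).valMinAbs + (L : ℤ) * p.2 i := by
  rintro ⟨u, z⟩ ⟨u', z'⟩ h
  have hL : L ≠ 0 := NeZero.ne L
  have h1 : u = u' := funext fun i => by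
    have := congrArg (Int.cast : ℤ → ZMod L) (congrFun h i)
    simpa using this
  subst h1
  refine Prod.ext rfl (funext fun i => ?_)
  have := congrFun h i
  simpa [hL] using this

lemma summable_lift [NeZero L] {v : (Fin d → ℤ) → ℝ} (hv : Summable v) (u : Torus d L) :
    Summable fun z : Fin d → ℤ => v fun i => (u i).valMinAbs + (L : ℤ) * z i :=
  hv.comp_injective (lift_injective.comp (Prod.mk_right_injective u))

lemma sum_periodisedDiff_le [NeZero L] {v : (Fin d → ℤ) → ℝ} (hv : Summable v)
    (h0 : ∀ x, 0 ≤ v x) : ∑ u : Torus d L, periodisedDiff v u ≤ ∑' x, v x := by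
  have h1 : Summable fun p : Torus d L × (Fin d → ℤ) =>
      v fun i => (p.1 i).valMinAbs + (L : ℤ) * p.2 i := hv.comp_injective lift_injective
  have h2 := h1.tsum_prod.trans (tsum_fintype _)
  unfold periodisedDiff
  rw [← h2]
  exact tsum_comp_le_tsum_of_inj hv h0 lift_injective

lemma abs_periodisedDiff_le [NeZero L] {v : (Fin d → ℤ) → ℝ} (hv : Summable fun x => |v x|)
    (u : Torus d L) : |periodisedDiff v u| ≤ periodisedDiff (fun x => |v x|) u :=
  norm_tsum_le_tsum_norm (f := fun z : Fin d → ℤ => v fun i => (u i).valMinAbs + (L : ℤ) * z i)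
    (summable_lift hv u)

lemma sum_abs_periodisedDiff_le [NeZero L] {v : (Fin d → ℤ) → ℝ}
    (hv : Summable fun x => |v x|) : ∑ u : Torus d L, |periodisedDiff v u| ≤ ∑' x, |v x| :=
  (Finset.sum_le_sum fun u _ => abs_periodisedDiff_le hv u).trans
    (sum_periodisedDiff_le hv fun _ => abs_nonneg _)

lemma sum_abs_periodised_le [NeZero L] {v : (Fin d → ℤ) → ℝ} (hv : Summable fun x => |v x|)
    (x : Torus d L) : ∑ y, |periodised v L x y| ≤ ∑' x, |v x| := by
  refine le_trans (le_of_eq ?_) (sum_abs_periodisedDiff_le (L := L) hv)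
  simp only [periodised_eq]
  exact Fintype.sum_equiv (Equiv.subRight x) _ _ fun y => rfl

lemma interaction_one_le [NeZero L] {v : (Fin d → ℤ) → ℝ} (hv : Summable fun x => |v x|) :
    interaction (periodised v L) (fun _ => 1) ≤ (∑' x, |v x|) * Fintype.card (Torus d L) := by
  have : interaction (periodised v L) (fun _ => 1) ≤ ∑ _x : Torus d L, ∑' x, |v x| := by
    refine Finset.sum_le_sum fun x _ => le_trans ?_ (sum_abs_periodised_le (L := L) hv x)
    refine Finset.sum_le_sum fun y _ => ?_
    simpa using le_abs_self _
  refine this.trans_eq ?_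
  rw [Finset.sum_const, nsmul_eq_mul, Finset.card_univ, mul_comm]

/-- Tempered potentials are superstable, with constant `vbar`. -/
lemma vbar_mul_le_interaction [NeZero L] {v : (Fin d → ℤ) → ℝ} (hv : IsTempered v)
    (n : Torus d L → ℕ) :
    vbar v * ∑ x, (n x : ℝ) ^ 2 ≤ interaction (periodised v L) n := by
  classical
  obtain ⟨hvb, hsum⟩ := hv
  set w : (Fin d → ℤ) → ℝ := fun x => -(if v x < 0 then v x else 0) with hw
  have hw0 : ∀ x, 0 ≤ w x := fun x => by simp only [hw]; split_ifs <;> linarith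
  have hws : Summable w := hsum.of_nonneg_of_le hw0 fun x => by
    simp only [hw]; split_ifs
    · exact neg_le_abs _
    · simp
  have hvbar : vbar v = v 0 - ∑' x, w x := by
    rw [vbar, hw, tsum_neg]
    have : ∀ x, (if v x < 0 then v x else 0) =
      @ite ℝ (v x < 0) (Classical.propDecidable _) (v x) 0 := fun x => by congr
    simp only [this]; ring
  have hv0 : 0 ≤ v 0 := by
    have : 0 ≤ ∑' x, w x := tsum_nonneg hw0
    linarith
  have hpt : ∀ u : Torus d L,
      (if u = 0 then v 0 else 0) - periodisedDiff w u ≤ periodisedDiff v u := by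
    intro u
    have hs1 := summable_lift hws u
    have hs2 := summable_lift (L := L) hsum.of_abs u
    by_cases hu : u = 0
    · subst hu
      rw [if_pos rfl]
      have hd : HasSum (fun z : Fin d → ℤ => if z = 0 then v 0 else 0) (v 0) := by
        convert hasSum_ite_eq (0 : Fin d → ℤ) (v 0)
      have h3 := hd.sub hs1.hasSum
      refine hasSum_le (fun z => ?_) h3 hs2.hasSum
      by_cases hz : z = 0
      · subst hz
        have hv0' : ¬ v (fun _ : Fin d => (0 : ℤ)) < 0 := not_lt.mpr hv0
        simp only [hw, if_true, Pi.zero_apply, ZMod.valMinAbs_zero, mul_zero, add_zero,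
          if_neg hv0', neg_zero, sub_zero]
        exact le_rfl
      · simp only [if_neg hz, hw]; split_ifs <;> linarith
    · rw [if_neg hu, zero_sub]
      refine hasSum_le (fun z => ?_) hs1.hasSum.neg hs2.hasSum
      simp only [hw]; split_ifs <;> linarith
  have hW0 : ∀ u : Torus d L, 0 ≤ periodisedDiff w u := fun u => tsum_nonneg fun _ => hw0 _
  set S := ∑ u : Torus d L, periodisedDiff w u with hS
  have hSle : S ≤ ∑' x, w x := sum_periodisedDiff_le hws hw0
  have hr : ∀ x : Torus d L, ∑ y, periodisedDiff w (y - x) = S := fun x =>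
    Fintype.sum_equiv (Equiv.subRight x) _ _ fun y => rfl
  have hl : ∀ y : Torus d L, ∑ x, periodisedDiff w (y - x) = S := fun y =>
    Fintype.sum_equiv (Equiv.subLeft y) _ _ fun x => rfl
  have hlow : ∑ x : Torus d L, ∑ y, ((if y - x = 0 then v 0 else 0) * (n x : ℝ) * (n y : ℝ) -
      periodisedDiff w (y - x) * ((n x : ℝ) ^ 2 / 2) -
      periodisedDiff w (y - x) * ((n y : ℝ) ^ 2 / 2)) ≤ interaction (periodised v L) n := by
    refine Finset.sum_le_sum fun x _ => Finset.sum_le_sum fun y _ => ?_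
    rw [periodised_eq]
    have h1 := mul_le_mul_of_nonneg_right (hpt (y - x))
      (mul_nonneg (Nat.cast_nonneg (α := ℝ) (n x)) (Nat.cast_nonneg (α := ℝ) (n y)))
    have h2 := mul_nonneg (hW0 (y - x)) (sq_nonneg ((n x : ℝ) - n y))
    nlinarith
  refine le_trans ?_ hlow
  simp only [Finset.sum_sub_distrib]
  have e1 : ∑ x : Torus d L, ∑ y, (if y - x = 0 then v 0 else 0) * (n x : ℝ) * (n y : ℝ) =
      v 0 * ∑ x, (n x : ℝ) ^ 2 := by
    rw [Finset.mul_sum]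
    refine Finset.sum_congr rfl fun x _ => ?_
    rw [Finset.sum_eq_single x]
    · simp; ring
    · intro y _ hy; simp [sub_eq_zero, hy]
    · simp
  have e2 : ∑ x : Torus d L, ∑ y, periodisedDiff w (y - x) * ((n x : ℝ) ^ 2 / 2) =
      S * (∑ x, (n x : ℝ) ^ 2) / 2 := by
    simp only [← Finset.sum_mul, hr, ← Finset.mul_sum, ← Finset.sum_div]; ring
  have e3 : ∑ x : Torus d L, ∑ y, periodisedDiff w (y - x) * ((n y : ℝ) ^ 2 / 2) =
      S * (∑ x, (n x : ℝ) ^ 2) / 2 := by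
    rw [Finset.sum_comm]
    simp only [← Finset.sum_mul, hl, ← Finset.mul_sum, ← Finset.sum_div]; ring
  rw [e1, e2, e3, hvbar]
  have : 0 ≤ ∑ x, (n x : ℝ) ^ 2 := Finset.sum_nonneg fun _ _ => sq_nonneg _
  nlinarith

end Periodised

end RandomPath
end

noncomputable section

namespace RandomPath

section TorusReflectionPositivity

variable {d L : ℕ}

lemma valMinAbs_reflect [NeZero L] (hL : Even L) (i : Fin d) (x : Torus d L) :
    (reflect i x i).valMinAbs = 1 - (x i).valMinAbs := by
  simp [reflect, valMinAbs_one_sub hL]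

/-- The kernel of a separable potential across the reflection plane is hermitian and positive
semidefinite. -/
lemma IsSeparableAlong.kernel [NeZero L] (hL : Even L) {v : (Fin d → ℤ) → ℝ} {i : Fin d}
    (h : IsSeparableAlong v L i) :
    (∀ x y : Torus d L, 0 < (x i).valMinAbs → 0 < (y i).valMinAbs →
      periodised v L x (reflect i y) = periodised v L y (reflect i x)) ∧
    ∀ c : Torus d L → ℝ, (∀ x, ¬ 0 < (x i).valMinAbs → c x = 0) →
      ∑ x, ∑ y, c x * c y * periodised v L x (reflect i y) ≤ 0 := by
  obtain ⟨k, T, _, ν, α, β, hν, hα, hβ, ⟨B, hB⟩, hrep, hconj⟩ := h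
  have hint : ∀ x y j, Integrable (fun t => α t x j * (starRingEnd ℂ) (α t y j)) ν := by
    intro x y j
    refine Integrable.of_bound (C := B * B) ?_ (Filter.Eventually.of_forall fun t => ?_)
    · exact ((hα x j).mul (Complex.continuous_conj.measurable.comp (hα y j))).aestronglyMeasurable
    · rw [norm_mul, RCLike.norm_conj]
      exact mul_le_mul (hB t x j).1 (hB t y j).1 (norm_nonneg _)
        ((norm_nonneg _).trans (hB t x j).1)
  have hker : ∀ x y : Torus d L, 0 < (x i).valMinAbs → 0 < (y i).valMinAbs →
      ((-periodised v L x (reflect i y) : ℝ) : ℂ) =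
        ∫ t, ∑ j, α t x j * (starRingEnd ℂ) (α t y j) ∂ν := by
    intro x y hx hy
    rw [hrep x (reflect i y) hx (by rw [valMinAbs_reflect hL]; omega)]
    refine integral_congr_ae ?_
    filter_upwards [hconj (reflect i y)] with t ht
    refine Finset.sum_congr rfl fun j _ => ?_
    rw [ht j]
    simp [reflect]
  refine ⟨fun x y hx hy => ?_, fun c hc => ?_⟩
  · have h1 := congrArg (starRingEnd ℂ) (hker x y hx hy)
    rw [Complex.conj_ofReal, ← integral_conj] at h1
    have h2 : ((-periodised v L x (reflect i y) : ℝ) : ℂ) =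
        ((-periodised v L y (reflect i x) : ℝ) : ℂ) := by
      rw [h1, hker y x hy hx]
      congr 1; funext t
      rw [map_sum]
      exact Finset.sum_congr rfl fun j _ => by rw [map_mul, Complex.conj_conj, mul_comm]
    have := Complex.ofReal_injective h2
    linarith
  · have h1 : ((-∑ x, ∑ y, c x * c y * periodised v L x (reflect i y) : ℝ) : ℂ) =
        ∫ t, ((∑ j, ‖∑ x, (c x : ℂ) * α t x j‖ ^ 2 : ℝ) : ℂ) ∂ν := by
      have e1 : ((-∑ x, ∑ y, c x * c y * periodised v L x (reflect i y) : ℝ) : ℂ) =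
          ∑ x, ∑ y, (c x : ℂ) * c y * ∫ t, ∑ j, α t x j * (starRingEnd ℂ) (α t y j) ∂ν := by
        rw [← Finset.sum_neg_distrib, Complex.ofReal_sum]
        refine Finset.sum_congr rfl fun x _ => ?_
        rw [← Finset.sum_neg_distrib, Complex.ofReal_sum]
        refine Finset.sum_congr rfl fun y _ => ?_
        by_cases hx : 0 < (x i).valMinAbs
        · by_cases hy : 0 < (y i).valMinAbs
          · rw [← hker x y hx hy]; push_cast; ring
          · simp [hc y hy]
        · simp [hc x hx]
      rw [e1]
      have e2 : ∀ t, ((∑ j, ‖∑ x, (c x : ℂ) * α t x j‖ ^ 2 : ℝ) : ℂ) =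
          ∑ x, ∑ y, (c x : ℂ) * c y * ∑ j, α t x j * (starRingEnd ℂ) (α t y j) := by
        intro t
        simp only [Finset.mul_sum]
        symm
        push_cast
        calc _ = ∑ x, ∑ j, ∑ y, (c x : ℂ) * c y * (α t x j * (starRingEnd ℂ) (α t y j)) :=
              Finset.sum_congr rfl fun x _ => Finset.sum_comm
          _ = ∑ j, ∑ x, ∑ y, (c x : ℂ) * c y * (α t x j * (starRingEnd ℂ) (α t y j)) :=
              Finset.sum_comm
          _ = _ := Finset.sum_congr rfl fun j _ => ?_
        rw [← Complex.mul_conj', map_sum, Finset.sum_mul_sum]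
        refine Finset.sum_congr rfl fun x _ => Finset.sum_congr rfl fun y _ => ?_
        rw [map_mul, Complex.conj_ofReal]; ring
      simp only [e2]
      rw [integral_finsetSum _ fun x _ => integrable_finsetSum _ fun y _ =>
        (integrable_finsetSum _ fun j _ => hint x y j).const_mul _]
      refine Finset.sum_congr rfl fun x _ => ?_
      rw [integral_finsetSum _ fun y _ =>
        (integrable_finsetSum _ fun j _ => hint x y j).const_mul _]
      exact Finset.sum_congr rfl fun y _ => (integral_const_mul _ _).symm
    rw [integral_complex_ofReal] at h1
    have h2 := Complex.ofReal_injective h1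
    have h3 : 0 ≤ ∫ t, ∑ j, ‖∑ x, (c x : ℂ) * α t x j‖ ^ 2 ∂ν :=
      integral_nonneg fun t => Finset.sum_nonneg fun j _ => sq_nonneg _
    linarith

/-- Separable even potentials are invariant under the reflection of one coordinate. -/
lemma periodisedDiff_update_neg [NeZero L] (hL : Even L) {v : (Fin d → ℤ) → ℝ}
    (hv : ∀ x, v x = v (-x)) {i : Fin d} (h : IsSeparableAlong v L i) (u : Torus d L) :
    periodisedDiff v (Function.update u i (-u i)) = periodisedDiff v u := by
  have hL2 := two_le_of_even hL
  by_cases hu : u i = 0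
  · rw [hu, neg_zero, ← hu, Function.update_eq_self]
  have hab : ∃ a b : ZMod L, 0 < a.valMinAbs ∧ 0 < b.valMinAbs ∧ 1 - b - a = u i := by
    have hbd := two_mul_valMinAbs_bounds (-u i)
    set m := (-u i).valMinAbs with hm
    have hm0 : m ≠ 0 := by rw [hm, Ne, ZMod.valMinAbs_eq_zero]; simpa using hu
    have hmc : (m : ZMod L) = -u i := ZMod.coe_valMinAbs _
    obtain ⟨k, hk⟩ := hL
    have hLk : ((k : ZMod L) + k) = 0 := by
      have : ((k + k : ℕ) : ZMod L) = 0 := by rw [← hk]; exact ZMod.natCast_self L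
      exact_mod_cast this
    rcases lt_or_gt_of_ne hm0 with hneg | hpos
    · refine ⟨(k : ℤ), (m + 1 + k : ℤ), ?_, ?_, ?_⟩
      · rw [valMinAbs_eq (m := k) rfl (by omega) (by omega)]; omega
      · rw [valMinAbs_eq (m := m + 1 + k) rfl (by omega) (by omega)]; omega
      · push_cast; linear_combination -hLk - hmc
    · refine ⟨(1 : ℤ), (m : ℤ), ?_, ?_, ?_⟩
      · rw [valMinAbs_eq (m := 1) rfl (by omega) (by omega)]; omega
      · rw [valMinAbs_eq (m := m) rfl (by omega) (by omega)]; omega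
      · push_cast; linear_combination -hmc
  obtain ⟨a, b, ha, hb, hab⟩ := hab
  let x : Torus d L := Function.update 0 i a
  let y : Torus d L := Function.update u i b
  have h1 := (h.kernel hL).1 x y (by simpa [x] using ha) (by simpa [y] using hb)
  rw [periodised_eq, periodised_eq] at h1
  have e1 : reflect i y - x = u := by
    funext j
    by_cases hj : j = i
    · subst hj; simpa [reflect, x, y] using hab
    · simp [reflect, x, y, hj]
  have e2 : reflect i x - y = -Function.update u i (-u i) := by
    funext j
    by_cases hj : j = i
    · subst hj; simp [reflect, x, y, ← hab]; ring
    · simp [reflect, x, y, hj]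
  rw [e1, e2, periodisedDiff_neg hv] at h1
  exact h1.symm

theorem isReflectionPositive_periodised [NeZero L] (hL : Even L) {v : (Fin d → ℤ) → ℝ}
    (hv : ∀ x, v x = v (-x)) {i : Fin d} (h : IsSeparableAlong v L i) (a : ZMod L) :
    IsReflectionPositive (torusReflection hL i a) (periodised v L) where
  symm x y := by rw [periodised_eq, periodised_eq, ← periodisedDiff_neg hv, neg_sub]
  reflect x y := by
    rw [periodised_eq, periodised_eq, ← periodisedDiff_update_neg hL hv h (y - x)]
    congr 1
    funext j
    by_cases hj : j = i
    · subst hj; simp [torusReflection, reflectAt]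
    · simp [torusReflection, reflectAt, hj]
  nonpos c hc := by
    have h1 := (h.kernel hL).2 (fun x => c (x + Pi.single i a)) fun x hx => hc _ (by
      simpa [torusReflection] using hx)
    refine le_trans (le_of_eq ?_) h1
    have key : ∀ x y : Torus d L, periodised v L x (reflect i y) =
        periodised v L (x + Pi.single i a) (reflectAt i a (y + Pi.single i a)) := fun x y => by
      rw [periodised_eq, periodised_eq]
      congr 1
      funext j
      by_cases hj : j = i
      · subst hj; simp [reflect, reflectAt]; ring
      · simp [reflect, reflectAt, hj]
    simp only [key]
    symm
    refine Fintype.sum_equiv (Equiv.addRight (Pi.single i a)) _ _ fun x => ?_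
    exact Fintype.sum_equiv (Equiv.addRight (Pi.single i a)) _ _ fun y => rfl

end TorusReflectionPositivity

end RandomPath
end

noncomputable section

namespace RandomPath

section ClosedConfigs

variable {V : Type} {G : SimpleGraph V} {N K : ℕ}

/-- The links touching `x`, sorted by their edges. -/
def starEquiv (m : G.edgeSet → ℕ) (x : V) :
    LinkAt m x ≃ Σ e : {e : G.edgeSet // x ∈ (e : Sym2 V)}, Fin (m e.1) where
  toFun l := ⟨⟨l.1.1, l.2⟩, l.1.2⟩
  invFun l := ⟨⟨l.1.1, l.2⟩, l.1.2⟩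
  left_inv _ := rfl
  right_inv _ := rfl

variable [Fintype V]

lemma Config.mem_closedConfigs {w : Config G N} : w ∈ closedConfigs G N ↔
    ∀ x, (∀ l, w.partner x l ≠ l) ∧ w.ghost x = 0 := by
  refine forall_congr' fun x => and_congr_left fun _ => ?_
  unfold Config.unpaired Config.unpairedColour
  simp only [Finset.sum_eq_zero_iff, Finset.mem_univ, true_imp_iff]
  constructor
  · intro h l hl
    have := h (w.colour l.1.1 l.1.2)
    rw [Finite.card_eq_zero_iff] at this
    exact this.elim ⟨l, hl, rfl⟩
  · intro h i
    have : IsEmpty {l : LinkAt w.links x // w.partner x l = l ∧ w.colour l.1.1 l.1.2 = i} :=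
      ⟨fun l => h _ l.2.1⟩
    exact Nat.card_of_isEmpty

open scoped Classical in
lemma card_linkAt (m : G.edgeSet → ℕ) (x : V) :
    Nat.card (LinkAt m x) = ∑ e : G.edgeSet, if x ∈ (e : Sym2 V) then m e else 0 := by
  rw [Nat.card_congr (starEquiv m x), Nat.card_eq_fintype_card, Fintype.card_sigma]
  simp only [Fintype.card_fin]
  rw [← Finset.sum_filter, Finset.sum_subtype (p := fun e : G.edgeSet => x ∈ (e : Sym2 V))]
  simp

lemma Config.numPairings_of_mem {w : Config G N} (hw : w ∈ closedConfigs G N) (x : V) :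
    w.numPairings x = Nat.card (LinkAt w.links x) / 2 := by
  have h := Config.mem_closedConfigs.mp hw x
  rw [Config.numPairings, h.2]
  simp only [Fin.val_zero, add_zero]
  congr 1
  exact Nat.card_congr (Equiv.subtypeUnivEquiv h.1)

/-- A state on the edges, together with pairings at all vertices. -/
abbrev PairedState (G : SimpleGraph V) (N K : ℕ) : Type :=
  Σ s : G.edgeSet → EdgeState N K, (x : V) →
    Matching fun l : Σ e : {e : G.edgeSet // x ∈ (e : Sym2 V)}, Fin (s e.1).1 => (s l.1.1).2 l.2

lemma card_modEq_card_fixed {X : Type*} [Finite X] {f : X → X} (hf : Function.Involutive f) :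
    Nat.card X ≡ Nat.card {x // f x = x} [MOD 2] := by
  classical
  have := Fintype.ofFinite X
  let g : Function.End X := f
  have h : g ^ 2 ^ 1 = 1 := by
    rw [pow_one, sq]; exact funext hf
  rw [Nat.card_eq_fintype_card, Nat.card_eq_fintype_card]
  exact Equiv.Perm.card_fixedPoints_modEq (p := 2) h

lemma even_card_of_involutive {X : Type*} [Finite X] {f : X → X} (hf : Function.Involutive f)
    (h : ∀ x, f x ≠ x) : Even (Nat.card X) := by
  have h1 := card_modEq_card_fixed hf
  have : IsEmpty {x // f x = x} := ⟨fun x => h x.1 x.2⟩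
  rw [Nat.card_of_isEmpty (α := {x // f x = x})] at h1
  exact Nat.even_iff.mpr h1

instance {X : Type*} [Finite X] {N : ℕ} (col : X → Fin N) : Fintype (Matching col) :=
  Fintype.ofFinite _

open scoped Classical in
instance : Fintype (PairedState G N K) := Fintype.ofFinite _

open scoped Classical in
lemma PairedState.sum_eq (f : PairedState G N K → ℝ) : ∑ t, f t = ∑ s, ∑ π, f ⟨s, π⟩ := by
  rw [← Fintype.sum_sigma]
  exact Finset.sum_congr (by ext; simp) fun _ _ => rfl

/-- The configuration of closed paths given by links, colours and pairings. -/
def PairedState.toConfig (t : PairedState G N K) : Config G N where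
  links e := (t.1 e).1
  even_links x := by
    classical
    have h := even_card_of_involutive (t.2 x).2.1 fun l => ((t.2 x).2.2 l).1
    rw [← Nat.card_congr (starEquiv (fun e => ((t.1 e).1 : ℕ)) x), card_linkAt] at h
    exact h
  colour e := (t.1 e).2
  partner x l := (starEquiv _ x).symm ((t.2 x).1 (starEquiv _ x l))
  partner_involutive x l := by
    simp only [Equiv.apply_symm_apply]
    rw [(t.2 x).2.1, Equiv.symm_apply_apply]
  colour_partner x l := ((t.2 x).2.2 (starEquiv _ x l)).2
  ghost _ := 0

lemma PairedState.toConfig_mem (t : PairedState G N K) : t.toConfig ∈ closedConfigs G N :=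
  Config.mem_closedConfigs.mpr fun x => ⟨fun l hl => ((t.2 x).2.2 (starEquiv _ x l)).1 (by
    have := congrArg (starEquiv _ x) hl
    exact ((starEquiv _ x).apply_symm_apply _).symm.trans this), rfl⟩

lemma PairedState.toConfig_injective :
    Function.Injective (PairedState.toConfig : PairedState G N K → Config G N) := by
  rintro ⟨s, π⟩ ⟨s', π'⟩ h
  have hs : s = s' := by
    funext e
    let f : EdgeState N K → Σ m : ℕ, (Fin m → Fin N) := fun a => ⟨a.1, a.2⟩
    have hf : Function.Injective f := by
      rintro ⟨⟨m, hm⟩, c⟩ ⟨⟨m', hm'⟩, c'⟩ h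
      simp only [f, Sigma.mk.injEq] at h
      obtain ⟨h1, h2⟩ := h
      subst h1
      rw [eq_of_heq h2]
    exact hf (congrArg (fun w : Config G N =>
      (⟨w.links e, w.colour e⟩ : Σ m : ℕ, (Fin m → Fin N))) h)
  subst hs
  congr 1
  funext x
  apply Subtype.ext
  funext l
  have hp : ∀ w w' : Config G N, w = w' → HEq w.partner w'.partner := by
    rintro w _ rfl; rfl
  let m : G.edgeSet → ℕ := fun e => (s e).1
  have h0 : (fun (x : V) (l : LinkAt m x) =>
      (starEquiv m x).symm ((π x).1 (starEquiv m x l))) =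
      fun x l => (starEquiv m x).symm ((π' x).1 (starEquiv m x l)) := eq_of_heq (hp _ _ h)
  have h1 := congrFun (congrFun h0 x) ((starEquiv m x).symm l)
  exact (starEquiv m x).symm.injective h1

lemma PairedState.exists_toConfig {w : Config G N} (hw : w ∈ closedConfigs G N)
    (hK : ∀ e, w.links e ≤ K) : ∃ t : PairedState G N K, t.toConfig = w := by
  have h := Config.mem_closedConfigs.mp hw
  obtain ⟨links, ev, colour, partner, inv, col, ghost⟩ := w
  refine ⟨⟨fun e => ⟨⟨links e, Nat.lt_succ_of_le (hK e)⟩, colour e⟩, fun x =>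
    ⟨fun l => starEquiv links x (partner x ((starEquiv links x).symm l)), fun l => ?_, fun l =>
      ⟨fun hl => ?_, ?_⟩⟩⟩, ?_⟩
  · simp only [Equiv.symm_apply_apply]
    rw [inv x, Equiv.apply_symm_apply]
  · exact (h x).1 ((starEquiv links x).symm l) ((starEquiv links x).injective (by
      simpa using hl))
  · exact col x ((starEquiv links x).symm l)
  · have hg : ghost = fun _ => 0 := funext fun x => (h x).2
    subst hg
    rfl

open scoped Classical in
/-- The weight of a configuration with general one-body functions. -/
def Config.weightWith (u : V → ℕ → ℝ) (v : V → V → ℝ) (lam : ℝ) (w : Config G N) : ℝ :=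
  (∏ e : G.edgeSet, lam ^ w.links e / ((w.links e).factorial : ℝ)) *
    (∏ x : V, u x (w.numPairings x)) * Real.exp (-w.energy v)

lemma Config.weightWith_nonneg {u : V → ℕ → ℝ} (hu : ∀ x n, 0 ≤ u x n) (v : V → V → ℝ) {lam : ℝ}
    (hlam : 0 ≤ lam) (w : Config G N) : 0 ≤ w.weightWith u v lam :=
  mul_nonneg (mul_nonneg (Finset.prod_nonneg fun e _ => by positivity)
    (Finset.prod_nonneg fun x _ => hu _ _)) (Real.exp_nonneg _)

lemma PairedState.numPairings_toConfig (t : PairedState G N K) (x : V) :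
    t.toConfig.numPairings x = occupation t.1 x := by
  classical
  rw [Config.numPairings_of_mem t.toConfig_mem, card_linkAt]
  rfl

open scoped Classical in
lemma sum_weightWith_toConfig (u : V → ℕ → ℝ) (v : V → V → ℝ) (lam : ℝ) :
    ∑ t : PairedState G N K, t.toConfig.weightWith u v lam = stateSum G N K v lam u := by
  rw [PairedState.sum_eq, stateSum]
  refine Finset.sum_congr rfl fun s _ => ?_
  have h : ∀ π, (PairedState.toConfig (⟨s, π⟩ : PairedState G N K)).weightWith u v lam =
      (∏ e, edgeWeight lam (s e)) * (∏ x, u x (occupation s x)) *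
        Real.exp (-interaction v (occupation s)) := fun π => by
    simp only [Config.weightWith, Config.energy, PairedState.numPairings_toConfig]
    rfl
  simp only [h, Finset.sum_const, Finset.card_univ, Fintype.card_pi, nsmul_eq_mul]
  rw [stateWeight, Finset.prod_mul_distrib]
  have hc : ∀ x, Fintype.card (Matching fun l : Σ e : {e : G.edgeSet // x ∈ (e : Sym2 V)},
      Fin (s e.1).1 => (s l.1.1).2 l.2) = pairingCount s x := fun x =>
    Nat.card_eq_fintype_card.symm
  simp only [hc]
  push_cast
  ring

/-- Finite sums over configurations of closed paths are bounded by sums over states. -/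
lemma exists_sum_weightWith_le {u : V → ℕ → ℝ} (hu : ∀ x n, 0 ≤ u x n) (v : V → V → ℝ) {lam : ℝ}
    (hlam : 0 ≤ lam) (T : Finset (closedConfigs G N)) : ∃ K, 2 ≤ K ∧
      ∑ w ∈ T, w.1.weightWith u v lam ≤ stateSum G N K v lam u := by
  classical
  let K := 2 + ∑ w ∈ T, ∑ e, w.1.links e
  refine ⟨K, Nat.le_add_right _ _, ?_⟩
  have hK : ∀ w ∈ T, ∀ e, w.1.links e ≤ K := fun w hw e =>
    ((Finset.single_le_sum (f := fun e => w.1.links e) (fun _ _ => Nat.zero_le _)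
      (Finset.mem_univ e)).trans (Finset.single_le_sum (f := fun w : closedConfigs G N =>
        ∑ e, w.1.links e) (fun _ _ => Nat.zero_le _) hw)).trans (Nat.le_add_left _ _)
  rw [← sum_weightWith_toConfig]
  rw [← Finset.sum_image (f := fun w : Config G N => w.weightWith u v lam)
    (g := fun w : closedConfigs G N => w.1) fun _ _ _ _ h => Subtype.ext h]
  rw [← Finset.sum_image (f := fun w : Config G N => w.weightWith u v lam)
    (g := fun t : PairedState G N K => t.toConfig)
    fun _ _ _ _ h => PairedState.toConfig_injective h]
  refine Finset.sum_le_sum_of_subset_of_nonneg ?_ fun w _ _ =>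
    Config.weightWith_nonneg hu v hlam w
  intro w hw
  obtain ⟨w', hw', rfl⟩ := Finset.mem_image.mp hw
  obtain ⟨t, ht⟩ := PairedState.exists_toConfig (K := K) w'.2 (hK w' hw')
  exact Finset.mem_image.mpr ⟨t, Finset.mem_univ _, ht⟩

lemma Config.weight_nonneg {U : ℕ → ℝ} (hU : ∀ n, 0 ≤ U n) (v : V → V → ℝ) {lam : ℝ}
    (hlam : 0 ≤ lam) (w : Config G N) : 0 ≤ w.weight U v lam :=
  Config.weightWith_nonneg (fun _ => hU) v hlam w

lemma stateSum_le_partitionFunction {U : ℕ → ℝ} (hU : ∀ n, 0 ≤ U n) {v : V → V → ℝ} {lam : ℝ}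
    (hlam : 0 ≤ lam) (hs : Summable fun w : closedConfigs G N => w.1.weight U v lam) :
    stateSum G N K v lam (fun _ => U) ≤ partitionFunction G N U v lam := by
  classical
  rw [← sum_weightWith_toConfig]
  let f : PairedState G N K → closedConfigs G N := fun t => ⟨t.toConfig, t.toConfig_mem⟩
  have hf : Function.Injective f := fun t t' h =>
    PairedState.toConfig_injective (congrArg Subtype.val h)
  have := Summable.sum_le_tsum (Finset.univ.image f)
    (fun w _ => Config.weight_nonneg hU v hlam w.1) hs
  rw [Finset.sum_image fun _ _ _ _ h => hf h] at this
  exact this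

open scoped Classical in
lemma Config.weightWith_single (U : ℕ → ℝ) (v : V → V → ℝ) (lam B : ℝ) (z : V)
    (w : Config G N) :
    w.weightWith (fun x n => U n * if x = z then Real.exp (B * n) else 1) v lam =
      w.weight U v lam * Real.exp (B * w.numPairings z) := by
  rw [Config.weightWith, Config.weight, Finset.prod_mul_distrib, Finset.prod_ite_eq' Finset.univ z,
    if_pos (Finset.mem_univ z)]
  ring

open scoped Classical in
lemma sum_weight_mul_exp_le (hG : G.Preconnected) {v : V → V → ℝ} {lam B C c : ℝ}
    (hlam : 0 ≤ lam) (hB : 0 ≤ B) (hc : 0 < c) {U : ℕ → ℝ} (hU : ∀ n, 0 ≤ U n)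
    (hupper : ∀ K, stateSum G N K v lam (fun _ n => U n * Real.exp (B * n)) ≤ C ^ Fintype.card V)
    (hlower : ∀ K, 2 ≤ K → c ^ Fintype.card V ≤ stateSum G N K v lam fun _ => U) (hC : 0 < C)
    (hrefl : ∀ x y, G.Adj x y → ∃ θ : Reflection G, ¬ (θ.half x ↔ θ.half y) ∧
      IsReflectionPositive θ v)
    (hs : Summable fun w : closedConfigs G N => w.1.weight U v lam) (z : V)
    (T : Finset (closedConfigs G N)) :
    ∑ w ∈ T, w.1.weight U v lam * Real.exp (B * w.1.numPairings z) ≤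
      C / c * partitionFunction G N U v lam := by
  have hu : ∀ (x : V) (n : ℕ), 0 ≤ U n * if x = z then Real.exp (B * n) else 1 := fun x n =>
    mul_nonneg (hU n) (by split_ifs; exacts [Real.exp_nonneg _, zero_le_one])
  obtain ⟨K, hK2, hK⟩ := exists_sum_weightWith_le hu v hlam T
  simp only [Config.weightWith_single] at hK
  exact hK.trans ((stateSum_single_le hG hlam hB hc hU (hupper K) (hlower K hK2) hC hrefl
    z).trans (mul_le_mul_of_nonneg_left (stateSum_le_partitionFunction hU hlam hs)
      (div_nonneg hC.le hc.le)))

end ClosedConfigs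

section TorusMoments

/-- Exponential moments of the number of pairings at a vertex of the torus are bounded uniformly
in the size of the torus. -/
theorem exists_exp_moment_bound {d N : ℕ} (hd : 1 ≤ d) (hN : 0 < N) {lam : ℝ} (hlam : 0 < lam)
    {v : (Fin d → ℤ) → ℝ} (hv_symm : ∀ x, v x = v (-x))
    (hv_tempered : IsTempered v) (hv_separable : IsSeparable v)
    {U : ℕ → ℝ} (hU : ∀ n, 0 ≤ U n) (hU_ne : ∃ n, U n ≠ 0) (hU_good : IsGood v U)
    {B : ℝ} (hB : 0 ≤ B) :
    ∃ R : ℝ, 0 < R ∧ ∀ (L : ℕ) [NeZero L], Even L →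
      ((Summable fun w : closedConfigs (torusGraph d L) N =>
          w.1.weight U (periodised v L) lam) ∧
        0 < partitionFunction (torusGraph d L) N U (periodised v L) lam) ∧
      ∀ (z : Torus d L) (T : Finset (closedConfigs (torusGraph d L) N)),
        ∑ w ∈ T, w.1.weight U (periodised v L) lam * Real.exp (B * w.1.numPairings z) ≤
          R * partitionFunction (torusGraph d L) N U (periodised v L) lam := by
  classical
  obtain ⟨M₀, hM₀⟩ := hU_good
  obtain ⟨M, hM, hgood⟩ : ∃ M : ℝ, 0 ≤ M ∧ ∀ n : ℕ,
      (n : ℝ) * (U (n + 1) * Real.exp (-vbar v * ((n + 1 : ℕ) : ℝ) ^ 2)) ≤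
        M * (U n * Real.exp (-vbar v * (n : ℝ) ^ 2)) :=
    ⟨max M₀ 0, le_max_right _ _, fun n => (hM₀ n).trans (mul_le_mul_of_nonneg_right
      (le_max_left _ _) (mul_nonneg (hU n) (Real.exp_nonneg _)))⟩
  have hU01 : 0 < U 0 ∨ 0 < U 1 := by
    by_contra hcon
    push Not at hcon
    obtain ⟨n, hn⟩ := hU_ne
    have hdec := good_decay hU hM hgood n
    have h0 : U 0 = 0 := le_antisymm hcon.1 (hU 0)
    have h1 : U 1 = 0 := le_antisymm hcon.2 (hU 1)
    rw [h0, h1, zero_mul, add_zero, zero_mul] at hdec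
    have hpos : 0 < U n := lt_of_le_of_ne (hU n) (Ne.symm hn)
    have : 0 < (n.factorial : ℝ) * (U n * Real.exp (-vbar v * (n : ℝ) ^ 2)) := by positivity
    linarith
  set C := (U 0 + U 1 * Real.exp (-vbar v)) *
    Real.exp (N * (lam * (4 * (M + 1) * Real.exp B))) ^ d with hC
  have hCpos : 0 < C := by
    refine mul_pos ?_ (pow_pos (Real.exp_pos _) _)
    have h0 := hU 0
    have h1 : 0 ≤ U 1 * Real.exp (-vbar v) := mul_nonneg (hU 1) (Real.exp_nonneg _)
    rcases hU01 with h | h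
    · linarith
    · have : 0 < U 1 * Real.exp (-vbar v) := by positivity
      linarith
  obtain ⟨c, hc, hlower⟩ : ∃ c : ℝ, 0 < c ∧ ∀ (L : ℕ) [NeZero L], Even L → ∀ K, 2 ≤ K →
      c ^ Fintype.card (Torus d L) ≤
        stateSum (torusGraph d L) N K (periodised v L) lam fun _ => U := by
    rcases hU01 with h | h
    · exact ⟨U 0, h, fun L _ _ K _ => pow_le_stateSum_of_zero hlam.le hU⟩
    · refine ⟨min 1 (lam ^ 2 / 2) ^ d * (U 1 * Real.exp (-∑' x, |v x|)), by positivity, ?_⟩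
      intro L _ hL K hK
      obtain ⟨mate, hm1, hm2⟩ := exists_mate hL (⟨0, hd⟩ : Fin d)
      exact pow_le_stateSum_of_mate hlam.le hU hN hK
        (card_edgeSet_torusGraph_le (two_le_of_even hL)) (interaction_one_le hv_tempered.2)
        mate hm1 hm2
  refine ⟨C / c, div_pos hCpos hc, fun L _ hL => ?_⟩
  have hL2 := two_le_of_even hL
  have hupper : ∀ K, stateSum (torusGraph d L) N K (periodised v L) lam
      (fun _ n => U n * Real.exp (B * n)) ≤ C ^ Fintype.card (Torus d L) := fun K =>
    stateSum_le hU hM hlam.le hB hgood (vbar_mul_le_interaction hv_tempered)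
      (card_edgeSet_torusGraph_le hL2)
  have hsum : Summable fun w : closedConfigs (torusGraph d L) N =>
      w.1.weight U (periodised v L) lam := by
    refine summable_of_sum_le (c := C ^ Fintype.card (Torus d L))
      (fun w => Config.weight_nonneg hU _ hlam.le w.1) fun T => ?_
    obtain ⟨K, -, hK⟩ := exists_sum_weightWith_le (u := fun _ => U) (fun _ => hU)
      (periodised v L) hlam.le T
    refine hK.trans (le_trans (stateSum_mono hlam.le (fun _ => hU) fun x n => ?_) (hupper K))
    exact le_mul_of_one_le_right (hU n) (Real.one_le_exp (by positivity))
  refine ⟨⟨hsum, ?_⟩, fun z T => ?_⟩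
  · exact ((pow_pos hc _).trans_le (hlower L hL 2 le_rfl)).trans_le
      (stateSum_le_partitionFunction hU hlam.le hsum)
  · refine sum_weight_mul_exp_le (torusGraph_preconnected hL2) hlam.le hB hc hU hupper
      (hlower L hL) hCpos (fun x y hxy => ?_) hsum z T
    obtain ⟨i, a, hi⟩ := exists_torusReflection hL hxy
    exact ⟨torusReflection hL i a, hi, isReflectionPositive_periodised hL hv_symm
      (hv_separable L (NeZero.pos L) hL i) a⟩

end TorusMoments

end RandomPath
end

noncomputable section

namespace RandomPath

section Surgery

variable {V : Type} {G : SimpleGraph V} {N : ℕ}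

/-- The relation of successive links defined by arbitrary pairings. -/
def FollowsOf {m : G.edgeSet → ℕ} (π : (z : V) → LinkAt m z → LinkAt m z) (l l' : Link m) : Prop :=
  ∃ (z : V) (h : z ∈ (l.1 : Sym2 V)), (π z ⟨l, h⟩).1 = l'

open scoped Classical in
/-- Remove the pairing of `a` at `x` and the pairing of `c` at `y`. -/
def cutPartner {m : G.edgeSet → ℕ} (π : (z : V) → LinkAt m z → LinkAt m z) {x y : V}
    (a : LinkAt m x) (c : LinkAt m y) (z : V) (l : LinkAt m z) : LinkAt m z :=
  if (z = x ∧ (l.1 = a.1 ∨ l.1 = (π x a).1)) ∨ (z = y ∧ (l.1 = c.1 ∨ l.1 = (π y c).1)) then l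
  else π z l

lemma card_endpoints (e : G.edgeSet) : Nat.card {z // z ∈ (e : Sym2 V)} = 2 := by
  obtain ⟨e, he⟩ := e
  induction e using Sym2.ind with
  | _ x y =>
    have hxy : G.Adj x y := he
    have : {z | z ∈ s(x, y)} = ({x, y} : Set V) := by ext z; simp
    change Nat.card ({z | z ∈ s(x, y)} : Set V) = 2
    rw [this, Nat.card_coe_set_eq, Set.ncard_pair hxy.ne]

variable [Fintype V]

namespace Config

/-- The data of a configuration. -/
def raw (w : Config G N) : Σ m : G.edgeSet → ℕ, ((e : G.edgeSet) → Fin (m e) → Fin N) ×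
    ((z : V) → LinkAt m z → LinkAt m z) × (V → Fin 3) :=
  ⟨w.links, w.colour, w.partner, w.ghost⟩

lemma raw_injective : Function.Injective (raw : Config G N → _) := by
  rintro ⟨m, _, c, p, _, _, g⟩ ⟨m', _, c', p', _, _, g'⟩ h
  simp only [raw, Sigma.mk.injEq] at h
  obtain ⟨rfl, h⟩ := h
  simp only [heq_eq_eq, Prod.mk.injEq] at h
  obtain ⟨rfl, rfl, rfl⟩ := h
  rfl

lemma colour_eq_of_eqvGen (w : Config G N) {l l' : Link w.links}
    (h : Relation.EqvGen w.Follows l l') : w.colour l.1 l.2 = w.colour l'.1 l'.2 := by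
  induction h with
  | rel l l' h =>
    obtain ⟨z, hz, rfl⟩ := h
    exact (w.colour_partner z ⟨l, hz⟩).symm
  | refl => rfl
  | symm _ _ _ ih => exact ih.symm
  | trans _ _ _ _ _ ih ih' => exact ih.trans ih'

instance (m : G.edgeSet → ℕ) : Finite (Link m) := by
  classical
  infer_instance

/-- A path which starts at `x` ends at `y`, if these are the only endpoints of its colour. -/
lemma eqvGen_of_unpaired (w : Config G N) {x y : V} {i : Fin N}
    (hx : w.unpairedColour x i = 1) (hy : w.unpairedColour y i = 1)
    (hother : ∀ z, z ≠ x → z ≠ y → w.unpairedColour z i = 0)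
    {l : LinkAt w.links x} (hl : w.partner x l = l) (hli : w.colour l.1.1 l.1.2 = i)
    {l' : LinkAt w.links y} (hl' : w.partner y l' = l') (hli' : w.colour l'.1.1 l'.1.2 = i) :
    Relation.EqvGen w.Follows l.1 l'.1 := by
  classical
  by_contra hcon
  let S : Link w.links → Prop := fun k => Relation.EqvGen w.Follows l.1 k
  let H := Σ z : V, {k : LinkAt w.links z // S k.1}
  let f : H → H := fun h => ⟨h.1, w.partner h.1 h.2.1,
    h.2.2.trans _ _ _ (Relation.EqvGen.rel _ _ ⟨h.1, h.2.1.2, rfl⟩)⟩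
  have hf : Function.Involutive f := by
    rintro ⟨z, k, hk⟩
    simp only [f, w.partner_involutive z k]
  have hH : Even (Nat.card H) := by
    let e : H ≃ Σ k : {k : Link w.links // S k}, {z // z ∈ (k.1.1 : Sym2 V)} :=
      { toFun := fun h => ⟨⟨h.2.1.1, h.2.2⟩, ⟨h.1, h.2.1.2⟩⟩
        invFun := fun p => ⟨p.2.1, ⟨p.1.1, p.2.2⟩, p.1.2⟩
        left_inv := fun _ => rfl
        right_inv := fun _ => rfl }
    have := Fintype.ofFinite {k : Link w.links // S k}
    rw [Nat.card_congr e, Nat.card_sigma]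
    simp only [card_endpoints, Finset.sum_const, smul_eq_mul]
    exact even_two.mul_left _
  have hmod := card_modEq_card_fixed hf
  have hone : Nat.card {h : H // f h = h} = 1 := by
    have hfix : ∀ h : H, f h = h → w.partner h.1 h.2.1 = h.2.1 ∧
        w.colour h.2.1.1.1 h.2.1.1.2 = i := by
      rintro ⟨z, k, hk⟩ h
      refine ⟨?_, by rw [← w.colour_eq_of_eqvGen hk, hli]⟩
      exact congrArg Subtype.val (eq_of_heq (Sigma.mk.inj h).2)
    refine Nat.card_eq_one_iff_exists.mpr
      ⟨⟨⟨x, l, Relation.EqvGen.refl _⟩, by simp only [f, hl]⟩, ?_⟩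
    rintro ⟨⟨z, k, hk⟩, h⟩
    obtain ⟨h1, h2⟩ := hfix _ h
    apply Subtype.ext
    by_cases hzx : z = x
    · subst hzx
      obtain ⟨p, hp⟩ := Nat.card_eq_one_iff_exists.mp hx
      have e1 := hp ⟨k, h1, h2⟩
      have e2 := hp ⟨l, hl, hli⟩
      have e3 : k = l := congrArg Subtype.val (e1.trans e2.symm)
      subst e3
      rfl
    · by_cases hzy : z = y
      · subst hzy
        obtain ⟨p, hp⟩ := Nat.card_eq_one_iff_exists.mp hy
        have e1 := hp ⟨k, h1, h2⟩
        have e2 := hp ⟨l', hl', hli'⟩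
        have e3 : k = l' := congrArg Subtype.val (e1.trans e2.symm)
        subst e3
        exact absurd hk hcon
      · have h0 := hother z hzx hzy
        rw [Config.unpairedColour, Finite.card_eq_zero_iff] at h0
        exact h0.elim ⟨k, h1, h2⟩
  rw [hone] at hmod
  have := Nat.even_iff.mp hH
  unfold Nat.ModEq at hmod
  omega

end Config

/-- The endpoints of the two open paths at `z`. -/
lemma exists_unpaired (hN : 2 ≤ N) {w : Config G N} {z : V}
    (h : ∀ i : Fin N, w.unpairedColour z i = if (i : ℕ) < 2 then 1 else 0) :
    ∃ a b : LinkAt w.links z, w.partner z a = a ∧ w.partner z b = b ∧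
      w.colour a.1.1 a.1.2 = ⟨0, by omega⟩ ∧ w.colour b.1.1 b.1.2 = ⟨1, by omega⟩ ∧
      ∀ l, w.partner z l = l → l = a ∨ l = b := by
  have h0 := h ⟨0, by omega⟩
  have h1 := h ⟨1, by omega⟩
  simp only [zero_lt_two, one_lt_two, if_true] at h0 h1
  obtain ⟨⟨a, ha, ha'⟩, hau⟩ := Nat.card_eq_one_iff_exists.mp h0
  obtain ⟨⟨b, hb, hb'⟩, hbu⟩ := Nat.card_eq_one_iff_exists.mp h1
  refine ⟨a, b, ha, hb, ha', hb', fun l hl => ?_⟩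
  have hi := h (w.colour l.1.1 l.1.2)
  split_ifs at hi with hlt
  · have hcase : w.colour l.1.1 l.1.2 = ⟨0, by omega⟩ ∨ w.colour l.1.1 l.1.2 = ⟨1, by omega⟩ := by
      rcases Nat.lt_or_ge (w.colour l.1.1 l.1.2 : ℕ) 1 with h' | h'
      · exact Or.inl (Fin.ext (by simpa using h'))
      · exact Or.inr (Fin.ext (by simp only; omega))
    rcases hcase with hc | hc
    · exact Or.inl (congrArg Subtype.val (hau ⟨l, hl, hc⟩))
    · exact Or.inr (congrArg Subtype.val (hbu ⟨l, hl, hc⟩))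
  · rw [Config.unpairedColour, Finite.card_eq_zero_iff] at hi
    exact (hi.elim ⟨l, hl, rfl⟩)

/-- An involution with exactly two fixed points extends to one without fixed points. -/
lemma exists_involutive_of_two_fixed {X : Type*} {π : X → X} (hπ : Function.Involutive π)
    {a b : X} (hab : a ≠ b) (ha : π a = a) (hb : π b = b) (hfix : ∀ l, π l = l → l = a ∨ l = b) :
    ∃ π' : X → X, Function.Involutive π' ∧ (∀ l, π' l ≠ l) ∧ (∀ l, π l ≠ l → π' l = π l) ∧
      π' a = b ∧ π' b = a := by
  classical
  have hne : ∀ l, π l ≠ l → l ≠ a ∧ l ≠ b := fun l hl =>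
    ⟨fun h => hl (by rw [h, ha]), fun h => hl (by rw [h, hb])⟩
  have h1 : ∀ l, π l ≠ l → π (Equiv.swap a b l) = π l := fun l hl => by
    rw [Equiv.swap_apply_of_ne_of_ne (hne l hl).1 (hne l hl).2]
  have h2 : π (Equiv.swap a b a) = b := by rw [Equiv.swap_apply_left, hb]
  have h3 : π (Equiv.swap a b b) = a := by rw [Equiv.swap_apply_right, ha]
  refine ⟨fun l => π (Equiv.swap a b l), fun l => ?_, fun l => ?_, h1, h2, h3⟩
  · by_cases hl : π l = l
    · rcases hfix l hl with rfl | rfl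
      · simp only [h2, h3]
      · simp only [h2, h3]
    · have : π (π l) ≠ π l := fun h => hl (hπ.injective h)
      simp only [h1 l hl, h1 _ this, hπ l]
  · by_cases hl : π l = l
    · rcases hfix l hl with rfl | rfl
      · simp only [h2]; exact hab.symm
      · simp only [h3]; exact hab
    · simp only [h1 l hl]; exact hl

lemma card_of_two_fixed {X : Type*} [Finite X] {π : X → X} {a b : X} (hab : a ≠ b) (ha : π a = a)
    (hb : π b = b) (hfix : ∀ l, π l = l → l = a ∨ l = b) :
    Nat.card X = Nat.card {l // π l ≠ l} + 2 := by
  have h : {l | π l ≠ l} = ({a, b} : Set X)ᶜ := by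
    ext l
    simp only [Set.mem_ofPred_eq, Set.mem_compl_iff, Set.mem_insert_iff, Set.mem_singleton_iff]
    refine not_congr ⟨hfix l, ?_⟩
    rintro (rfl | rfl) <;> assumption
  have h2 := Set.ncard_add_ncard_compl ({a, b} : Set X)
  rw [← h, Set.ncard_pair hab, add_comm] at h2
  exact h2.symm

/-- A configuration of closed paths with a marked link at `x` and a marked link at `y`. -/
abbrev MarkedConfig (G : SimpleGraph V) (N : ℕ) (x y : V) : Type :=
  Σ w : closedConfigs G N, LinkAt w.1.links x × LinkAt w.1.links y

open scoped Classical in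
/-- Open a closed path at the marked links, and recolour one of the two resulting paths. -/
def MarkedConfig.cut {x y : V} (hN : 2 ≤ N) (t : MarkedConfig G N x y) :
    Σ m : G.edgeSet → ℕ, ((e : G.edgeSet) → Fin (m e) → Fin N) ×
      ((z : V) → LinkAt m z → LinkAt m z) × (V → Fin 3) :=
  ⟨t.1.1.links,
    fun e p => if Relation.EqvGen (FollowsOf (cutPartner t.1.1.partner t.2.1 t.2.2))
      (t.1.1.partner x t.2.1).1 ⟨e, p⟩ then ⟨1, by omega⟩ else t.1.1.colour e p,
    cutPartner t.1.1.partner t.2.1 t.2.2,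
    fun z => if z = x ∨ z = y then 2 else 0⟩

open scoped Classical in
/-- The two open paths between `x` and `y` are merged into a closed path. -/
theorem exists_marked (hN : 2 ≤ N) {x y : V} (hxy : x ≠ y) {w : Config G N}
    (hw : w ∈ twoPathConfigs G N x y) : ∃ t : MarkedConfig G N x y,
      t.cut hN = w.raw ∧ 1 ≤ t.1.1.numCycles x y ∧ t.1.1.links = w.links ∧
      (∀ z, w.numPairings z = t.1.1.numPairings z + if z = x ∨ z = y then 1 else 0) ∧
      ∀ z, z = x ∨ z = y → 1 ≤ t.1.1.numPairings z := by
  obtain ⟨hw1, hw2⟩ := hw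
  set c0 : Fin N := ⟨0, by omega⟩ with hc0
  set c1 : Fin N := ⟨1, by omega⟩ with hc1
  have hc01 : c0 ≠ c1 := by simp [hc0, hc1]
  have hoff0 : ∀ z, z ≠ x → z ≠ y → ∀ i, w.unpairedColour z i = 0 := fun z hzx hzy i => by
    have := (hw1 z hzx hzy).1
    rw [Config.unpaired, Finset.sum_eq_zero_iff] at this
    exact this i (Finset.mem_univ i)
  have hoff : ∀ z, z ≠ x → z ≠ y → ∀ l, w.partner z l ≠ l := fun z hzx hzy l hl => by
    have := hoff0 z hzx hzy (w.colour l.1.1 l.1.2)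
    rw [Config.unpairedColour, Finite.card_eq_zero_iff] at this
    exact this.elim ⟨l, hl, rfl⟩
  have hcol : ∀ z, z = x ∨ z = y → w.unpairedColour z c0 = 1 ∧ w.unpairedColour z c1 = 1 :=
    fun z hz => by
      constructor
      · rw [(hw2 z hz).1]; simp [hc0]
      · rw [(hw2 z hz).1]; simp [hc1]
  obtain ⟨ax, bx, hax, hbx, cax, cbx, fx⟩ := exists_unpaired hN (hw2 x (Or.inl rfl)).1
  obtain ⟨ay, bY, hay, hby, cay, cby, fy⟩ := exists_unpaired hN (hw2 y (Or.inr rfl)).1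
  have habx : ax ≠ bx := fun h => hc01 (cax.symm.trans
    ((congrArg (fun l : LinkAt w.links x => w.colour l.1.1 l.1.2) h).trans cbx))
  have haby : ay ≠ bY := fun h => hc01 (cay.symm.trans
    ((congrArg (fun l : LinkAt w.links y => w.colour l.1.1 l.1.2) h).trans cby))
  have hA : Relation.EqvGen w.Follows ax.1 ay.1 := w.eqvGen_of_unpaired (hcol x (Or.inl rfl)).1
    (hcol y (Or.inr rfl)).1 (fun z h h' => hoff0 z h h' _) hax cax hay cay
  have hB : Relation.EqvGen w.Follows bx.1 bY.1 := w.eqvGen_of_unpaired (hcol x (Or.inl rfl)).2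
    (hcol y (Or.inr rfl)).2 (fun z h h' => hoff0 z h h' _) hbx cbx hby cby
  have hπ : ∀ z, ∃ π' : LinkAt w.links z → LinkAt w.links z, Function.Involutive π' ∧
      (∀ l, π' l ≠ l) ∧ (∀ l, w.partner z l ≠ l → π' l = w.partner z l) ∧
      ∀ l, w.partner z l = l → w.partner z (π' l) = π' l := fun z => by
    by_cases hzx : z = x
    · subst hzx
      obtain ⟨π', h1, h2, h3, h4, h5⟩ :=
        exists_involutive_of_two_fixed (w.partner_involutive z) habx hax hbx fx
      refine ⟨π', h1, h2, h3, fun l hl => ?_⟩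
      rcases fx l hl with rfl | rfl
      · rw [h4, hbx]
      · rw [h5, hax]
    · by_cases hzy : z = y
      · subst hzy
        obtain ⟨π', h1, h2, h3, h4, h5⟩ :=
          exists_involutive_of_two_fixed (w.partner_involutive z) haby hay hby fy
        refine ⟨π', h1, h2, h3, fun l hl => ?_⟩
        rcases fy l hl with rfl | rfl
        · rw [h4, hby]
        · rw [h5, hay]
      · exact ⟨w.partner z, w.partner_involutive z, hoff z hzx hzy, fun _ _ => rfl,
          fun l hl => absurd hl (hoff z hzx hzy l)⟩
  choose π' hinv hnofix hsame hfree using hπ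
  have hπx : π' x ax = bx := by
    rcases fx _ (hfree x ax hax) with h | h
    · exact absurd h (hnofix x ax)
    · exact h
  have hπy : π' y ay = bY := by
    rcases fy _ (hfree y ay hay) with h | h
    · exact absurd h (hnofix y ay)
    · exact h
  let col : (e : G.edgeSet) → Fin (w.links e) → Fin N := fun e p =>
    if Relation.EqvGen w.Follows bx.1 ⟨e, p⟩ then c0 else w.colour e p
  have hcolfree : ∀ z (l : LinkAt w.links z), w.partner z l = l → col l.1.1 l.1.2 = c0 := by
    intro z l hl
    simp only [col]
    split_ifs with h
    · rfl
    · by_cases hzx : z = x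
      · subst hzx
        rcases fx l hl with rfl | rfl
        · exact cax
        · exact absurd (Relation.EqvGen.refl _) h
      · by_cases hzy : z = y
        · subst hzy
          rcases fy l hl with rfl | rfl
          · exact cay
          · exact absurd hB h
        · exact absurd hl (hoff z hzx hzy l)
  let w' : Config G N :=
    { links := w.links
      even_links := w.even_links
      colour := col
      partner := π'
      partner_involutive := hinv
      colour_partner := fun z l => by
        by_cases hl : w.partner z l = l
        · rw [hcolfree z _ (hfree z l hl), hcolfree z l hl]
        · rw [hsame z l hl]
          have hF : Relation.EqvGen w.Follows l.1 (w.partner z l).1 :=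
            Relation.EqvGen.rel _ _ ⟨z, l.2, rfl⟩
          have hiff : Relation.EqvGen w.Follows bx.1 (w.partner z l).1 ↔
              Relation.EqvGen w.Follows bx.1 l.1 :=
            ⟨fun h => h.trans _ _ _ (hF.symm _ _), fun h => h.trans _ _ _ hF⟩
          simp only [col]
          by_cases h : Relation.EqvGen w.Follows bx.1 l.1
          · rw [if_pos h, if_pos (hiff.mpr h)]
          · rw [if_neg h, if_neg (fun h' => h (hiff.mp h')), w.colour_partner]
      ghost := fun _ => 0 }
  have hw' : w' ∈ closedConfigs G N :=
    Config.mem_closedConfigs.mpr fun z => ⟨hnofix z, rfl⟩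
  have hcut : cutPartner π' ax ay = w.partner := by
    funext z l
    unfold cutPartner
    rw [hπx, hπy]
    split_ifs with h
    · symm
      rcases h with ⟨rfl, h | h⟩ | ⟨rfl, h | h⟩
      · rw [show l = ax from Subtype.ext h, hax]
      · rw [show l = bx from Subtype.ext h, hbx]
      · rw [show l = ay from Subtype.ext h, hay]
      · rw [show l = bY from Subtype.ext h, hby]
    · refine hsame z l fun hl => h ?_
      by_cases hzx : z = x
      · subst hzx
        rcases fx l hl with rfl | rfl
        · exact Or.inl ⟨rfl, Or.inl rfl⟩
        · exact Or.inl ⟨rfl, Or.inr rfl⟩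
      · by_cases hzy : z = y
        · subst hzy
          rcases fy l hl with rfl | rfl
          · exact Or.inr ⟨rfl, Or.inl rfl⟩
          · exact Or.inr ⟨rfl, Or.inr rfl⟩
        · exact absurd hl (hoff z hzx hzy l)
  refine ⟨⟨⟨w', hw'⟩, ax, ay⟩, ?_, ?_, rfl, ?_, ?_⟩
  · have hghost : (fun z => if z = x ∨ z = y then 2 else 0) = w.ghost := by
      funext z
      split_ifs with h
      · exact (hw2 z h).2.symm
      · push Not at h
        exact (hw1 z h.1 h.2).2.symm
    have hcolour : (fun e p => if Relation.EqvGen (FollowsOf w.partner) bx.1 ⟨e, p⟩ then c1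
        else col e p) = w.colour := by
      funext e p
      split_ifs with h
      · exact cbx.symm.trans (w.colour_eq_of_eqvGen h)
      · exact if_neg h
    change (⟨w.links, fun e p => if Relation.EqvGen (FollowsOf (cutPartner π' ax ay))
      (π' x ax).1 ⟨e, p⟩ then c1 else col e p, cutPartner π' ax ay,
      fun z => if z = x ∨ z = y then 2 else 0⟩ : Σ m : G.edgeSet → ℕ,
        ((e : G.edgeSet) → Fin (m e) → Fin N) ×
        ((z : V) → LinkAt m z → LinkAt m z) × (V → Fin 3)) = w.raw
    rw [hcut, hπx, hghost, hcolour]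
    rfl
  · have hmono : ∀ l l', Relation.EqvGen w.Follows l l' → Relation.EqvGen w'.Follows l l' := by
      intro l l' h
      induction h with
      | rel l l' h =>
        obtain ⟨z, hz, rfl⟩ := h
        by_cases hl : w.partner z ⟨l, hz⟩ = ⟨l, hz⟩
        · rw [hl]; exact Relation.EqvGen.refl _
        · exact Relation.EqvGen.rel _ _ ⟨z, hz, congrArg Subtype.val (hsame z _ hl)⟩
      | refl => exact Relation.EqvGen.refl _
      | symm _ _ _ ih => exact ih.symm
      | trans _ _ _ _ _ ih ih' => exact ih.trans _ _ _ ih'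
    have : Finite w'.Cycle := Quotient.finite _
    have : Nonempty {χ : w'.Cycle // w'.Visits χ x ∧ w'.Visits χ y} :=
      ⟨⟨Quotient.mk (Relation.EqvGen.setoid w'.Follows) ax.1, ⟨ax.1, rfl, ax.2⟩,
        ⟨ay.1, Quotient.sound ((hmono _ _ hA).symm _ _), ay.2⟩⟩⟩
    exact Nat.card_pos
  all_goals
    have hpos : ∀ z, z = x ∨ z = y → Nat.card (LinkAt w.links z) =
        Nat.card {l : LinkAt w.links z // w.partner z l ≠ l} + 2 := by
      rintro z (rfl | rfl)
      · exact card_of_two_fixed habx hax hbx fx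
      · exact card_of_two_fixed haby hay hby fy
    intro z
    rw [Config.numPairings_of_mem hw']
  · rw [Config.numPairings]
    change _ = Nat.card (LinkAt w.links z) / 2 + _
    split_ifs with h
    · rw [hpos z h, (hw2 z h).2]
      simp only [Fin.val_two]
      omega
    · push Not at h
      rw [(hw1 z h.1 h.2).2]
      congr 2
      exact Nat.card_congr (Equiv.subtypeUnivEquiv (hoff z h.1 h.2))
  · intro hz
    change 1 ≤ Nat.card (LinkAt w.links z) / 2
    have := hpos z hz
    omega

lemma card_linkAt_eq {w : Config G N} (hw : w ∈ closedConfigs G N) (z : V) :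
    Nat.card (LinkAt w.links z) = 2 * w.numPairings z := by
  have h := even_card_of_involutive (w.partner_involutive z)
    (Config.mem_closedConfigs.mp hw z).1
  rw [Config.numPairings_of_mem hw]
  obtain ⟨k, hk⟩ := h
  omega

open scoped Classical in
/-- The weight of the configurations with two open paths is bounded by a sum over configurations
of closed paths, with a multiplicity due to the choice of the links at `x` and `y`. -/
theorem sum_twoPath_le (hN : 2 ≤ N) {x y : V} (hxy : x ≠ y) (f g : Config G N → ℝ)
    (hg : ∀ w, 0 ≤ g w)
    (hfg : ∀ w w' : Config G N, w'.links = w.links →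
      (∀ z, w.numPairings z = w'.numPairings z + if z = x ∨ z = y then 1 else 0) →
      1 ≤ w'.numPairings x → 1 ≤ w'.numPairings y → f w ≤ g w')
    (T : Finset (twoPathConfigs G N x y)) :
    ∃ T' : Finset (closedConfigs G N), (∀ w ∈ T', 1 ≤ w.1.numCycles x y) ∧
      ∑ w ∈ T, f w.1 ≤
        ∑ w ∈ T', 4 * (w.1.numPairings x : ℝ) * (w.1.numPairings y : ℝ) * g w.1 := by
  choose Φ hΦ hcyc hlinks hnum hpos using
    fun w : twoPathConfigs G N x y => exists_marked hN hxy w.2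
  have hinj : Function.Injective Φ := fun w₁ w₂ h => Subtype.ext (Config.raw_injective (by
    rw [← hΦ, ← hΦ, h]))
  refine ⟨T.image fun w => (Φ w).1, fun w hw => ?_, ?_⟩
  · obtain ⟨w₀, -, rfl⟩ := Finset.mem_image.mp hw
    exact hcyc w₀
  · have h1 : ∑ w ∈ T, f w.1 ≤ ∑ w ∈ T, g (Φ w).1.1 := Finset.sum_le_sum fun w _ =>
      hfg _ _ (hlinks w) (hnum w) (hpos w x (Or.inl rfl)) (hpos w y (Or.inr rfl))
    refine h1.trans ?_
    rw [← Finset.sum_fiberwise_of_maps_to (g := fun w => (Φ w).1)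
      fun w hw => Finset.mem_image_of_mem (fun w => (Φ w).1) hw]
    refine Finset.sum_le_sum fun w' _ => ?_
    have h2 : ∑ w ∈ T with (Φ w).1 = w', g (Φ w).1.1 =
        ((T.filter fun w => (Φ w).1 = w').card : ℝ) * g w'.1 := by
      rw [← nsmul_eq_mul, ← Finset.sum_const]
      exact Finset.sum_congr rfl fun w hw => by rw [(Finset.mem_filter.mp hw).2]
    rw [h2]
    refine mul_le_mul_of_nonneg_right ?_ (hg _)
    have h3 : (T.filter fun w => (Φ w).1 = w').card ≤
        Nat.card (LinkAt w'.1.links x × LinkAt w'.1.links y) := by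
      let F : (T.filter fun w => (Φ w).1 = w') → LinkAt w'.1.links x × LinkAt w'.1.links y :=
        fun w => (Finset.mem_filter.mp w.2).2 ▸ (Φ w.1).2
      have hF : ∀ w, (⟨w', F w⟩ : MarkedConfig G N x y) = Φ w.1 := by
        rintro ⟨w, hw⟩
        obtain ⟨-, rfl⟩ := Finset.mem_filter.mp hw
        rfl
      rw [← Fintype.card_coe, ← Nat.card_eq_fintype_card]
      refine Nat.card_le_card_of_injective F fun w₁ w₂ h => ?_
      apply Subtype.ext
      apply hinj
      rw [← hF, ← hF, h]
    rw [Nat.card_prod, card_linkAt_eq w'.2, card_linkAt_eq w'.2] at h3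
    have h4 : ((T.filter fun w => (Φ w).1 = w').card : ℝ) ≤
        ((2 * w'.1.numPairings x * (2 * w'.1.numPairings y) : ℕ) : ℝ) := by exact_mod_cast h3
    refine h4.trans_eq ?_
    push_cast; ring

lemma numCycles_le {w : Config G N} (hw : w ∈ closedConfigs G N) (x y : V) :
    w.numCycles x y ≤ 2 * w.numPairings x := by
  classical
  rw [← card_linkAt_eq hw]
  have : Finite w.Cycle := Quotient.finite _
  let F : {χ : w.Cycle // w.Visits χ x ∧ w.Visits χ y} → LinkAt w.links x := fun χ =>
    ⟨χ.2.1.choose, χ.2.1.choose_spec.2⟩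
  refine Nat.card_le_card_of_injective F fun χ₁ χ₂ h => Subtype.ext ?_
  have h' : χ₁.2.1.choose = χ₂.2.1.choose := congrArg Subtype.val h
  rw [← χ₁.2.1.choose_spec.1, ← χ₂.2.1.choose_spec.1, h']

end Surgery

end RandomPath
end

noncomputable section

namespace RandomPath

section TwoPoint

variable {V : Type} [Fintype V] {G : SimpleGraph V} {N : ℕ}

open scoped Classical in
/-- Adding a pairing at `x` and at `y` lowers the energy by at most a linear function of the
numbers of pairings. -/
lemma interaction_add_le {v : V → V → ℝ} {S : ℝ} (hsymm : ∀ a b, v a b = v b a)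
    (hS : ∀ a, ∑ b, |v a b| ≤ S) {x y : V} (hxy : x ≠ y) {n n' : V → ℕ}
    (hn : ∀ z, n z = n' z + if z = x ∨ z = y then 1 else 0) :
    -interaction v n ≤ -interaction v n' +
      (∑ z, (2 * |v x z| + 2 * |v y z|) * (n' z : ℝ) + 2 * S) := by
  set e : V → ℝ := fun z => if z = x ∨ z = y then 1 else 0 with he
  have hn' : ∀ z, (n z : ℝ) = n' z + e z := fun z => by
    rw [hn, he]; push_cast; rfl
  have hesum : ∀ f : V → ℝ, ∑ z, e z * f z = f x + f y := fun f => by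
    have h0 : ∀ z, e z * f z = if z = x ∨ z = y then f z else 0 := fun z => by
      simp only [he]; split_ifs <;> simp
    simp only [h0]
    rw [← Finset.sum_filter]
    have : (Finset.univ.filter fun z => z = x ∨ z = y) = {x, y} := by ext z; simp
    rw [this, Finset.sum_pair hxy]
  have he0 : ∀ z, 0 ≤ e z := fun z => by simp only [he]; split_ifs <;> norm_num
  have he1 : ∀ z, e z ≤ 1 := fun z => by simp only [he]; split_ifs <;> norm_num
  have h1 : interaction v n = interaction v n' +
      2 * ∑ a, e a * ∑ b, v a b * (n' b : ℝ) + ∑ a, e a * ∑ b, v a b * e b := by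
    have hsw : ∑ a, ∑ b, v a b * (n' a : ℝ) * e b = ∑ a, ∑ b, v a b * e a * (n' b : ℝ) := by
      rw [Finset.sum_comm]
      exact Finset.sum_congr rfl fun a _ => Finset.sum_congr rfl fun b _ => by
        rw [hsymm]; ring
    have hexp : interaction v n = interaction v n' +
        ∑ a, ∑ b, v a b * (n' a : ℝ) * e b + ∑ a, ∑ b, v a b * e a * (n' b : ℝ) +
        ∑ a, ∑ b, v a b * e a * e b := by
      simp only [interaction, hn', ← Finset.sum_add_distrib]
      exact Finset.sum_congr rfl fun a _ => Finset.sum_congr rfl fun b _ => by ring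
    rw [hexp, hsw]
    have e1 : ∑ a, ∑ b, v a b * e a * (n' b : ℝ) = ∑ a, e a * ∑ b, v a b * (n' b : ℝ) := by
      simp only [Finset.mul_sum]
      exact Finset.sum_congr rfl fun a _ => Finset.sum_congr rfl fun b _ => by ring
    have e2 : ∑ a, ∑ b, v a b * e a * e b = ∑ a, e a * ∑ b, v a b * e b := by
      simp only [Finset.mul_sum]
      exact Finset.sum_congr rfl fun a _ => Finset.sum_congr rfl fun b _ => by ring
    rw [e1, e2]; ring
  rw [hesum, hesum] at h1
  have h2 : ∀ a, -∑ b, v a b * (n' b : ℝ) ≤ ∑ b, |v a b| * (n' b : ℝ) := fun a => by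
    rw [← Finset.sum_neg_distrib]
    refine Finset.sum_le_sum fun b _ => ?_
    rw [← neg_mul]
    exact mul_le_mul_of_nonneg_right (neg_le_abs _) (Nat.cast_nonneg _)
  have h3 : ∀ a, -∑ b, v a b * e b ≤ S := fun a => by
    refine le_trans ?_ (hS a)
    rw [← Finset.sum_neg_distrib]
    refine Finset.sum_le_sum fun b _ => ?_
    have := neg_le_abs (v a b)
    have h4 := abs_nonneg (v a b)
    nlinarith [he0 b, he1 b]
  have h5 : ∑ z, (2 * |v x z| + 2 * |v y z|) * (n' z : ℝ) =
      2 * ∑ b, |v x b| * (n' b : ℝ) + 2 * ∑ b, |v y b| * (n' b : ℝ) := by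
    simp only [Finset.mul_sum, ← Finset.sum_add_distrib]
    exact Finset.sum_congr rfl fun b _ => by ring
  rw [h1, h5]
  linarith [h2 x, h2 y, h3 x, h3 y]

open scoped Classical in
lemma prod_good_le {U : ℕ → ℝ} {vb M : ℝ} (hU : ∀ n, 0 ≤ U n)
    (hgood : ∀ n : ℕ, (n : ℝ) * (U (n + 1) * Real.exp (-vb * ((n + 1 : ℕ) : ℝ) ^ 2)) ≤
      M * (U n * Real.exp (-vb * (n : ℝ) ^ 2))) {x y : V} (hxy : x ≠ y) {n n' : V → ℕ}
    (hn : ∀ z, n z = n' z + if z = x ∨ z = y then 1 else 0) :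
    (n' x : ℝ) * (n' y : ℝ) * ∏ z, U (n z) ≤
      (M * Real.exp (vb * (2 * n' x + 1))) * (M * Real.exp (vb * (2 * n' y + 1))) *
        ∏ z, U (n' z) := by
  have hpair : ∀ f : V → ℝ, f x * f y = ∏ z, if z = x ∨ z = y then f z else 1 := fun f => by
    rw [← Finset.prod_filter]
    have : (Finset.univ.filter fun z => z = x ∨ z = y) = {x, y} := by ext z; simp
    rw [this, Finset.prod_pair hxy]
  rw [hpair fun z => (n' z : ℝ), hpair fun z => M * Real.exp (vb * (2 * n' z + 1)),
    ← Finset.prod_mul_distrib, ← Finset.prod_mul_distrib]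
  refine Finset.prod_le_prod (fun z _ => ?_) fun z _ => ?_
  · refine mul_nonneg ?_ (hU _)
    split_ifs
    exacts [Nat.cast_nonneg _, zero_le_one]
  · rw [hn]
    split_ifs with h
    · have h1 := hgood (n' z)
      have e : Real.exp (-vb * (n' z : ℝ) ^ 2) =
          Real.exp (-vb * ((n' z + 1 : ℕ) : ℝ) ^ 2) * Real.exp (vb * (2 * n' z + 1)) := by
        rw [← Real.exp_add]; congr 1; push_cast; ring
      rw [e] at h1
      have hp := Real.exp_pos (-vb * ((n' z + 1 : ℕ) : ℝ) ^ 2)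
      refine le_of_mul_le_mul_right ?_ hp
      calc _ = (n' z : ℝ) * (U (n' z + 1) * Real.exp (-vb * ((n' z + 1 : ℕ) : ℝ) ^ 2)) := by ring
        _ ≤ _ := h1
        _ = _ := by ring
    · simp

open scoped Classical in
/-- Comparison of the weights before and after merging two open paths. -/
lemma weight_le_of_merge {U : ℕ → ℝ} {vb M lam S : ℝ} {v : V → V → ℝ} (hU : ∀ n, 0 ≤ U n)
    (hM : 0 ≤ M) (hlam : 0 ≤ lam)
    (hgood : ∀ n : ℕ, (n : ℝ) * (U (n + 1) * Real.exp (-vb * ((n + 1 : ℕ) : ℝ) ^ 2)) ≤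
      M * (U n * Real.exp (-vb * (n : ℝ) ^ 2)))
    (hsymm : ∀ a b, v a b = v b a) (hS : ∀ a, ∑ b, |v a b| ≤ S) {x y : V} (hxy : x ≠ y)
    {w w' : Config G N} (hlinks : w'.links = w.links)
    (hn : ∀ z, w.numPairings z = w'.numPairings z + if z = x ∨ z = y then 1 else 0) :
    (w'.numPairings x : ℝ) * (w'.numPairings y : ℝ) * w.weight U v lam ≤
      M ^ 2 * Real.exp (2 * vb + 2 * S) * (w'.weight U v lam *
        Real.exp (∑ z, ((if z = x then 2 * vb else 0) + (if z = y then 2 * vb else 0) +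
          2 * |v x z| + 2 * |v y z|) * (w'.numPairings z : ℝ))) := by
  set n' := w'.numPairings
  have h1 := prod_good_le hU hgood hxy hn
  have h2 := interaction_add_le hsymm hS hxy hn
  have hE : Real.exp (-w.energy v) ≤ Real.exp (-w'.energy v) *
      Real.exp (∑ z, (2 * |v x z| + 2 * |v y z|) * (n' z : ℝ) + 2 * S) := by
    rw [← Real.exp_add, Real.exp_le_exp]; exact h2
  have hL : 0 ≤ ∏ e : G.edgeSet, lam ^ w.links e / ((w.links e).factorial : ℝ) :=
    Finset.prod_nonneg fun e _ => by positivity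
  have hP : 0 ≤ ∏ z, U (n' z) := Finset.prod_nonneg fun z _ => hU _
  have hsum : ∑ z, ((if z = x then 2 * vb else 0) + (if z = y then 2 * vb else 0) +
      2 * |v x z| + 2 * |v y z|) * (n' z : ℝ) =
      2 * vb * n' x + 2 * vb * n' y + ∑ z, (2 * |v x z| + 2 * |v y z|) * (n' z : ℝ) := by
    have e : ∀ z, ((if z = x then 2 * vb else 0) + (if z = y then 2 * vb else 0) +
        2 * |v x z| + 2 * |v y z|) * (n' z : ℝ) =
        (if z = x then 2 * vb * (n' z : ℝ) else 0) + (if z = y then 2 * vb * (n' z : ℝ) else 0) +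
        (2 * |v x z| + 2 * |v y z|) * (n' z : ℝ) := fun z => by split_ifs <;> ring
    simp only [e, Finset.sum_add_distrib, Finset.sum_ite_eq', Finset.mem_univ, if_true]
  calc (n' x : ℝ) * (n' y : ℝ) * w.weight U v lam
      = (∏ e : G.edgeSet, lam ^ w.links e / ((w.links e).factorial : ℝ)) *
          ((n' x : ℝ) * (n' y : ℝ) * ∏ z, U (w.numPairings z)) * Real.exp (-w.energy v) := by
        rw [Config.weight]; ring
    _ ≤ (∏ e : G.edgeSet, lam ^ w.links e / ((w.links e).factorial : ℝ)) *
          ((M * Real.exp (vb * (2 * n' x + 1))) * (M * Real.exp (vb * (2 * n' y + 1))) *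
            ∏ z, U (n' z)) * (Real.exp (-w'.energy v) *
          Real.exp (∑ z, (2 * |v x z| + 2 * |v y z|) * (n' z : ℝ) + 2 * S)) := by
        gcongr
    _ = _ := by
        have hexp : Real.exp (vb * (2 * n' x + 1)) * Real.exp (vb * (2 * n' y + 1)) *
            Real.exp (∑ z, (2 * |v x z| + 2 * |v y z|) * (n' z : ℝ) + 2 * S) =
            Real.exp (2 * vb + 2 * S) * Real.exp (2 * vb * n' x + 2 * vb * n' y +
              ∑ z, (2 * |v x z| + 2 * |v y z|) * (n' z : ℝ)) := by
          rw [← Real.exp_add, ← Real.exp_add, ← Real.exp_add]; congr 1; ring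
        rw [hsum, Config.weight, hlinks]
        linear_combination (∏ e : G.edgeSet, lam ^ w.links e / ((w.links e).factorial : ℝ)) *
          M ^ 2 * (∏ z, U (n' z)) * Real.exp (-w'.energy v) * hexp

/-- Jensen's inequality for the exponential of a linear function with nonnegative coefficients. -/
lemma exists_exp_sum_le {a : V → ℝ} {A : ℝ} (hA : 0 < A) (ha : ∀ z, 0 ≤ a z)
    (hsum : ∑ z, a z ≤ A) (x : V) : ∃ p : V → ℝ, (∀ z, 0 ≤ p z) ∧ ∑ z, p z = 1 ∧
      ∀ t : V → ℝ, (∀ z, 0 ≤ t z) →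
        Real.exp (∑ z, a z * t z) ≤ ∑ z, p z * Real.exp (A * t z) := by
  classical
  let a' : V → ℝ := fun z => a z + if z = x then A - ∑ z, a z else 0
  have ha' : ∀ z, a z ≤ a' z := fun z => by
    simp only [a']; split_ifs <;> linarith
  have hsum' : ∑ z, a' z = A := by
    simp only [a', Finset.sum_add_distrib, Finset.sum_ite_eq', Finset.mem_univ, if_true]; ring
  have hp0 : ∀ z, 0 ≤ a' z / A := fun z => div_nonneg ((ha z).trans (ha' z)) hA.le
  have hp1 : ∑ z, a' z / A = 1 := by rw [← Finset.sum_div, hsum', div_self hA.ne']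
  refine ⟨fun z => a' z / A, hp0, hp1, fun t ht => ?_⟩
  have h := convexOn_exp.map_sum_le (t := Finset.univ) (w := fun z => a' z / A)
    (p := fun z => A * t z) (fun z _ => hp0 z) hp1 fun z _ => Set.mem_univ _
  simp only [smul_eq_mul] at h
  refine le_trans (Real.exp_le_exp.mpr (Finset.sum_le_sum fun z _ => ?_)) h
  rw [← mul_assoc, div_mul_cancel₀ _ hA.ne']
  exact mul_le_mul_of_nonneg_right (ha' z) (ht z)

/-- The two-point function is bounded in terms of the expected number of closed paths which visit
both points, given uniform exponential moments. -/
theorem mass_twoPath_sq_le {U : ℕ → ℝ} {vb M lam S A R : ℝ} {v : V → V → ℝ} (hN : 2 ≤ N)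
    (hU : ∀ n, 0 ≤ U n) (hM : 0 ≤ M) (hlam : 0 ≤ lam) (hvb : 0 ≤ vb)
    (hgood : ∀ n : ℕ, (n : ℝ) * (U (n + 1) * Real.exp (-vb * ((n + 1 : ℕ) : ℝ) ^ 2)) ≤
      M * (U n * Real.exp (-vb * (n : ℝ) ^ 2)))
    (hsymm : ∀ a b, v a b = v b a) (hS : ∀ a, ∑ b, |v a b| ≤ S) (hA : 1 ≤ A)
    (hAS : 4 * vb + 4 * S ≤ A)
    (hmom : ∀ (z : V) (T : Finset (closedConfigs G N)),
      ∑ w ∈ T, w.1.weight U v lam * Real.exp (2 * A * w.1.numPairings z) ≤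
        R * partitionFunction G N U v lam) {x y : V} (hxy : x ≠ y) :
    (Summable fun w : twoPathConfigs G N x y => w.1.weight U v lam) ∧
    (Summable fun w : closedConfigs G N => w.1.weight U v lam * (w.1.numCycles x y : ℝ)) ∧
    mass U v lam (twoPathConfigs G N x y) ^ 2 ≤ (4 * (M ^ 2 * Real.exp (2 * vb + 2 * S))) ^ 2 *
      (∑' w : closedConfigs G N, w.1.weight U v lam * (w.1.numCycles x y : ℝ)) *
      (R * partitionFunction G N U v lam) ∧
    ∑' w : closedConfigs G N, w.1.weight U v lam * (w.1.numCycles x y : ℝ) ≤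
      2 * (R * partitionFunction G N U v lam) := by
  classical
  set Z := partitionFunction G N U v lam
  have hw0 : ∀ w : Config G N, 0 ≤ w.weight U v lam := Config.weight_nonneg hU v hlam
  have hRZ : 0 ≤ R * Z := by simpa using hmom x ∅
  have hcyc : ∀ T : Finset (closedConfigs G N),
      ∑ w ∈ T, w.1.weight U v lam * (w.1.numCycles x y : ℝ) ≤ 2 * (R * Z) := fun T => by
    refine le_trans ?_ (mul_le_mul_of_nonneg_left (hmom x T) zero_le_two)
    rw [Finset.mul_sum]
    refine Finset.sum_le_sum fun w _ => ?_
    have h1 : (w.1.numCycles x y : ℝ) ≤ 2 * (w.1.numPairings x : ℝ) := by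
      exact_mod_cast numCycles_le w.2 x y
    have h2 : (w.1.numPairings x : ℝ) ≤ Real.exp (2 * A * w.1.numPairings x) := by
      have h3 := Real.add_one_le_exp (2 * A * (w.1.numPairings x : ℝ))
      have h4 : 0 ≤ (w.1.numPairings x : ℝ) := Nat.cast_nonneg _
      nlinarith
    have h5 := mul_le_mul_of_nonneg_left (h1.trans (mul_le_mul_of_nonneg_left h2 zero_le_two))
      (hw0 w.1)
    linarith
  have hsumN : Summable fun w : closedConfigs G N =>
      w.1.weight U v lam * (w.1.numCycles x y : ℝ) :=
    summable_of_sum_le (fun w => mul_nonneg (hw0 w.1) (Nat.cast_nonneg _)) hcyc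
  set D := ∑' w : closedConfigs G N, w.1.weight U v lam * (w.1.numCycles x y : ℝ) with hD
  have hD0 : 0 ≤ D := tsum_nonneg fun w => mul_nonneg (hw0 w.1) (Nat.cast_nonneg _)
  set K := M ^ 2 * Real.exp (2 * vb + 2 * S) with hK
  have hK0 : 0 ≤ K := by positivity
  let a : V → ℝ := fun z => (if z = x then 2 * vb else 0) + (if z = y then 2 * vb else 0) +
    2 * |v x z| + 2 * |v y z|
  have ha0 : ∀ z, 0 ≤ a z := fun z => by
    have h1 := abs_nonneg (v x z)
    have h2 := abs_nonneg (v y z)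
    simp only [a]; split_ifs <;> linarith
  have hasum : ∑ z, a z ≤ A := by
    have : ∑ z, a z = 2 * vb + 2 * vb + 2 * ∑ z, |v x z| + 2 * ∑ z, |v y z| := by
      simp only [a, Finset.sum_add_distrib, Finset.sum_ite_eq', Finset.mem_univ, if_true,
        Finset.mul_sum]
    rw [this]
    linarith [hS x, hS y]
  obtain ⟨p, hp0, hp1, hp⟩ := exists_exp_sum_le (by linarith) ha0 hasum x
  let E : Config G N → ℝ := fun w => Real.exp (∑ z, a z * (w.numPairings z : ℝ))
  have hE2 : ∀ T : Finset (closedConfigs G N),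
      ∑ w ∈ T, w.1.weight U v lam * E w.1 ^ 2 ≤ R * Z := fun T => by
    calc ∑ w ∈ T, w.1.weight U v lam * E w.1 ^ 2
        ≤ ∑ w ∈ T, w.1.weight U v lam *
            ∑ z, p z * Real.exp (2 * A * w.1.numPairings z) := by
          refine Finset.sum_le_sum fun w _ => mul_le_mul_of_nonneg_left ?_ (hw0 w.1)
          have h := hp (fun z => 2 * (w.1.numPairings z : ℝ)) fun z => by positivity
          have e1 : E w.1 ^ 2 = Real.exp (∑ z, a z * (2 * (w.1.numPairings z : ℝ))) := by
            rw [sq, ← Real.exp_add, ← Finset.sum_add_distrib]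
            congr 1
            exact Finset.sum_congr rfl fun z _ => by ring
          rw [e1]
          refine h.trans_eq (Finset.sum_congr rfl fun z _ => ?_)
          congr 2; ring
      _ = ∑ z, p z * ∑ w ∈ T, w.1.weight U v lam *
            Real.exp (2 * A * w.1.numPairings z) := by
          simp only [Finset.mul_sum]
          rw [Finset.sum_comm]
          exact Finset.sum_congr rfl fun z _ => Finset.sum_congr rfl fun w _ => by ring
      _ ≤ ∑ z, p z * (R * Z) :=
          Finset.sum_le_sum fun z _ => mul_le_mul_of_nonneg_left (hmom z T) (hp0 z)
      _ = R * Z := by rw [← Finset.sum_mul, hp1, one_mul]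
  have hmain : ∀ T : Finset (twoPathConfigs G N x y),
      (∑ w ∈ T, w.1.weight U v lam) ^ 2 ≤ (4 * K) ^ 2 * D * (R * Z) := fun T => by
    obtain ⟨T', hT', hle⟩ := sum_twoPath_le hN hxy (fun w => w.weight U v lam)
      (fun w => K * (w.weight U v lam * E w) / ((w.numPairings x : ℝ) * (w.numPairings y : ℝ)))
      (fun w => div_nonneg (mul_nonneg hK0 (mul_nonneg (hw0 w) (Real.exp_nonneg _)))
        (by positivity)) (fun w w' hl hn hx hy => by
          have hpos : 0 < (w'.numPairings x : ℝ) * (w'.numPairings y : ℝ) :=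
            mul_pos (by exact_mod_cast hx) (by exact_mod_cast hy)
          rw [le_div_iff₀ hpos, mul_comm]
          exact weight_le_of_merge hU hM hlam hgood hsymm hS hxy hl hn) T
    have hle2 : ∑ w ∈ T, w.1.weight U v lam ≤ (4 * K) * ∑ w ∈ T', w.1.weight U v lam * E w.1 := by
      refine hle.trans ?_
      rw [Finset.mul_sum]
      refine Finset.sum_le_sum fun w _ => ?_
      have h0 : 0 ≤ K * (w.1.weight U v lam * E w.1) :=
        mul_nonneg hK0 (mul_nonneg (hw0 w.1) (Real.exp_nonneg _))
      by_cases hz : (w.1.numPairings x : ℝ) * (w.1.numPairings y : ℝ) = 0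
      · rw [hz, div_zero, mul_zero]; linarith
      · rw [mul_assoc 4, mul_assoc 4, mul_div_cancel₀ _ hz]; linarith
    have hCS := Finset.sum_sq_le_sum_mul_sum_of_sq_le_mul T'
      (r := fun w => w.1.weight U v lam * E w.1) (f := fun w => w.1.weight U v lam)
      (g := fun w => w.1.weight U v lam * E w.1 ^ 2) (fun w _ => hw0 w.1)
      (fun w _ => mul_nonneg (hw0 w.1) (sq_nonneg _)) fun w _ => le_of_eq (by ring)
    have hf : ∑ w ∈ T', w.1.weight U v lam ≤ D := by
      refine le_trans (Finset.sum_le_sum fun w hw => ?_)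
        (hsumN.sum_le_tsum T' fun w _ => mul_nonneg (hw0 w.1) (Nat.cast_nonneg _))
      exact le_mul_of_one_le_right (hw0 w.1) (by exact_mod_cast hT' w hw)
    have hT0 : 0 ≤ ∑ w ∈ T, w.1.weight U v lam := Finset.sum_nonneg fun w _ => hw0 w.1
    calc (∑ w ∈ T, w.1.weight U v lam) ^ 2
        ≤ ((4 * K) * ∑ w ∈ T', w.1.weight U v lam * E w.1) ^ 2 := pow_le_pow_left₀ hT0 hle2 2
      _ = (4 * K) ^ 2 * (∑ w ∈ T', w.1.weight U v lam * E w.1) ^ 2 := by rw [mul_pow]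
      _ ≤ (4 * K) ^ 2 * (D * (R * Z)) := by
          refine mul_le_mul_of_nonneg_left (hCS.trans ?_) (sq_nonneg _)
          exact mul_le_mul hf (hE2 T') (Finset.sum_nonneg fun w _ =>
            mul_nonneg (hw0 w.1) (sq_nonneg _)) hD0
      _ = (4 * K) ^ 2 * D * (R * Z) := by ring
  have hsqrt : ∀ T : Finset (twoPathConfigs G N x y),
      ∑ w ∈ T, w.1.weight U v lam ≤ Real.sqrt ((4 * K) ^ 2 * D * (R * Z)) := fun T =>
    Real.le_sqrt_of_sq_le (hmain T)
  have hsum2 : Summable fun w : twoPathConfigs G N x y => w.1.weight U v lam :=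
    summable_of_sum_le (fun w => hw0 w.1) hsqrt
  refine ⟨hsum2, hsumN, ?_, hsumN.tsum_le_of_sum_le hcyc⟩
  have h1 : mass U v lam (twoPathConfigs G N x y) ≤ Real.sqrt ((4 * K) ^ 2 * D * (R * Z)) :=
    hsum2.tsum_le_of_sum_le hsqrt
  have h2 : 0 ≤ mass U v lam (twoPathConfigs G N x y) := tsum_nonneg fun w => hw0 w.1
  calc _ ≤ Real.sqrt ((4 * K) ^ 2 * D * (R * Z)) ^ 2 := pow_le_pow_left₀ h2 h1 2
    _ = _ := Real.sq_sqrt (by positivity)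

end TwoPoint

end RandomPath
end

theorem proposition5 (d N : ℕ) (hd : 1 ≤ d) (hN : 2 ≤ N) (lam : ℝ) (hlam : 0 < lam)
    (v : (Fin d → ℤ) → ℝ) (hv_symm : ∀ x, v x = v (-x))
    (hv_tempered : RandomPath.IsTempered v) (hv_separable : RandomPath.IsSeparable v)
    (U : ℕ → ℝ) (hU_nonneg : ∀ n, 0 ≤ U n) (hU_ne : ∃ n, U n ≠ 0)
    (hU_good : RandomPath.IsGood v U) :
    ∃ c : ℝ, 0 < c ∧ ∀ (L : ℕ) [NeZero L], Even L →
      -- the probability measure of the model on the torus is well defined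
      ((Summable fun w : RandomPath.closedConfigs (RandomPath.torusGraph d L) N =>
          w.1.weight U (RandomPath.periodised v L) lam) ∧
        0 < RandomPath.partitionFunction (RandomPath.torusGraph d L) N U
          (RandomPath.periodised v L) lam) ∧
      ∀ x y : RandomPath.Torus d L, x ≠ y →
        -- the two-point function and the expectation are finite
        (Summable fun w : RandomPath.twoPathConfigs (RandomPath.torusGraph d L) N x y =>
          w.1.weight U (RandomPath.periodised v L) lam) ∧
        (Summable fun w : RandomPath.closedConfigs (RandomPath.torusGraph d L) N =>
          w.1.weight U (RandomPath.periodised v L) lam * (w.1.numCycles x y : ℝ)) ∧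
        -- the inequality
        c * RandomPath.twoPoint (RandomPath.torusGraph d L) N U
            (RandomPath.periodised v L) lam x y ^ 4 ≤
          RandomPath.expectation (G := RandomPath.torusGraph d L) (N := N) U
            (RandomPath.periodised v L) lam (fun w => (w.numCycles x y : ℝ)) := by
  classical
  obtain ⟨M₀, hM₀⟩ := hU_good
  set M := max M₀ 1 with hM
  have hM1 : 1 ≤ M := le_max_right _ _
  have hgood : ∀ n : ℕ,
      (n : ℝ) * (U (n + 1) * Real.exp (-RandomPath.vbar v * ((n + 1 : ℕ) : ℝ) ^ 2)) ≤
        M * (U n * Real.exp (-RandomPath.vbar v * (n : ℝ) ^ 2)) := fun n =>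
    (hM₀ n).trans (mul_le_mul_of_nonneg_right (le_max_left _ _)
      (mul_nonneg (hU_nonneg n) (Real.exp_nonneg _)))
  set S := ∑' x, |v x| with hS
  have hS0 : 0 ≤ S := tsum_nonneg fun _ => abs_nonneg _
  have hvb := hv_tempered.1
  set A := 4 * RandomPath.vbar v + 4 * S + 1 with hA
  obtain ⟨R, hR, hmom⟩ := RandomPath.exists_exp_moment_bound hd (by omega : 0 < N) hlam hv_symm
    hv_tempered hv_separable hU_nonneg hU_ne ⟨M₀, hM₀⟩ (B := 2 * A) (by linarith)
  set K := 4 * (M ^ 2 * Real.exp (2 * RandomPath.vbar v + 2 * S)) with hK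
  have hK0 : 0 < K := by positivity
  refine ⟨(2 * lam ^ 8 * K ^ 4 * R ^ 3)⁻¹, by positivity, fun L _ hL => ?_⟩
  obtain ⟨⟨hsum, hZ⟩, hmomL⟩ := hmom L hL
  refine ⟨⟨hsum, hZ⟩, fun x y hxy => ?_⟩
  obtain ⟨h1, h2, h3, h4⟩ := RandomPath.mass_twoPath_sq_le hN hU_nonneg (by linarith) hlam.le hvb
    hgood (fun a b => by
      rw [RandomPath.periodised_eq, RandomPath.periodised_eq,
        ← RandomPath.periodisedDiff_neg hv_symm, neg_sub])
    (RandomPath.sum_abs_periodised_le hv_tempered.2) (by linarith) (by linarith) hmomL hxy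
  refine ⟨h1, h2, ?_⟩
  unfold RandomPath.twoPoint RandomPath.expectation
  set Z := RandomPath.partitionFunction (RandomPath.torusGraph d L) N U
    (RandomPath.periodised v L) lam
  set m := RandomPath.mass U (RandomPath.periodised v L) lam
    (RandomPath.twoPathConfigs (RandomPath.torusGraph d L) N x y)
  set D := ∑' w : RandomPath.closedConfigs (RandomPath.torusGraph d L) N,
    w.1.weight U (RandomPath.periodised v L) lam * (w.1.numCycles x y : ℝ)
  have hD0 : 0 ≤ D := tsum_nonneg fun w =>
    mul_nonneg (RandomPath.Config.weight_nonneg hU_nonneg _ hlam.le w.1) (Nat.cast_nonneg _)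
  have h5 : (m / Z) ^ 2 ≤ K ^ 2 * R * (D / Z) := by
    rw [div_pow, div_le_iff₀ (by positivity)]
    have h3' : m ^ 2 ≤ K ^ 2 * D * (R * Z) := h3
    refine h3'.trans_eq ?_
    field_simp
  have h6 : D / Z ≤ 2 * R := by
    rw [div_le_iff₀ hZ]; linarith
  have h7 : 0 ≤ D / Z := div_nonneg hD0 hZ.le
  rw [inv_mul_le_iff₀ (by positivity)]
  calc (lam ^ 2 * (m / Z)) ^ 4 = lam ^ 8 * ((m / Z) ^ 2) ^ 2 := by ring
    _ ≤ lam ^ 8 * (K ^ 2 * R * (D / Z)) ^ 2 := by gcongr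
    _ = lam ^ 8 * K ^ 4 * R ^ 2 * (D / Z) * (D / Z) := by ring
    _ ≤ lam ^ 8 * K ^ 4 * R ^ 2 * (2 * R) * (D / Z) := by gcongr
    _ = _ := by ring
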